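/- Let $m\ge 2$, $\mathrm M=\{1,\dots,m\}$, $\mathrm N=\{2,\dots,m\}$, and let multi-indices $i=(i^1,\dots,i^m)$ range over $\mathbb I=\mathbb Z_+^m$; write $i=(i^1,j)$ with $j\in\mathbb J=\mathbb Z_+^{\mathrm N}$, and let $(\mu)$ be the multi-index with $1$ in place $\mu$ and $0$ elsewhere. Repeated indices are summed. Let $\mathbf B$ be the space of all real points $(x^\mu,u^\mu_i,p_i)$ ($\mu\in\mathrm M$, $i\in\mathbb I$), $\mathcal A(\mathbf B)$ the algebra of smooth functions of finitely many of these coordinates, and $$D_\mu=\partial_{x^\mu}+u^\lambda_{i+(\mu)}\partial_{u^\lambda_i}+p_{i+(\mu)}\partial_{p_i}.$$ Let $\mathbf{CE}=\{u^\mu_{i+(\mu)}=0\text{ for all }i\in\mathbb I\}\subset\mathbf B$, let $\mathcal I$ be the (differential) ideal of the functions in $\mathcal A(\mathbf B)$ vanishing on $\mathbf{CE}$, and let $\mathcal A=\mathcal A(\mathbf{CE})=\mathcal A(\mathbf B)/\mathcal I$ with the induced commuting derivations $D_\mu$. The coordinates $x^\mu$, $u^1_{0,j}$, $u^\alpha_i$,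 $p_i$ ($\alpha\in\mathrm N$, $j\in\mathbb J$, $i\in\mathbb I$) are global coordinates on $\mathbf{CE}$, and identify $\mathcal A$ with the smooth functions of finitely many of them. Let $\Omega^q$ be the space of horizontal $q$-forms $\omega_{\mu_1\dots\mu_q}dx^{\mu_1}\wedge\dots\wedge dx^{\mu_q}$ with coefficients in $\mathcal A$ ($\Omega^q=0$ for $q<0$ and $q>m$), $d_{\mathrm H}=dx^\mu\wedge D_\mu$, and $H^q_{\mathrm H}(\mathbf{CE})=\ker d^q_{\mathrm H}/\operatorname{im}d^{q-1}_{\mathrm H}$. Let $\Theta^q$ be the space of forms $\theta_{\alpha_1\dots\alpha_q}dx^{\alpha_1}\wedge\dots\wedge dx^{\alpha_q}$, $\alpha_1,\dots,\alpha_q\in\mathrm N$, with coefficients in $\mathcal A$, $d_\Theta=dx^\alpha\wedge D_\alpha$ (sum over $\alpha\in\mathrm N$), and $H^q(\Theta)=\ker d^q_\Theta/\operatorname{im}d^{q-1}_\Theta$. The derivation $D_1$, applied to coefficients, induces $D_1^q:H^q(\Theta)\to H^q(\Theta)$. Put $d_\mu x=(-1)^{\mu-1}dx^1\wedge\dots\widehat{dx^\mu}\dots\wedge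 dx^m$, $\pi:\Omega^q\to\Theta^q$, $dx^1\wedge\theta'+\theta\mapsto\theta$, and $\iota:\Theta^q\to\Omega^{q+1}$, $\theta\mapsto(-1)^q dx^1\wedge\theta$. Consider families $\chi=(\chi^0_1,\chi^k_\alpha,\chi^k)_{\alpha\in\mathrm N,\,k\ge0}$ of elements of $\mathcal A$ with finitely many nonzero components. The components are indexed by the dependent variables $a\in\{u^1_0,u^\alpha_k,p_k\}$, whose derivatives in the directions of $\mathrm N$ are the coordinates $a_j\in\{u^1_{0,j},u^\alpha_{k,j},p_{k,j}\}$, $j\in\mathbb J$. Put $D_j=\prod_{\alpha\in\mathrm N}D_\alpha^{j^\alpha}$ and $(-D)_j=\prod_{\alpha\in\mathrm N}(-D_\alpha)^{j^\alpha}$. Let $$\mathcal H(\Theta)=\{\chi\mid\chi_*=\chi^*\},\quad (\chi_*f)_a=\sum_{b,j}\partial_{b_j}\chi_a\cdot D_jf_b,\quad (\chi^*f)_a=\sum_{b,j}(-D)_j\big(f_b\,\partial_{a_j}\chi_b\big)$$ (equality for all families $f=(f_b)$ in $\mathcal A$), $(\delta L)_a=\sum_j(-D)_j\partial_{a_j}L$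 for $L\in\mathcal A$, and $$(\tilde D_1\chi)^0_1=D_1\chi^0_1,\quad (\tilde D_1\chi)^k_\alpha=D_1\chi^k_\alpha+\delta^k_0D_\alpha\chi^0_1+\chi^{k-1}_\alpha,\quad (\tilde D_1\chi)^k=D_1\chi^k+\chi^{k-1},$$ where $\chi^{-1}_\alpha=\chi^{-1}=0$. **Theorem.** The horizontal cohomology spaces of $\mathbf{CE}$ are as follows. 1. $H^q_{\mathrm H}(\mathbf{CE})=0$ for $q<0$, for $1\le q\le m-2$ and for $q>m$. 2. $H^0_{\mathrm H}(\mathbf{CE})=\mathbb R$, the constant functions. 3. $[\omega]\mapsto[\pi\omega]$ is a linear isomorphism $H^{m-1}_{\mathrm H}(\mathbf{CE})\simeq\ker D_1^{m-1}$, and $H^{m-1}_{\mathrm H}(\mathbf{CE})=\mathbb R\cdot[u^\mu d_\mu x]$ is one-dimensional. 4. $[\theta]\mapsto[\iota\theta]$ induces a linear isomorphism $H^{m-1}(\Theta)/\operatorname{im}D_1^{m-1}\simeq H^m_{\mathrm H}(\mathbf{CE})$. 5. $[L\,dx^2\wedge\dots\wedge dx^m]\mapsto\delta L$ is a linear isomorphism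 $H^{m-1}(\Theta)\simeq\mathcal H(\Theta)$, the operator $\tilde D_1$ maps $\mathcal H(\Theta)$ into itself, and the isomorphism induces an isomorphism $H^{m-1}(\Theta)/\operatorname{im}D_1^{m-1}\simeq\mathcal H(\Theta)/\tilde D_1\mathcal H(\Theta)$. -/

import Mathlib

open scoped ContDiff

noncomputable section

namespace DivFree

/-! ### Smooth functions of finite order on a space of real sequences -/

/-- `f` depends, smoothly, on finitely many of the coordinates indexed by `V`. -/
def IsFinSmooth {V : Type} (f : (V → ℝ) → ℝ) : Prop :=
  ∃ (S : Finset V) (g : (S → ℝ) → ℝ), ContDiff ℝ ∞ g ∧ ∀ b, f b = g (fun s => b s)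

theorem IsFinSmooth.of_contDiff {V : Type} [Fintype V] {f : (V → ℝ) → ℝ}
    (hf : ContDiff ℝ ∞ f) : IsFinSmooth f := by
  refine ⟨Finset.univ, fun y => f (fun v => y ⟨v, Finset.mem_univ v⟩), ?_, fun b => rfl⟩
  exact hf.comp (contDiff_pi.2 fun v => contDiff_apply ℝ ℝ _)

theorem IsFinSmooth.comp {V W : Type} {f : (V → ℝ) → ℝ} {φ : (W → ℝ) → V → ℝ}
    (hf : IsFinSmooth f) (hφ : ∀ v, IsFinSmooth fun b => φ b v) :
    IsFinSmooth fun b => f (φ b) := by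
  classical
  obtain ⟨S, g, hg, hfg⟩ := hf
  choose T G hG hφG using hφ
  refine ⟨S.biUnion T, fun y => g fun s => G s fun t =>
    y ⟨t, Finset.mem_biUnion.2 ⟨s, s.2, t.2⟩⟩, ?_, fun b => ?_⟩
  · exact hg.comp (contDiff_pi.2 fun s => (hG s).comp
      (contDiff_pi.2 fun t => contDiff_apply ℝ ℝ _))
  · simp only [hfg, hφG]

theorem IsFinSmooth.const {V : Type} (c : ℝ) : IsFinSmooth fun _ : V → ℝ => c :=
  ⟨∅, fun _ => c, contDiff_const, fun _ => rfl⟩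

theorem IsFinSmooth.coord {V : Type} (v : V) : IsFinSmooth fun b : V → ℝ => b v :=
  ⟨{v}, fun y => y ⟨v, Finset.mem_singleton_self v⟩, contDiff_apply ℝ ℝ _, fun _ => rfl⟩

theorem IsFinSmooth.add {V : Type} {f g : (V → ℝ) → ℝ} (hf : IsFinSmooth f)
    (hg : IsFinSmooth g) : IsFinSmooth fun b => f b + g b := by
  have h : IsFinSmooth fun y : Fin 2 → ℝ => y 0 + y 1 :=
    .of_contDiff ((contDiff_apply ℝ ℝ _).add (contDiff_apply ℝ ℝ _))
  have := h.comp (φ := fun b : V → ℝ => ![f b, g b]) (fun v => by fin_cases v <;> assumption)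
  simpa using this

theorem IsFinSmooth.mul {V : Type} {f g : (V → ℝ) → ℝ} (hf : IsFinSmooth f)
    (hg : IsFinSmooth g) : IsFinSmooth fun b => f b * g b := by
  have h : IsFinSmooth fun y : Fin 2 → ℝ => y 0 * y 1 :=
    .of_contDiff ((contDiff_apply ℝ ℝ _).mul (contDiff_apply ℝ ℝ _))
  have := h.comp (φ := fun b : V → ℝ => ![f b, g b]) (fun v => by fin_cases v <;> assumption)
  simpa using this

theorem IsFinSmooth.neg {V : Type} {f : (V → ℝ) → ℝ} (hf : IsFinSmooth f) :
    IsFinSmooth fun b => -f b := by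
  simpa using (IsFinSmooth.const (V := V) (-1)).mul hf

theorem IsFinSmooth.sum {V ι : Type} (s : Finset ι) {f : ι → (V → ℝ) → ℝ}
    (hf : ∀ i, IsFinSmooth (f i)) : IsFinSmooth fun b => ∑ i ∈ s, f i b := by
  classical
  induction s using Finset.induction_on with
  | empty => simpa using IsFinSmooth.const (V := V) 0
  | insert a s ha ih => simpa [Finset.sum_insert ha] using (hf a).add ih

/-- The algebra `C^∞_fin(ℝ^V)` of smooth real functions of finite order in the
coordinates indexed by `V`. -/
def FinSmooth (V : Type) : Subalgebra ℝ ((V → ℝ) → ℝ) where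
  carrier := {f | IsFinSmooth f}
  mul_mem' hf hg := IsFinSmooth.mul hf hg
  add_mem' hf hg := IsFinSmooth.add hf hg
  algebraMap_mem' c := IsFinSmooth.const c

/-- Pull-back along a map all of whose components are smooth of finite order. -/
def pullback {V W : Type} (φ : (W → ℝ) → V → ℝ) (hφ : ∀ v, IsFinSmooth fun b => φ b v) :
    FinSmooth V →ₐ[ℝ] FinSmooth W where
  toFun f := ⟨fun b => f.1 (φ b), IsFinSmooth.comp f.2 hφ⟩
  map_one' := rfl
  map_mul' _ _ := rfl
  map_zero' := rfl
  map_add' _ _ := rfl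
  commutes' _ := rfl

/-- The coordinate function `v`. -/
def coord {V : Type} (v : V) : FinSmooth V := ⟨fun b => b v, IsFinSmooth.coord v⟩

/-! ### Partial derivatives -/

open Classical in
/-- The partial derivative of a function on `ℝ^V` with respect to the coordinate `v`. -/
def pderivFun {V : Type} (v : V) (f : (V → ℝ) → ℝ) (b : V → ℝ) : ℝ :=
  deriv (fun t : ℝ => f (Function.update b v t)) (b v)

open Classical in
/-- the unit vector in the direction `v`, seen in the coordinates in `S` -/
def unitVec {V : Type} (S : Finset V) (v : V) : S → ℝ := fun s => if (s : V) = v then 1 else 0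

theorem pderivFun_eq {V : Type} {S : Finset V} {g : (S → ℝ) → ℝ} {f : (V → ℝ) → ℝ}
    (hg : ContDiff ℝ ∞ g) (hf : ∀ b, f b = g (fun s => b s)) (v : V) (b : V → ℝ) :
    pderivFun v f b = fderiv ℝ g (fun s => b s) (unitVec S v) := by
  classical
  have h1 : (fun t : ℝ => f (Function.update b v t)) =
      fun t : ℝ => g ((fun s : S => b s) + (t - b v) • unitVec S v) := by
    funext t
    rw [hf]
    congr 1
    funext s
    by_cases h : (s : V) = v
    · subst h; simp [unitVec]
    · simp [unitVec, h]
  have h2 : HasDerivAt (fun t : ℝ => (fun s : S => b s) + (t - b v) • unitVec S v)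
      ((1 : ℝ) • unitVec S v) (b v) :=
    (((hasDerivAt_id (b v)).sub_const (b v)).smul_const _).const_add _
  have h3 : HasFDerivAt g (fderiv ℝ g (fun s => b s))
      ((fun s : S => b s) + (b v - b v) • unitVec S v) := by
    simpa using (hg.differentiable (by simp)).differentiableAt.hasFDerivAt
  unfold pderivFun
  rw [h1]
  have h4 := (h3.comp_hasDerivAt (b v) h2).deriv
  rw [one_smul] at h4
  exact h4

theorem contDiff_fderiv_apply {S : Type} [Fintype S] {g : (S → ℝ) → ℝ} (hg : ContDiff ℝ ∞ g)
    (w : S → ℝ) : ContDiff ℝ ∞ fun y => fderiv ℝ g y w :=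
  (hg.fderiv_right (m := ∞) (by simp)).clm_apply contDiff_const

theorem IsFinSmooth.pderivFun {V : Type} {f : (V → ℝ) → ℝ} (hf : IsFinSmooth f) (v : V) :
    IsFinSmooth (DivFree.pderivFun v f) := by
  obtain ⟨S, g, hg, hfg⟩ := hf
  exact ⟨S, _, contDiff_fderiv_apply hg (unitVec S v), fun b => pderivFun_eq hg hfg v b⟩

/-- A finite set of coordinates on which `f` depends smoothly, that is `f = g ∘ restriction`. -/
def DependsOn {V : Type} (S : Finset V) (f : (V → ℝ) → ℝ) : Prop :=
  ∃ g : (S → ℝ) → ℝ, ContDiff ℝ ∞ g ∧ ∀ b, f b = g (fun s => b s)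

theorem DependsOn.mono {V : Type} {S T : Finset V} {f : (V → ℝ) → ℝ} (h : S ⊆ T)
    (hf : DependsOn S f) : DependsOn T f := by
  obtain ⟨g, hg, hfg⟩ := hf
  exact ⟨fun y => g fun s => y ⟨s, h s.2⟩,
    hg.comp (contDiff_pi.2 fun s => contDiff_apply ℝ ℝ _), hfg⟩

theorem DependsOn.pderivFun {V : Type} {S : Finset V} {f : (V → ℝ) → ℝ}
    (hf : DependsOn S f) (v : V) : DependsOn S (DivFree.pderivFun v f) := by
  obtain ⟨g, hg, hfg⟩ := hf
  exact ⟨_, contDiff_fderiv_apply hg (unitVec S v), fun b => pderivFun_eq hg hfg v b⟩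

theorem DependsOn.pderivFun_eq_zero {V : Type} {S : Finset V} {f : (V → ℝ) → ℝ}
    (hf : DependsOn S f) {v : V} (hv : v ∉ S) : DivFree.pderivFun v f = 0 := by
  obtain ⟨g, hg, hfg⟩ := hf
  funext b
  have : unitVec S v = 0 := by
    funext s
    have : (s : V) ≠ v := fun h => hv (h ▸ s.2)
    simp [unitVec, this]
  rw [pderivFun_eq hg hfg, this]
  simp

/-- The partial derivative as an operator on the smooth functions of finite order. -/
def pderiv {V : Type} (v : V) : FinSmooth V →ₗ[ℝ] FinSmooth V where
  toFun f := ⟨pderivFun v f.1, IsFinSmooth.pderivFun f.2 v⟩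
  map_add' f g := by
    classical
    obtain ⟨S, hS⟩ := f.2
    obtain ⟨T, hT⟩ := g.2
    obtain ⟨a, ha, hfa⟩ := DependsOn.mono (Finset.subset_union_left (s₂ := T)) hS
    obtain ⟨c, hc, hgc⟩ := DependsOn.mono (Finset.subset_union_right (s₁ := S)) hT
    ext b
    change pderivFun v (f.1 + g.1) b = pderivFun v f.1 b + pderivFun v g.1 b
    rw [pderivFun_eq ha hfa, pderivFun_eq hc hgc,
      pderivFun_eq (ha.add hc) (fun b => by simp [hfa, hgc]),
      fderiv_fun_add (ha.differentiable (by simp)).differentiableAt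
        (hc.differentiable (by simp)).differentiableAt]
    rfl
  map_smul' r f := by
    obtain ⟨S, a, ha, hfa⟩ := f.2
    ext b
    change pderivFun v (r • f.1) b = r * pderivFun v f.1 b
    rw [pderivFun_eq ha hfa, pderivFun_eq (g := fun y => r * a y) (contDiff_const.mul ha)
      (fun b => by simp [hfa]), fderiv_const_mul (ha.differentiable (by simp)).differentiableAt]
    rfl

theorem pderiv_mul {V : Type} (v : V) (f g : FinSmooth V) :
    pderiv v (f * g) = f * pderiv v g + g * pderiv v f := by
  classical
  obtain ⟨S, hS⟩ := f.2
  obtain ⟨T, hT⟩ := g.2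
  obtain ⟨a, ha, hfa⟩ := DependsOn.mono (Finset.subset_union_left (s₂ := T)) hS
  obtain ⟨c, hc, hgc⟩ := DependsOn.mono (Finset.subset_union_right (s₁ := S)) hT
  ext b
  change pderivFun v (f.1 * g.1) b = f.1 b * pderivFun v g.1 b + g.1 b * pderivFun v f.1 b
  rw [pderivFun_eq ha hfa, pderivFun_eq hc hgc,
    pderivFun_eq (g := fun y => a y * c y) (ha.mul hc) (fun b => by simp [hfa, hgc]),
    fderiv_fun_mul (ha.differentiable (by simp)).differentiableAt
      (hc.differentiable (by simp)).differentiableAt, hfa b, hgc b]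
  rfl

theorem pderiv_comm {V : Type} (v w : V) (f : FinSmooth V) :
    pderiv v (pderiv w f) = pderiv w (pderiv v f) := by
  obtain ⟨S, a, ha, hfa⟩ := f.2
  ext b
  change pderivFun v (pderivFun w f.1) b = pderivFun w (pderivFun v f.1) b
  have key : ∀ x y : S → ℝ, fderiv ℝ (fun z => fderiv ℝ a z x) (fun s => b s) y =
      fderiv ℝ (fderiv ℝ a) (fun s => b s) y x := by
    intro x y
    have hd : DifferentiableAt ℝ (fderiv ℝ a) (fun s => b s) :=
      ((ha.fderiv_right (m := ∞) (by simp)).differentiable (by simp)).differentiableAt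
    rw [fderiv_clm_apply hd (differentiableAt_const x)]
    simp
  rw [pderivFun_eq (contDiff_fderiv_apply ha (unitVec S w)) (fun b => pderivFun_eq ha hfa w b),
    pderivFun_eq (contDiff_fderiv_apply ha (unitVec S v)) (fun b => pderivFun_eq ha hfa v b),
    key, key]
  exact (ha.contDiffAt.isSymmSndFDerivAt
    (by simpa using WithTop.coe_le_coe.2 (le_top (a := (2 : ℕ∞))))).eq _ _

open Classical in
theorem pderiv_coord {V : Type} (v w : V) :
    pderiv v (coord w) = if v = w then 1 else 0 := by
  ext b
  have h0 : (pderiv v (coord w)).1 b =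
    deriv (fun t : ℝ => Function.update b v t w) (b v) := rfl
  rw [h0]
  by_cases h : v = w
  · subst h; simp
  · simp [h, Ne.symm h]

theorem pderiv_support_finite {V : Type} (f : FinSmooth V) :
    {v | pderiv v f ≠ 0}.Finite := by
  obtain ⟨S, hS⟩ := f.2
  refine S.finite_toSet.subset fun v hv => ?_
  by_contra h
  exact hv (Subtype.ext (DependsOn.pderivFun_eq_zero hS h))

/-! ### Derivations with given coefficients -/

/-- The operator `∑_v c_v ∂_v`; the sum is finite on every function of finite order. -/
def vectorField {V : Type} (c : V → FinSmooth V) : FinSmooth V →ₗ[ℝ] FinSmooth V where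
  toFun f := ∑ᶠ v, c v * pderiv v f
  map_add' f g := by
    rw [← finsum_add_distrib]
    · simp [mul_add]
    · exact (pderiv_support_finite f).subset fun v hv h => hv (by simp [h])
    · exact (pderiv_support_finite g).subset fun v hv h => hv (by simp [h])
  map_smul' r f := by
    rw [RingHom.id_apply, smul_finsum' r
      ((pderiv_support_finite f).subset fun v hv h => hv (by simp [h]))]
    simp

theorem vectorField_eq_sum {V : Type} (c : V → FinSmooth V) {S : Finset V} {f : FinSmooth V}
    (hf : DependsOn S f.1) : vectorField c f = ∑ v ∈ S, c v * pderiv v f := by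
  change ∑ᶠ v, c v * pderiv v f = _
  refine finsum_eq_sum_of_support_subset _ fun v hv => ?_
  by_contra h
  exact hv (by
    have : pderiv v f = 0 := Subtype.ext (DependsOn.pderivFun_eq_zero hf h)
    simp [this])

theorem vectorField_mul {V : Type} (c : V → FinSmooth V) (f g : FinSmooth V) :
    vectorField c (f * g) = f * vectorField c g + g * vectorField c f := by
  have h1 := (pderiv_support_finite f)
  have h2 := (pderiv_support_finite g)
  change ∑ᶠ v, c v * pderiv v (f * g) =
    f * (∑ᶠ v, c v * pderiv v g) + g * ∑ᶠ v, c v * pderiv v f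
  rw [mul_finsum' _ _ (h2.subset fun v hv h => hv (by simp [h])),
    mul_finsum' _ _ (h1.subset fun v hv h => hv (by simp [h])),
    ← finsum_add_distrib
      (h2.subset fun v hv h => hv (by simp [h])) (h1.subset fun v hv h => hv (by simp [h]))]
  exact finsum_congr fun v => by rw [pderiv_mul]; ring

theorem vectorField_coord {V : Type} (c : V → FinSmooth V) (w : V) :
    vectorField c (coord w) = c w := by
  classical
  change ∑ᶠ v, c v * pderiv v (coord w) = _
  rw [finsum_eq_single _ w (fun v hv => by simp [pderiv_coord, hv])]
  simp [pderiv_coord]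

theorem vectorField_comm {V : Type} {c e : V → FinSmooth V}
    (h : ∀ v, vectorField c (e v) = vectorField e (c v)) (f : FinSmooth V) :
    vectorField c (vectorField e f) = vectorField e (vectorField c f) := by
  obtain ⟨S, hS⟩ := f.2
  have hv : ∀ v, DependsOn S (pderiv v f).1 := fun v => DependsOn.pderivFun hS v
  have key : ∀ c e : V → FinSmooth V, vectorField c (vectorField e f) =
      ∑ v ∈ S, vectorField c (e v) * pderiv v f +
        ∑ v ∈ S, ∑ w ∈ S, e v * (c w * pderiv w (pderiv v f)) := by
    intro c e
    rw [vectorField_eq_sum e hS, map_sum, ← Finset.sum_add_distrib]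
    refine Finset.sum_congr rfl fun v _ => ?_
    rw [vectorField_mul, vectorField_eq_sum c (hv v), Finset.mul_sum]
    ring
  rw [key c e, key e c, Finset.sum_comm]
  congr 1
  · exact Finset.sum_congr rfl fun v _ => by rw [h]
  · exact Finset.sum_congr rfl fun v _ => Finset.sum_congr rfl fun w _ => by
      rw [pderiv_comm]; ring

/-- A vector field evaluated at a point is a derivative along a straight line. -/
theorem vectorField_apply {V : Type} (c : V → FinSmooth V) (f : FinSmooth V) (b : V → ℝ) :
    (vectorField c f).1 b = deriv (fun t : ℝ => f.1 fun v => b v + t * (c v).1 b) 0 := by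
  classical
  obtain ⟨S, g, hg, hfg⟩ := f.2
  rw [vectorField_eq_sum c ⟨g, hg, hfg⟩]
  have h2 : HasDerivAt (fun t : ℝ => (fun s : S => b s) + t • fun s : S => (c s).1 b)
      ((1 : ℝ) • fun s : S => (c s).1 b) 0 :=
    ((hasDerivAt_id (0 : ℝ)).smul_const _).const_add _
  have h3 : HasFDerivAt g (fderiv ℝ g (fun s => b s))
      ((fun s : S => b s) + (0 : ℝ) • fun s : S => (c s).1 b) := by
    simpa using (hg.differentiable (by simp)).differentiableAt.hasFDerivAt
  have h4 := (h3.comp_hasDerivAt (0 : ℝ) h2).deriv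
  have h5 : (fun t : ℝ => f.1 fun v => b v + t * (c v).1 b) =
      g ∘ fun t : ℝ => (fun s : S => b s) + t • fun s : S => (c s).1 b := by
    funext t
    rw [hfg]
    rfl
  rw [h5, h4, one_smul]
  have h6 : (fun s : S => (c s).1 b) = ∑ s : S, (c s).1 b • unitVec S (s : V) := by
    funext s
    simp [unitVec, Finset.sum_apply]
  rw [h6, map_sum]
  rw [← Finset.sum_coe_sort S]
  have h7 : (∑ s : S, c s * pderiv (s : V) f).1 b =
      ∑ s : S, (c s).1 b * (pderiv (s : V) f).1 b := by
    rw [AddSubmonoidClass.coe_finsetSum]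
    simp [Finset.sum_apply]
  rw [h7]
  refine Finset.sum_congr rfl fun s _ => ?_
  rw [map_smul, smul_eq_mul]
  congr 1
  exact pderivFun_eq hg hfg _ _

/-! ### The base space and the solution manifold of the continuity equation -/

/-- The coordinates on the base space `B`: the independent variables `x^μ`, the velocity
variables `u^l_i` and the pressure variables `p_i`, where `i` is a multi-index. -/
inductive BVar (m : ℕ) : Type
  | x (μ : Fin m) : BVar m
  | u (l : Fin m) (i : Fin m → ℕ) : BVar m
  | p (i : Fin m → ℕ) : BVar m

/-- The algebra of smooth functions of finite order on the base space `B`. -/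
abbrev AB (m : ℕ) : Type := FinSmooth (BVar m)

/-- The coefficients of the total derivative `D_μ`. -/
def totalCoeff {m : ℕ} (μ : Fin m) : BVar m → AB m
  | .x ν => if ν = μ then 1 else 0
  | .u l i => coord (.u l (i + Pi.single μ 1))
  | .p i => coord (.p (i + Pi.single μ 1))

/-- The total derivative
`D_μ = ∂_{x^μ} + u^l_{i+(μ)} ∂_{u^l_i} + p_{i+(μ)} ∂_{p_i}` on the base space. -/
def DB {m : ℕ} (μ : Fin m) : AB m →ₗ[ℝ] AB m := vectorField (totalCoeff μ)

theorem DB_comm {m : ℕ} (μ ν : Fin m) (f : AB m) : DB μ (DB ν f) = DB ν (DB μ f) := by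
  have h0 : ∀ c : BVar m → AB m, vectorField c 1 = 0 := by
    intro c
    have := vectorField_mul c 1 1
    simpa using this
  refine vectorField_comm (fun v => ?_) f
  cases v with
  | x l => simp only [totalCoeff]; split_ifs <;> simp [h0]
  | u l i =>
    simp only [totalCoeff, vectorField_coord]
    rw [add_right_comm]
  | p i =>
    simp only [totalCoeff, vectorField_coord]
    rw [add_right_comm]

/-- The solution manifold `CE = {u^μ_{i+(μ)} = 0 for all i}` of the continuity equation. -/
def solManifold (m : ℕ) : Set (BVar m → ℝ) :=
  {b | ∀ i : Fin m → ℕ, ∑ μ, b (.u μ (i + Pi.single μ 1)) = 0}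

/-- The ideal of the functions that vanish on `CE`. -/
def idealCE (m : ℕ) : Ideal (AB m) where
  carrier := {f | ∀ b ∈ solManifold m, f.1 b = 0}
  add_mem' {f g} hf hg b hb := by
    change f.1 b + g.1 b = 0
    rw [hf b hb, hg b hb, add_zero]
  zero_mem' _ _ := rfl
  smul_mem' c f hf b hb := by
    change c.1 b * f.1 b = 0
    rw [hf b hb, mul_zero]

/-- The ideal of `CE` is differential. -/
theorem DB_mem_idealCE {m : ℕ} (μ : Fin m) {f : AB m} (hf : f ∈ idealCE m) :
    DB μ f ∈ idealCE m := by
  intro b hb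
  have hline : ∀ t : ℝ, (fun v => b v + t * (totalCoeff μ v).1 b) ∈ solManifold m := by
    intro t i
    have h1 := hb i
    have h2 := hb (i + Pi.single μ 1)
    simp only [totalCoeff, coord, Finset.sum_add_distrib, h1, ← Finset.mul_sum]
    have h3 : ∑ l, b (.u l (i + Pi.single l 1 + Pi.single μ 1)) = 0 := by
      rw [← h2]
      exact Finset.sum_congr rfl fun l _ => by rw [add_right_comm]
    rw [h3]
    simp
  have h4 : (fun t : ℝ => f.1 fun v => b v + t * (totalCoeff μ v).1 b) = fun _ => 0 :=
    funext fun t => hf _ (hline t)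
  rw [DB, vectorField_apply, h4, deriv_const]

/-- The algebra `A(CE) = A(B) / I` of smooth functions on `CE`. -/
def ACE (m : ℕ) : Type := AB m ⧸ idealCE m

instance (m : ℕ) : CommRing (ACE m) := inferInstanceAs (CommRing (AB m ⧸ idealCE m))

set_option synthInstance.maxHeartbeats 200000 in
instance (m : ℕ) : Algebra ℝ (ACE m) := inferInstanceAs (Algebra ℝ (AB m ⧸ idealCE m))

/-- The restriction `f ↦ f + I` of a function to `CE`. -/
def restr (m : ℕ) : AB m →ₐ[ℝ] ACE m := Ideal.Quotient.mkₐ ℝ (idealCE m)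

theorem restr_surjective (m : ℕ) : Function.Surjective (restr m) := Ideal.Quotient.mk_surjective

theorem restr_eq_iff {m : ℕ} {f g : AB m} : restr m f = restr m g ↔ f - g ∈ idealCE m :=
  Ideal.Quotient.mk_eq_mk_iff_sub_mem f g

/-- The derivation of `A(CE)` induced by `D_μ`, that is `f + I ↦ D_μ f + I`. These derivations
form a basis of the `A(CE)`-module of horizontal derivations. -/
def DCE {m : ℕ} (μ : Fin m) : ACE m →ₗ[ℝ] ACE m where
  toFun := Quotient.lift (fun f => restr m (DB μ f)) fun f g h => by
    have h1 : f - g ∈ idealCE m := (Submodule.quotientRel_def _).1 h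
    rw [restr_eq_iff, ← map_sub]
    exact DB_mem_idealCE μ h1
  map_add' f g := by
    obtain ⟨f, rfl⟩ := restr_surjective m f
    obtain ⟨g, rfl⟩ := restr_surjective m g
    rw [← map_add]
    change restr m (DB μ (f + g)) = restr m (DB μ f) + restr m (DB μ g)
    rw [map_add, map_add]
  map_smul' r f := by
    obtain ⟨f, rfl⟩ := restr_surjective m f
    rw [← map_smul]
    change restr m (DB μ (r • f)) = r • restr m (DB μ f)
    rw [map_smul, map_smul]

theorem DCE_restr {m : ℕ} (μ : Fin m) (f : AB m) :
    DCE μ (restr m f) = restr m (DB μ f) := rfl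

theorem DCE_comm {m : ℕ} (μ ν : Fin m) (f : ACE m) :
    DCE μ (DCE ν f) = DCE ν (DCE μ f) := by
  obtain ⟨f, rfl⟩ := restr_surjective m f
  rw [DCE_restr, DCE_restr, DCE_restr, DCE_restr, DB_comm]

/-! ### Global coordinates on the solution manifold

Here `m = n + 1`; the first coordinate direction is `0 : Fin (n + 1)` and the others are
`α.succ` for `α : Fin n`. A multi-index is `i = (i^1, j)` with `j : Fin n → ℕ`. -/

/-- The global coordinates `x^μ`, `u^1_{0,j}`, `u^α_i`, `p_i` on `CE`. -/
inductive CEVar (n : ℕ) : Type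
  | x (μ : Fin (n + 1)) : CEVar n
  | u1 (j : Fin n → ℕ) : CEVar n
  | u (α : Fin n) (i : Fin (n + 1) → ℕ) : CEVar n
  | p (i : Fin (n + 1) → ℕ) : CEVar n

/-- The multi-index `(k, j)`. -/
abbrev mcons {n : ℕ} (k : ℕ) (j : Fin n → ℕ) : Fin (n + 1) → ℕ :=
  Fin.cons (α := fun _ => ℕ) k j

/-- The global coordinates of `CE` among the coordinates of `B`. -/
def toBVar {n : ℕ} : CEVar n → BVar (n + 1)
  | .x μ => .x μ
  | .u1 j => .u 0 (mcons 0 j)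
  | .u α i => .u α.succ i
  | .p i => .p i

/-- The point of `CE` with given global coordinates:
`u^1_i = - ∑_α u^α_{i-(1)+(α)}` if `i^1 > 0`. -/
def param {n : ℕ} (y : CEVar n → ℝ) : BVar (n + 1) → ℝ
  | .x μ => y (.x μ)
  | .u l i => Fin.cases (motive := fun _ => ℝ)
      (if i 0 = 0 then y (.u1 (Fin.tail i))
        else -∑ α : Fin n, y (.u α (i - Pi.single 0 1 + Pi.single α.succ 1)))
      (fun α => y (.u α i)) l
  | .p i => y (.p i)

theorem param_toBVar {n : ℕ} (y : CEVar n → ℝ) (v : CEVar n) : param y (toBVar v) = y v := by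
  cases v <;> simp [param, toBVar]

theorem param_mem {n : ℕ} (y : CEVar n → ℝ) : param y ∈ solManifold (n + 1) := by
  intro i
  rw [Fin.sum_univ_succ]
  simp [param]

theorem param_of_mem {n : ℕ} {b : BVar (n + 1) → ℝ} (hb : b ∈ solManifold (n + 1)) :
    param (fun v => b (toBVar v)) = b := by
  funext v
  cases v with
  | x μ => rfl
  | p i => rfl
  | u l i =>
    refine Fin.cases ?_ (fun α => ?_) l
    · by_cases h : i 0 = 0
      · have h1 : mcons 0 (Fin.tail i) = i := by
          rw [← h]; exact Fin.cons_self_tail i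
        simp [param, toBVar, h, h1]
      · have h1 : i - Pi.single 0 1 + Pi.single 0 1 = i := by
          funext k
          by_cases hk : k = 0
          · subst hk
            simp
            omega
          · simp [hk]
        have h2 := hb (i - Pi.single 0 1)
        rw [Fin.sum_univ_succ, h1] at h2
        simp only [param, toBVar, h, if_false, Fin.cases_zero]
        linarith
    · simp [param, toBVar]

theorem isFinSmooth_param {n : ℕ} (v : BVar (n + 1)) :
    IsFinSmooth fun y : CEVar n → ℝ => param y v := by
  cases v with
  | x μ => exact IsFinSmooth.coord (CEVar.x μ)
  | p i => exact IsFinSmooth.coord (CEVar.p i)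
  | u l i =>
    refine Fin.cases ?_ (fun α => ?_) l
    · by_cases h : i 0 = 0
      · simpa [param, h] using IsFinSmooth.coord (CEVar.u1 (Fin.tail i))
      · simpa [param, h] using (IsFinSmooth.sum Finset.univ fun α : Fin n =>
          IsFinSmooth.coord (CEVar.u α (i - Pi.single 0 1 + Pi.single α.succ 1))).neg
    · simpa [param] using IsFinSmooth.coord (CEVar.u α i)

/-- A function on `CE` expressed in the global coordinates. -/
def inCoordsHom (n : ℕ) : ACE (n + 1) →ₐ[ℝ] FinSmooth (CEVar n) :=
  Ideal.Quotient.liftₐ (idealCE (n + 1)) (pullback param isFinSmooth_param)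
    (fun _ hf => Subtype.ext (funext fun y => hf _ (param_mem y)))

/-- A function of the global coordinates, seen as a function on `CE`. -/
def ofCoordsHom (n : ℕ) : FinSmooth (CEVar n) →ₐ[ℝ] ACE (n + 1) :=
  (restr (n + 1)).comp
    (pullback (fun b v => b (toBVar v)) fun v => IsFinSmooth.coord (toBVar v))

theorem inCoordsHom_restr {n : ℕ} (f : AB (n + 1)) :
    inCoordsHom n (restr (n + 1) f) = pullback param isFinSmooth_param f := rfl

/-- The identification `A(CE) = C^∞_fin(CE)` given by the global coordinates. -/
def inCoords (n : ℕ) : ACE (n + 1) ≃ₐ[ℝ] FinSmooth (CEVar n) :=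
  AlgEquiv.ofAlgHom (inCoordsHom n) (ofCoordsHom n)
    (AlgHom.ext fun f => Subtype.ext <| funext fun y => by
      change f.1 (fun v => param y (toBVar v)) = f.1 y
      simp only [param_toBVar])
    (AlgHom.ext fun f => by
      obtain ⟨f, rfl⟩ := restr_surjective (n + 1) f
      refine restr_eq_iff.2 fun b hb => ?_
      change f.1 (param fun v => b (toBVar v)) - f.1 b = 0
      rw [param_of_mem hb, sub_self])

/-- The partial derivative on `A(CE)` with respect to a global coordinate. -/
def pderivCE {n : ℕ} (v : CEVar n) : ACE (n + 1) →ₗ[ℝ] ACE (n + 1) :=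
  (inCoords n).symm.toLinearMap ∘ₗ pderiv v ∘ₗ (inCoords n).toLinearMap

theorem pderivCE_support_finite {n : ℕ} (f : ACE (n + 1)) :
    {v | pderivCE v f ≠ 0}.Finite := by
  refine (pderiv_support_finite (inCoords n f)).subset fun v hv h => hv ?_
  change (inCoords n).symm (pderiv v (inCoords n f)) = 0
  rw [h, map_zero]

/-! ### Differential forms and their cohomology -/

/-- Alternating `q`-forms in `k` directions with coefficients in `A`. The value of a form on
vectors `v_1, …, v_q` of `ℝ^k` is its value on the derivations `∑_μ v_i^μ D_μ`; in particular
the components of the form are its values on the standard basis vectors. -/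
abbrev Form (k : ℕ) (A : Type) [AddCommGroup A] [Module ℝ A] (q : ℕ) : Type :=
  (Fin k → ℝ) [⋀^Fin q]→ₗ[ℝ] A

section Complex

variable {k : ℕ} {A : Type} [AddCommGroup A] [Module ℝ A]

/-- The differential `∑_μ dx^μ ∧ D_μ`, see `dForm_apply`. -/
def dForm (D : Fin k → A →ₗ[ℝ] A) (q : ℕ) : Form k A q →ₗ[ℝ] Form k A (q + 1) :=
  AlternatingMap.alternatizeUncurryFinLM ∘ₗ
    ∑ μ, LinearMap.smulRightₗ (LinearMap.proj (φ := fun _ : Fin k => ℝ) μ) ∘ₗ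
      (D μ).compAlternatingMapₗ (S := ℝ)

theorem sum_form_apply {ι : Type} (s : Finset ι) {q : ℕ} (w : ι → Form k A q)
    (v : Fin q → Fin k → ℝ) : (∑ i ∈ s, w i) v = ∑ i ∈ s, w i v := by
  classical
  induction s using Finset.induction_on with
  | empty => rfl
  | insert a s ha ih => rw [Finset.sum_insert ha, Finset.sum_insert ha, ← ih]; rfl

theorem dForm_apply (D : Fin k → A →ₗ[ℝ] A) (q : ℕ) (w : Form k A q)
    (v : Fin (q + 1) → Fin k → ℝ) :
    dForm D q w v =
      ∑ i : Fin (q + 1), (-1 : ℤ) ^ (i : ℕ) • ∑ μ, v i μ • D μ (w (i.removeNth v)) := by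
  simp [dForm, AlternatingMap.alternatizeUncurryFin_apply, sum_form_apply, Finset.smul_sum,
    Finset.sum_comm (γ := Fin k)]

/-- The closed forms of degree `q`. -/
def cocycles (D : Fin k → A →ₗ[ℝ] A) (q : ℕ) : Submodule ℝ (Form k A q) :=
  LinearMap.ker (dForm D q)

/-- The exact forms of degree `q`. -/
def coboundaries (D : Fin k → A →ₗ[ℝ] A) : (q : ℕ) → Submodule ℝ (Form k A q)
  | 0 => ⊥
  | q + 1 => LinearMap.range (dForm D q)

/-- The cohomology space of degree `q : ℕ`. -/
abbrev Coh (D : Fin k → A →ₗ[ℝ] A) (q : ℕ) : Type :=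
  cocycles D q ⧸ (coboundaries D q).submoduleOf (cocycles D q)

/-- The cohomology class of a closed form. -/
abbrev Coh.cls (D : Fin k → A →ₗ[ℝ] A) {q : ℕ} (w : Form k A q) (h : w ∈ cocycles D q) :
    Coh D q :=
  Submodule.Quotient.mk ⟨w, h⟩

/-- The cohomology space of degree `q : ℤ`; there are no nonzero forms of negative degree. -/
def CohInt (D : Fin k → A →ₗ[ℝ] A) : ℤ → Type
  | .ofNat q => Coh D q
  | .negSucc _ => PUnit

theorem dForm_comp {D : Fin k → A →ₗ[ℝ] A} {T : A →ₗ[ℝ] A}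
    (hT : ∀ μ a, T (D μ a) = D μ (T a)) (q : ℕ) (w : Form k A q) :
    dForm D q (T.compAlternatingMap w) = T.compAlternatingMap (dForm D q w) := by
  ext v
  simp only [dForm_apply, LinearMap.compAlternatingMap_apply, map_sum, map_zsmul, map_smul, hT]

theorem dForm_dForm {D : Fin k → A →ₗ[ℝ] A} (hD : ∀ μ ν a, D μ (D ν a) = D ν (D μ a)) (q : ℕ)
    (w : Form k A q) : dForm D (q + 1) (dForm D q w) = 0 := by
  let G : Form k A q →ₗ[ℝ] (Fin k → ℝ) →ₗ[ℝ] Form k A q :=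
    ∑ μ, LinearMap.smulRightₗ (LinearMap.proj (φ := fun _ : Fin k => ℝ) μ) ∘ₗ
      (D μ).compAlternatingMapₗ (S := ℝ)
  let f : (Fin k → ℝ) →ₗ[ℝ] (Fin k → ℝ) →ₗ[ℝ] Form k A q :=
    ∑ μ, (LinearMap.proj (φ := fun _ : Fin k => ℝ) μ).smulRight (G ((D μ).compAlternatingMap w))
  have hf : ∀ x y, f x y = f y x := by
    intro x y
    have hc : ∀ μ ν, (D ν).compAlternatingMap ((D μ).compAlternatingMap w) =
        (D μ).compAlternatingMap ((D ν).compAlternatingMap w) := fun μ ν => by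
      ext v
      exact hD _ _ _
    simp only [f, G, LinearMap.sum_apply, LinearMap.smulRight_apply, LinearMap.smul_apply,
      LinearMap.comp_apply, LinearMap.smulRightₗ_apply, LinearMap.proj_apply,
      LinearMap.compAlternatingMapₗ_apply, Finset.smul_sum]
    rw [Finset.sum_comm]
    refine Finset.sum_congr rfl fun μ _ => Finset.sum_congr rfl fun ν _ => ?_
    rw [hc, smul_comm]
  rw [← AlternatingMap.alternatizeUncurryFin_alternatizeUncurryFinLM_comp_of_symmetric hf]
  ext v
  have h1 : ∀ μ, (D μ).compAlternatingMap (dForm D q w) =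
      AlternatingMap.alternatizeUncurryFinLM (G ((D μ).compAlternatingMap w)) := fun μ =>
    (dForm_comp (fun ν a => hD μ ν a) q w).symm
  rw [dForm_apply, AlternatingMap.alternatizeUncurryFin_apply]
  refine Finset.sum_congr rfl fun i _ => ?_
  congr 1
  simp only [← LinearMap.compAlternatingMap_apply, h1, f, LinearMap.comp_apply,
    LinearMap.sum_apply, LinearMap.smulRight_apply, LinearMap.proj_apply, map_sum, map_smul,
    sum_form_apply, AlternatingMap.smul_apply]

/-- The action on closed forms of an operator applied to the coefficients. -/
def cocyclesMap (D : Fin k → A →ₗ[ℝ] A) (T : A →ₗ[ℝ] A)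
    (hT : ∀ μ a, T (D μ a) = D μ (T a)) (q : ℕ) : cocycles D q →ₗ[ℝ] cocycles D q :=
  (T.compAlternatingMapₗ (S := ℝ)).restrict fun w hw => by
    change dForm D q (T.compAlternatingMap w) = 0
    rw [dForm_comp hT, show dForm D q w = 0 from hw]
    ext v
    simp

/-- The action on cohomology of an operator applied to the coefficients. -/
def Coh.map (D : Fin k → A →ₗ[ℝ] A) (T : A →ₗ[ℝ] A)
    (hT : ∀ μ a, T (D μ a) = D μ (T a)) (q : ℕ) : Coh D q →ₗ[ℝ] Coh D q :=
  Submodule.mapQ _ _ (cocyclesMap D T hT q) fun w hw => by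
    cases q with
    | zero =>
      have h0 : w.1 = 0 := hw
      change T.compAlternatingMap w.1 = 0
      rw [h0]
      ext v
      simp
    | succ q =>
      obtain ⟨η, hη⟩ : ∃ η, dForm D q η = w.1 := hw
      exact ⟨T.compAlternatingMap η, by rw [dForm_comp hT, hη]; rfl⟩

end Complex

/-! ### The horizontal complex of `CE` and the auxiliary complex -/

/-- The horizontal cohomology of `CE` in degree `q : ℕ`. -/
abbrev HCE (m : ℕ) (q : ℕ) : Type := Coh (DCE (m := m)) q

/-- The horizontal cohomology of `CE` in degree `q : ℤ`. -/
abbrev HCEInt (m : ℕ) (q : ℤ) : Type := CohInt (DCE (m := m)) q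

/-- The derivations `D_α`, `α = 2, …, m`. -/
abbrev DTheta (n : ℕ) : Fin n → ACE (n + 1) →ₗ[ℝ] ACE (n + 1) := fun α => DCE α.succ

/-- The forms `Θ^q` in the directions `dx^2, …, dx^m`. -/
abbrev Theta (n q : ℕ) : Type := Form n (ACE (n + 1)) q

/-- The cohomology `H^q(Θ)` of the auxiliary complex. -/
abbrev HTheta (n q : ℕ) : Type := Coh (DTheta n) q

/-- The operator `D_1^q` on `H^q(Θ)`: the derivation `D_1` applied to the coefficients. -/
def D1 (n q : ℕ) : HTheta n q →ₗ[ℝ] HTheta n q :=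
  Coh.map (DTheta n) (DCE 0) (fun _ _ => DCE_comm _ _ _) q

/-- The projection `π : Ω^q → Θ^q`, `dx^1 ∧ θ' + θ ↦ θ`. -/
def proj {n q : ℕ} (w : Form (n + 1) (ACE (n + 1)) q) : Theta n q :=
  w.compLinearMap (LinearMap.pi (Fin.cons 0 fun α => LinearMap.proj α))

/-- The map `ι : Θ^q → Ω^{q+1}`, `θ ↦ (-1)^q dx^1 ∧ θ`. -/
def incl {n q : ℕ} (θ : Theta n q) : Form (n + 1) (ACE (n + 1)) (q + 1) :=
  (-1 : ℝ) ^ q • AlternatingMap.alternatizeUncurryFin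
    ((LinearMap.proj (φ := fun _ : Fin (n + 1) => ℝ) 0).smulRight
      (θ.compLinearMap (LinearMap.funLeft ℝ ℝ Fin.succ)))

/-- The `0`-form of `CE` given by a constant function. -/
def constForm (m : ℕ) (c : ℝ) : Form m (ACE m) 0 :=
  AlternatingMap.constOfIsEmpty ℝ (Fin m → ℝ) (Fin 0) (algebraMap ℝ (ACE m) c)

/-- The `(m-1)`-form `d_μ x = (-1)^{μ-1} dx^1 ∧ … ∧ dx^m` with the factor `dx^μ` omitted, that
is the contraction of the volume form `dx^1 ∧ … ∧ dx^m` with the `μ`-th basis vector. -/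
def dHat {n : ℕ} (μ : Fin (n + 1)) : (Fin (n + 1) → ℝ) [⋀^Fin n]→ₗ[ℝ] ℝ :=
  AlternatingMap.curryLeft Matrix.detRowAlternating (Pi.single μ 1)

/-- The `(m-1)`-form `u^μ d_μ x` on `CE`. -/
def velocityForm (n : ℕ) : Form (n + 1) (ACE (n + 1)) n :=
  ∑ μ, (LinearMap.toSpanSingleton ℝ (ACE (n + 1))
    (restr (n + 1) (coord (BVar.u μ 0)))).compAlternatingMap (dHat μ)

/-! ### Variational derivatives and the Helmholtz space of the auxiliary complex -/

/-- The dependent variables `u^1_0`, `u^α_k`, `p_k`, `k = 0, 1, …`, of the auxiliary complex;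
the number `k` counts the derivatives with respect to `x^1`. -/
inductive ThetaField (n : ℕ) : Type
  | u1 : ThetaField n
  | u (α : Fin n) (k : ℕ) : ThetaField n
  | p (k : ℕ) : ThetaField n

/-- The `j`-th derivative of a dependent variable, `j` being a multi-index in the directions
`2, …, m`, is one of the global coordinates `u^1_{0,j}`, `u^α_{k,j}`, `p_{k,j}` of `CE`. -/
def ThetaField.var {n : ℕ} : ThetaField n → (Fin n → ℕ) → CEVar n
  | .u1, j => .u1 j
  | .u α k, j => .u α (mcons k j)
  | .p k, j => .p (mcons k j)

/-- `D_j = (D_2)^{j^2} ∘ … ∘ (D_m)^{j^m}`. -/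
def DJet {n : ℕ} (j : Fin n → ℕ) : Module.End ℝ (ACE (n + 1)) :=
  (List.ofFn fun α => (DTheta n α : Module.End ℝ (ACE (n + 1))) ^ j α).prod

/-- `(-D)_j = (-D_2)^{j^2} ∘ … ∘ (-D_m)^{j^m}`. -/
def negDJet {n : ℕ} (j : Fin n → ℕ) : Module.End ℝ (ACE (n + 1)) :=
  (List.ofFn fun α => (-DTheta n α : Module.End ℝ (ACE (n + 1))) ^ j α).prod

/-- The variational derivative `(δL)_a = ∑_j (-D)_j ∂_{a_j} L`. -/
def varDeriv {n : ℕ} (L : ACE (n + 1)) (a : ThetaField n) : ACE (n + 1) :=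
  ∑ᶠ j : Fin n → ℕ, negDJet j (pderivCE (a.var j) L)

/-- The linearization `χ_*`: `(χ_* f)_a = ∑_{b,j} ∂_{b_j} χ_a · D_j f_b`. -/
def linearization {n : ℕ} (χ f : ThetaField n → ACE (n + 1)) (a : ThetaField n) : ACE (n + 1) :=
  ∑ᶠ c : ThetaField n × (Fin n → ℕ), pderivCE (c.1.var c.2) (χ a) * DJet c.2 (f c.1)

/-- The adjoint `χ^*` of the linearization:
`(χ^* f)_a = ∑_{b,j} (-D)_j (f_b · ∂_{a_j} χ_b)`. -/
def adjoint {n : ℕ} (χ f : ThetaField n → ACE (n + 1)) (a : ThetaField n) : ACE (n + 1) :=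
  ∑ᶠ c : ThetaField n × (Fin n → ℕ), negDJet c.2 (f c.1 * pderivCE (a.var c.2) (χ c.1))

theorem ThetaField.var_injective {n : ℕ} :
    Function.Injective fun c : ThetaField n × (Fin n → ℕ) => c.1.var c.2 := by
  rintro ⟨a, i⟩ ⟨b, j⟩ h
  cases a <;> cases b <;> simp_all [ThetaField.var, Fin.cons_inj]

theorem linearization_support {n : ℕ} (χ f : ThetaField n → ACE (n + 1)) (a : ThetaField n) :
    (Function.support fun c : ThetaField n × (Fin n → ℕ) =>
      pderivCE (c.1.var c.2) (χ a) * DJet c.2 (f c.1)).Finite :=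
  ((pderivCE_support_finite (χ a)).preimage ThetaField.var_injective.injOn).subset
    fun c hc h => hc (by simp [show pderivCE (c.1.var c.2) (χ a) = 0 from h])

theorem adjoint_support {n : ℕ} {χ : ThetaField n → ACE (n + 1)}
    (hχ : (Function.support χ).Finite) (f : ThetaField n → ACE (n + 1)) (a : ThetaField n) :
    (Function.support fun c : ThetaField n × (Fin n → ℕ) =>
      negDJet c.2 (f c.1 * pderivCE (a.var c.2) (χ c.1))).Finite := by
  have h1 : (⋃ b ∈ Function.support χ,
      (fun j => (b, j)) '' {j : Fin n → ℕ | pderivCE (a.var j) (χ b) ≠ 0}).Finite := by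
    refine hχ.biUnion fun b _ => Set.Finite.image _ ?_
    refine (pderivCE_support_finite (χ b)).preimage (f := fun j => a.var j) fun i _ j _ h => ?_
    exact congrArg Prod.snd (@ThetaField.var_injective n (a, i) (a, j) h)
  refine h1.subset ?_
  rintro ⟨b, j⟩ hc
  have h2 : pderivCE (a.var j) (χ b) ≠ 0 := fun h => hc (by simp [h])
  have h3 : χ b ≠ 0 := fun h => h2 (by simp [h])
  simp only [Set.mem_iUnion]
  exact ⟨b, h3, j, h2, rfl⟩

/-- The Helmholtz space `{χ | χ_* = χ^*}`, where `χ` runs over the families with finitely many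
nonzero components. -/
def helmholtz (n : ℕ) : Submodule ℝ (ThetaField n → ACE (n + 1)) where
  carrier := {χ | (Function.support χ).Finite ∧ ∀ f, linearization χ f = adjoint χ f}
  zero_mem' := by
    refine ⟨by simp, fun f => funext fun a => ?_⟩
    simp [linearization, adjoint]
  add_mem' {χ ψ} hχ hψ := by
    refine ⟨(hχ.1.union hψ.1).subset (Function.support_add χ ψ), fun f => funext fun a => ?_⟩
    have h1 : linearization (χ + ψ) f a = linearization χ f a + linearization ψ f a := by
      simp only [linearization]
      rw [← finsum_add_distrib (linearization_support χ f a) (linearization_support ψ f a)]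
      exact finsum_congr fun c => by rw [Pi.add_apply, map_add, add_mul]
    have h2 : adjoint (χ + ψ) f a = adjoint χ f a + adjoint ψ f a := by
      simp only [adjoint]
      rw [← finsum_add_distrib (adjoint_support hχ.1 f a) (adjoint_support hψ.1 f a)]
      exact finsum_congr fun c => by rw [Pi.add_apply, map_add, mul_add, map_add]
    rw [h1, h2, hχ.2, hψ.2]
  smul_mem' r χ hχ := by
    refine ⟨hχ.1.subset (Function.support_const_smul_subset r χ), fun f => funext fun a => ?_⟩
    have h1 : linearization (r • χ) f a = r • linearization χ f a := by
      simp only [linearization]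
      rw [smul_finsum' r (linearization_support χ f a)]
      exact finsum_congr fun c => by rw [Pi.smul_apply, map_smul, smul_mul_assoc]
    have h2 : adjoint (r • χ) f a = r • adjoint χ f a := by
      simp only [adjoint]
      rw [smul_finsum' r (adjoint_support hχ.1 f a)]
      exact finsum_congr fun c => by rw [Pi.smul_apply, map_smul, mul_smul_comm, map_smul]
    rw [h1, h2, hχ.2]

/-- The operator `D_1 + f^*`, where `(f^* χ)_{u^1_0} = 0`,
`(f^* χ)_{u^α_k} = δ_{k,0} D_α χ_{u^1_0} + χ_{u^α_{k-1}}`, `(f^* χ)_{p_k} = χ_{p_{k-1}}`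
and components with the index `k - 1 = -1` are zero. -/
def DTilde {n : ℕ} (χ : ThetaField n → ACE (n + 1)) : ThetaField n → ACE (n + 1)
  | .u1 => DCE 0 (χ .u1)
  | .u α 0 => DCE 0 (χ (.u α 0)) + DCE α.succ (χ .u1)
  | .u α (k + 1) => DCE 0 (χ (.u α (k + 1))) + χ (.u α k)
  | .p 0 => DCE 0 (χ (.p 0))
  | .p (k + 1) => DCE 0 (χ (.p (k + 1))) + χ (.p k)

/-- The coefficient `L` of a form `θ = L dx^2 ∧ … ∧ dx^m`. -/
def topCoeff {n : ℕ} (θ : Theta n n) : ACE (n + 1) := θ fun α => Pi.single α 1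

end DivFree

end

open DivFree

noncomputable section

namespace DivFree

/-! ### Smoothness of parametric integrals -/

/-! The continuity equation can be solved for the `x^1`-derivatives of `u^1`. With respect to the
directions `2, …, m`, the manifold `CE` is therefore a free jet space of the fields `u^1_0`,
`u^α_k`, `p_k`, with `x^1` as a parameter, and the constraint survives only in the way `D_1` acts.
Every form is uniquely `θ + dx^1 ∧ θ'`, and its differential is `d_Θ θ + dx^1 ∧ (D_1 θ - d_Θ θ')`
(`dForm_pull_add_wedgeFirst`). This gives a long exact sequence between the cohomologies of `Ω` and
`Θ` whose connecting map is `D_1`; the pieces needed are `mem_coboundaries_of_front`,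
`range_frontCoh` and `ker_inclCoh`.

The cohomology of `Θ` is that of a free variational complex. The vertical differential of a closed
form takes values in the module of the `θ_{a,j}`. If `θ_{a,j}` is read as a monomial `ξ^j`, the
total derivative becomes `D_α + ξ_α`. The operators `∂/∂ξ_α` then give a Cartan homotopy whose
diagonal entries are `n + |j|` minus the form degree. It makes the vertical differential exact,
except for a remainder along `θ_{a,0}` in top degree, which integration by parts identifies with the
variational derivative (`exists_dForm_DVert`, `parts_eq_apply`). Contraction with the fibre Euler
field carries this back to functions, up to forms depending on `x` alone, for which the Poincaré
lemma holds (`exists_dForm_of_eulerJet`, `exists_dForm_eq`). So `H^0(Θ)` consists of functions of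
`x^1`, the intermediate groups vanish, and `δ` is injective on `H^{m-1}(Θ)`. Its image is the
Helmholtz space: second derivatives are symmetric (`varL_mem_helmholtz`), and conversely `∑ u^a
∫_0^1 χ_a(t u) dt` is a Lagrangian for `χ` (`exists_varL_eq`).

On functions of `x^1`, `D_1` is onto with constant kernel. This settles degree `0` and prevents
`H^0(Θ)` from contributing in degree `1`. Under `δ`, `D_1` becomes `DTilde` (`varL_DCE_zero`). A
family with finitely many components in the kernel of `DTilde` must vanish, by descent on `k`,
except for its `u^1_0` component, and that component is constant (`eq_smul_of_DTilde_eq_zero`).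
Hence the kernel is the line spanned by `δ u^1_0`, the image of the current `u^μ d_μ x`.

All homotopies rest on one analytic fact: an Euler field plus a positive integer is invertible on
smooth functions of finite order. The inverse is an integral over a ray, hence the parametric
integrals. -/

theorem hasFDerivAt_intervalIntegral_param {H E : Type} [NormedAddCommGroup H] [NormedSpace ℝ H]
    [ProperSpace H] [NormedAddCommGroup E] [NormedSpace ℝ E] {F : ℝ × H → E}
    (hF : ContDiff ℝ ∞ F) (y : H) :
    HasFDerivAt (fun y => ∫ t in (0 : ℝ)..1, F (t, y))
      (∫ t in (0 : ℝ)..1, fderiv ℝ (fun z => F (t, z)) y) y := by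
  have hd : ∀ t z, HasFDerivAt (fun z => F (t, z))
      ((fderiv ℝ F (t, z)).comp (ContinuousLinearMap.inr ℝ ℝ H)) z := fun t z =>
    ((hF.differentiable (by simp)) (t, z)).hasFDerivAt.comp z (hasFDerivAt_prodMk_right t z)
  have hc : Continuous fun p : ℝ × H =>
      (fderiv ℝ F p).comp (ContinuousLinearMap.inr ℝ ℝ H) :=
    (hF.continuous_fderiv (by simp)).clm_comp continuous_const
  -- The derivative in the parameter is continuous, hence bounded on the compact set `[0,1] ×`
  -- closed unit ball; this bound dominates the integrands near `y`.
  obtain ⟨C, hC⟩ := (isCompact_Icc.prod (isCompact_closedBall y 1)).exists_bound_of_continuousOn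
    (s := Set.Icc (0 : ℝ) 1 ×ˢ Metric.closedBall y 1) hc.continuousOn
  have h1 : ∀ z, Continuous fun t : ℝ => F (t, z) := fun z =>
    hF.continuous.comp (continuous_id.prodMk continuous_const)
  simp only [fun t => (hd t y).fderiv]
  refine intervalIntegral.hasFDerivAt_integral_of_dominated_of_fderiv_le
    (F := fun z t => F (t, z))
    (F' := fun z t => (fderiv ℝ F (t, z)).comp (ContinuousLinearMap.inr ℝ ℝ H))
    (bound := fun _ => C) (Metric.ball_mem_nhds y one_pos) ?_ ?_ ?_ ?_ ?_ ?_
  · exact Filter.Eventually.of_forall fun z => (h1 z).aestronglyMeasurable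
  · exact (h1 y).intervalIntegrable _ _
  · exact (hc.comp (continuous_id.prodMk continuous_const)).aestronglyMeasurable
  · refine Filter.Eventually.of_forall fun t ht z hz => hC (t, z) ⟨?_, Metric.ball_subset_closedBall hz⟩
    rw [Set.uIoc_of_le zero_le_one] at ht
    exact Set.Ioc_subset_Icc_self ht
  · exact intervalIntegrable_const
  · exact Filter.Eventually.of_forall fun t _ z _ => hd t z

/-- The derivative of such an integral is again such an integral, with values in `H →L[ℝ] E`. The
induction on the order of smoothness must therefore let the target space vary. -/
theorem contDiff_intervalIntegral_param {H E : Type} [NormedAddCommGroup H] [NormedSpace ℝ H]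
    [ProperSpace H] [NormedAddCommGroup E] [NormedSpace ℝ E] {F : ℝ × H → E}
    (hF : ContDiff ℝ ∞ F) : ContDiff ℝ ∞ fun y => ∫ t in (0 : ℝ)..1, F (t, y) := by
  refine contDiff_infty.2 fun k => ?_
  induction k generalizing E with
  | zero =>
    exact contDiff_zero.2 (continuous_iff_continuousAt.2 fun y =>
      (hasFDerivAt_intervalIntegral_param hF y).continuousAt)
  | succ k ih =>
    have h1 := hasFDerivAt_intervalIntegral_param hF
    refine contDiff_succ_iff_fderiv.2 ⟨fun y => (h1 y).differentiableAt,
      fun h => absurd h (WithTop.coe_ne_top (a := (k : ℕ∞))), ?_⟩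
    have h2 : fderiv ℝ (fun y => ∫ t in (0 : ℝ)..1, F (t, y)) = fun y =>
        ∫ t in (0 : ℝ)..1, (fderiv ℝ F (t, y)).comp (ContinuousLinearMap.inr ℝ ℝ H) := by
      funext y
      rw [(h1 y).fderiv]
      congr 1
      funext t
      exact (((hF.differentiable (by simp)) (t, y)).hasFDerivAt.comp y
        (hasFDerivAt_prodMk_right t y)).fderiv
    rw [h2]
    exact ih ((hF.fderiv_right (m := ∞) (by simp)).clm_comp contDiff_const)

/-! ### Partial Euler fields -/

section Euler

variable {V : Type} (P : V → Prop) [DecidablePred P]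

/-- Multiplication of the coordinates in `P` by `t`. -/
def scale (t : ℝ) (b : V → ℝ) (v : V) : ℝ := if P v then t * b v else b v

theorem scale_one (b : V → ℝ) : scale P 1 b = b := by
  funext v; simp [scale]

theorem scale_scale (s t : ℝ) (b : V → ℝ) : scale P s (scale P t b) = scale P (s * t) b := by
  funext v
  by_cases h : P v <;> simp [scale, h, mul_assoc]

/-- The Euler field `∑_{v ∈ P} v ∂_v`. -/
def euler : FinSmooth V →ₗ[ℝ] FinSmooth V := vectorField fun v => if P v then coord v else 0

theorem hasDerivAt_scale {S : Finset V} {g : (S → ℝ) → ℝ} {f : FinSmooth V}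
    (hg : ContDiff ℝ ∞ g) (hfg : ∀ b, f.1 b = g (fun s => b s)) (b : V → ℝ) (t : ℝ) :
    HasDerivAt (fun t => f.1 (scale P t b))
      (∑ v ∈ S, (if P v then b v else 0) * (pderiv v f).1 (scale P t b)) t := by
  classical
  have h2 : HasDerivAt (fun t : ℝ => fun s : S => scale P t b s)
      (fun s : S => if P s then b s else 0) t := by
    refine hasDerivAt_pi.2 fun s => ?_
    by_cases h : P s
    · simpa [scale, h] using (hasDerivAt_id t).mul_const (b s)
    · simpa [scale, h] using hasDerivAt_const t (b s)
  have h3 : HasFDerivAt g (fderiv ℝ g (fun s : S => scale P t b s))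
      (fun s : S => scale P t b s) := (hg.differentiable (by simp)).differentiableAt.hasFDerivAt
  have h4 := h3.comp_hasDerivAt t h2
  have h6 : (fun s : S => if P s then b s else 0) =
      ∑ s : S, (if P s then b s else 0) • unitVec S (s : V) := by
    funext s
    rw [Finset.sum_apply, Finset.sum_eq_single s]
    · simp [unitVec]
    · intro c _ hc
      have : (s : V) ≠ c := fun h => hc (Subtype.ext h.symm)
      simp [unitVec, this]
    · simp
  rw [h6, map_sum] at h4
  have h7 : (∑ v ∈ S, (if P v then b v else 0) * (pderiv v f).1 (scale P t b)) =
      ∑ s : S, fderiv ℝ g (fun s => scale P t b s)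
        ((if P s then b s else 0) • unitVec S (s : V)) := by
    rw [← Finset.sum_coe_sort S]
    refine Finset.sum_congr rfl fun s _ => ?_
    rw [map_smul, smul_eq_mul]
    congr 1
    exact pderivFun_eq hg hfg _ _
  rw [h7]
  refine h4.congr_of_eventuallyEq (Filter.Eventually.of_forall fun t => ?_)
  exact hfg _

theorem euler_apply_scale {S : Finset V} {f : FinSmooth V} (hf : DependsOn S f.1)
    (b : V → ℝ) (t : ℝ) : (euler P f).1 (scale P t b) =
      t * ∑ v ∈ S, (if P v then b v else 0) * (pderiv v f).1 (scale P t b) := by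
  rw [euler, vectorField_eq_sum _ hf, AddSubmonoidClass.coe_finsetSum, Finset.sum_apply,
    Finset.mul_sum]
  refine Finset.sum_congr rfl fun v _ => ?_
  by_cases h : P v
  · simp [h, coord, scale, mul_assoc]
  · simp [h]

/-- The equation says that `f` is homogeneous of degree `-q` in the coordinates of `P`. Thus `t ^ q
* f (scale P t b)` is constant in `t`, and its value at `t = 0` is zero because `q` is positive and
`f` is defined there. -/
theorem euler_add_injective {q : ℕ} (hq : 1 ≤ q) {f : FinSmooth V}
    (h : euler P f + (q : ℝ) • f = 0) : f = 0 := by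
  obtain ⟨S, g, hg, hfg⟩ := f.2
  ext b
  obtain ⟨q, rfl⟩ : ∃ r, q = r + 1 := ⟨q - 1, by omega⟩
  have h1 : ∀ t, HasDerivAt (fun t => t ^ (q + 1) * f.1 (scale P t b)) 0 t := by
    intro t
    refine ((hasDerivAt_pow (q + 1) t).mul (hasDerivAt_scale P hg hfg b t)).congr_deriv ?_
    have h3 := congrFun (congrArg Subtype.val h) (scale P t b)
    change (euler P f).1 (scale P t b) + ((q + 1 : ℕ) : ℝ) * f.1 (scale P t b) = 0 at h3
    rw [euler_apply_scale P ⟨g, hg, hfg⟩] at h3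
    simp only [add_tsub_cancel_right]
    linear_combination t ^ q * h3
  have h4 := is_const_of_deriv_eq_zero (fun t => (h1 t).differentiableAt) (fun t => (h1 t).deriv)
    1 0
  simpa [scale_one] using h4

theorem eq_scale_zero {f : FinSmooth V} (h : ∀ v, P v → pderiv v f = 0) (b : V → ℝ) :
    f.1 b = f.1 (scale P 0 b) := by
  obtain ⟨S, g, hg, hfg⟩ := f.2
  have h1 : ∀ t, HasDerivAt (fun t => f.1 (scale P t b)) 0 t := by
    intro t
    convert hasDerivAt_scale P hg hfg b t using 1
    refine (Finset.sum_eq_zero fun v _ => ?_).symm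
    by_cases hv : P v
    · rw [h v hv]; simp
    · simp [hv]
  have h4 := is_const_of_deriv_eq_zero (fun t => (h1 t).differentiableAt) (fun t => (h1 t).deriv)
    1 0
  simpa [scale_one] using h4

/-- The solution is `F b = ∫_0^1 t^(q-1) f (scale P t b) dt`. Substitution turns `s^q F (scale P s
b)` into `∫_0^s t^(q-1) f (scale P t b) dt`, and differentiating both expressions at `s = 1` gives
the equation. Finite order is preserved because the integral involves only the coordinates in `S`.
-/
theorem euler_add_surjective {q : ℕ} (hq : 1 ≤ q) (f : FinSmooth V) :
    ∃ F, euler P F + (q : ℝ) • F = f := by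
  obtain ⟨S, g, hg, hfg⟩ := f.2
  obtain ⟨q, rfl⟩ : ∃ r, q = r + 1 := ⟨q - 1, by omega⟩
  let G : (S → ℝ) → ℝ := fun y => ∫ t in (0 : ℝ)..1,
    t ^ q * g fun s => if P s then t * y s else y s
  have hG : ContDiff ℝ ∞ G := by
    have h0 : ContDiff ℝ ∞ fun p : ℝ × (S → ℝ) => p.1 := contDiff_fst
    refine contDiff_intervalIntegral_param (F := fun p : ℝ × (S → ℝ) =>
      p.1 ^ q * g fun s => if P s then p.1 * p.2 s else p.2 s) ((h0.pow q).mul (hg.comp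
      (contDiff_pi.2 fun s => ?_)))
    have h1 : ContDiff ℝ ∞ fun p : ℝ × (S → ℝ) => p.2 s :=
      contDiff_pi.1 contDiff_snd s
    by_cases h : P s
    · simpa [h] using h0.mul h1
    · simpa [h] using h1
  let F : FinSmooth V := ⟨fun b => G fun s => b s, S, G, hG, fun _ => rfl⟩
  have hF : ∀ b, F.1 b = ∫ t in (0 : ℝ)..1, t ^ q * f.1 (scale P t b) := fun b => by
    simp only [hfg]; rfl
  refine ⟨F, ?_⟩
  ext b
  have h1 : ∀ s : ℝ, s ^ (q + 1) * F.1 (scale P s b) =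
      ∫ t in (0 : ℝ)..s, t ^ q * f.1 (scale P t b) := by
    intro s
    have h2 := intervalIntegral.smul_integral_comp_mul_left (a := 0) (b := 1)
      (fun t => t ^ q * f.1 (scale P t b)) s
    rw [mul_zero, mul_one] at h2
    rw [← h2, hF, pow_succ', smul_eq_mul, mul_assoc, ← intervalIntegral.integral_const_mul]
    congr 2
    funext t
    rw [scale_scale, mul_comm t s, mul_pow, mul_assoc]
  have hcont : Continuous fun t => t ^ q * f.1 (scale P t b) :=
    (continuous_pow q).mul (continuous_iff_continuousAt.2 fun t =>
      (hasDerivAt_scale P hg hfg b t).continuousAt)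
  have h3 := (hcont.integral_hasStrictDerivAt 0 1).hasDerivAt
  have h4 := (hasDerivAt_pow (q + 1) (1 : ℝ)).mul
    (hasDerivAt_scale P (f := F) hG (fun _ => rfl) b 1)
  have h5 := h4.unique (h3.congr_of_eventuallyEq (Filter.Eventually.of_forall h1))
  have h6 := euler_apply_scale P (f := F) ⟨G, hG, fun _ => rfl⟩ b 1
  rw [scale_one] at h5 h6
  change (euler P F).1 b + ((q + 1 : ℕ) : ℝ) * F.1 b = f.1 b
  simp only [one_pow, mul_one, one_mul] at h5 h6
  rw [h6]
  linarith

theorem pderiv_euler (v : V) (f : FinSmooth V) :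
    pderiv v (euler P f) = euler P (pderiv v f) + if P v then pderiv v f else 0 := by
  classical
  obtain ⟨S, hS⟩ := f.2
  -- The index `v` is put into the summation set so that the commutator term, concentrated at `w =
  -- v`, is certain to be met.
  have hS' := DependsOn.mono (Finset.subset_insert v S) hS
  rw [euler, vectorField_eq_sum _ hS', vectorField_eq_sum _ (DependsOn.pderivFun hS' v), map_sum]
  have h1 : ∀ w, pderiv v ((if P w then coord w else 0) * pderiv w f) =
      (if P w then coord w else 0) * pderiv w (pderiv v f) +
        if w = v then (if P v then pderiv v f else 0) else 0 := by
    intro w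
    rw [pderiv_mul, pderiv_comm v w]
    congr 1
    by_cases h : P w
    · by_cases hw : w = v
      · subst hw; simp [h, pderiv_coord]
      · simp [h, pderiv_coord, Ne.symm hw, hw]
    · by_cases hw : w = v
      · subst hw; simp [h]
      · simp [h, hw]
  simp_rw [h1]
  rw [Finset.sum_add_distrib, Finset.sum_ite_eq' _ v]
  simp

end Euler

/-! ### Operators on forms -/

section Forms

variable {k : ℕ} {A B : Type} [AddCommGroup A] [Module ℝ A] [AddCommGroup B] [Module ℝ B]

theorem dForm_map {D : Fin k → A →ₗ[ℝ] A} {D' : Fin k → B →ₗ[ℝ] B} {T : A →ₗ[ℝ] B}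
    (hT : ∀ μ a, T (D μ a) = D' μ (T a)) (q : ℕ) (w : Form k A q) :
    dForm D' q (T.compAlternatingMap w) = T.compAlternatingMap (dForm D q w) := by
  ext v
  simp only [dForm_apply, LinearMap.compAlternatingMap_apply, map_sum, map_zsmul, map_smul, hT]

theorem dForm_add_left (D D' : Fin k → A →ₗ[ℝ] A) (q : ℕ) (w : Form k A q) :
    dForm (D + D') q w = dForm D q w + dForm D' q w := by
  ext v
  simp only [dForm_apply, AlternatingMap.add_apply, Pi.add_apply, LinearMap.add_apply, smul_add,
    Finset.sum_add_distrib]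

/-- Two families of commuting operators that commute with each other have anticommuting
differentials. -/
theorem dForm_anticomm {D D' : Fin k → A →ₗ[ℝ] A} (hD : ∀ μ ν a, D μ (D ν a) = D ν (D μ a))
    (hD' : ∀ μ ν a, D' μ (D' ν a) = D' ν (D' μ a)) (hDD' : ∀ μ ν a, D μ (D' ν a) = D' ν (D μ a))
    (q : ℕ) (w : Form k A q) :
    dForm D (q + 1) (dForm D' q w) = -dForm D' (q + 1) (dForm D q w) := by
  -- The family `D + D'` commutes as well, so its differential squares to zero; expanding the square
  -- leaves only the mixed terms.
  have h1 := dForm_dForm (D := D + D') (fun μ ν a => by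
    simp only [Pi.add_apply, LinearMap.add_apply, map_add, hD μ ν, hD' μ ν, hDD' μ ν, ← hDD' ν μ]
    abel) q w
  rw [dForm_add_left, dForm_add_left D D' q, map_add, map_add, dForm_dForm hD, dForm_dForm hD',
    zero_add, add_zero] at h1
  exact eq_neg_of_add_eq_zero_left h1

theorem form_eq_zero_of_lt {q : ℕ} (hq : k < q) (w : Form k A q) : w = 0 := by
  refine (Pi.basisFun ℝ (Fin k)).ext_alternating fun v hv => ?_
  have := Fintype.card_le_of_injective v hv
  simp only [Fintype.card_fin] at this
  omega

theorem map_eq_sum_vecCons {q : ℕ} (w : Form k A (q + 1)) (x : Fin k → ℝ)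
    (v : Fin q → Fin k → ℝ) :
    w (Matrix.vecCons x v) = ∑ μ, x μ • w (Matrix.vecCons (Pi.single μ 1) v) := by
  have h := congrArg (fun x => w.curryLeft x v) (pi_eq_sum_univ' x)
  simpa only [map_sum, map_smul, sum_form_apply, AlternatingMap.smul_apply,
    AlternatingMap.curryLeft_apply_apply] using h

theorem neg_one_pow_smul_vecCons_removeNth {q : ℕ} (w : Form k A (q + 1))
    (v : Fin (q + 1) → Fin k → ℝ) (i : Fin (q + 1)) :
    (-1 : ℤ) ^ (i : ℕ) • w (Matrix.vecCons (v i) (i.removeNth v)) = w v := by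
  rw [← w.neg_one_pow_smul_map_insertNth i, Fin.insertNth_self_removeNth, smul_smul, ← pow_add,
    Even.neg_one_pow ⟨_, rfl⟩, one_smul]

/-- The operator `∑_α P_α ι_α` on forms, where `ι_α` is the contraction with the `α`-th basis
vector. -/
def contract (P : Fin k → A →ₗ[ℝ] A) {q : ℕ} (w : Form k A (q + 1)) : Form k A q :=
  ∑ α, (P α).compAlternatingMap (w.curryLeft (Pi.single α 1))

theorem contract_apply (P : Fin k → A →ₗ[ℝ] A) {q : ℕ} (w : Form k A (q + 1))
    (v : Fin q → Fin k → ℝ) :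
    contract P w v = ∑ α, P α (w (Matrix.vecCons (Pi.single α 1) v)) := by
  rw [contract, sum_form_apply]
  rfl

theorem removeNth_zero_vecCons {q : ℕ} {M : Type} (x : M) (v : Fin q → M) :
    (0 : Fin (q + 1)).removeNth (Matrix.vecCons x v) = v := rfl

theorem removeNth_succ_vecCons {q : ℕ} {M : Type} (x : M) (v : Fin (q + 1) → M)
    (i : Fin (q + 1)) :
    i.succ.removeNth (Matrix.vecCons x v) = Matrix.vecCons x (i.removeNth v) := by
  funext l
  refine Fin.cases ?_ (fun l => ?_) l <;> simp [Fin.removeNth_apply]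

theorem sum_single_smul {M : Type} [AddCommGroup M] [Module ℝ M] (α : Fin k) (f : Fin k → M) :
    ∑ μ, (Pi.single α (1 : ℝ) : Fin k → ℝ) μ • f μ = f α := by
  rw [Finset.sum_eq_single α] <;> simp +contextual

/-- Cartan's formula in degree `0`. -/
theorem contract_dForm_zero (D P : Fin k → A →ₗ[ℝ] A) (w : Form k A 0) :
    contract P (dForm D 0 w) = (∑ α, P α ∘ₗ D α).compAlternatingMap w := by
  ext v
  rw [contract_apply, LinearMap.compAlternatingMap_apply, LinearMap.sum_apply]
  refine Finset.sum_congr rfl fun α _ => ?_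
  rw [dForm_apply, Fin.sum_univ_one]
  simp only [Fin.val_zero, pow_zero, one_smul, Matrix.cons_val_zero, removeNth_zero_vecCons,
    sum_single_smul, LinearMap.comp_apply]

/-- Cartan's formula in positive degree, for operators with `[D_α, P_β] = ε δ_{αβ}`. -/
theorem contract_dForm_succ {D P : Fin k → A →ₗ[ℝ] A} {ε : ℝ}
    (h : ∀ α β a, D α (P β a) = P β (D α a) + if α = β then ε • a else 0) {q : ℕ}
    (w : Form k A (q + 1)) :
    contract P (dForm D (q + 1) w) + dForm D q (contract P w) =
      (∑ α, P α ∘ₗ D α).compAlternatingMap w + (ε * (q + 1)) • w := by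
  ext v
  simp only [AlternatingMap.add_apply, AlternatingMap.smul_apply, contract_apply, dForm_apply,
    LinearMap.compAlternatingMap_apply, LinearMap.sum_apply, LinearMap.comp_apply]
  -- In the differential evaluated on `(e_α, v)`, the term that differentiates along `e_α` gives
  -- `P_α D_α`. In all other terms the index is shifted by one, hence the minus sign.
  have h1 : ∀ α, P α (∑ i : Fin (q + 1 + 1), (-1 : ℤ) ^ (i : ℕ) •
      ∑ μ, (Matrix.vecCons (Pi.single α 1) v : Fin (q + 1 + 1) → Fin k → ℝ) i μ •
        D μ (w (i.removeNth (Matrix.vecCons (Pi.single α 1) v)))) =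
      P α (D α (w v)) - ∑ i : Fin (q + 1), (-1 : ℤ) ^ (i : ℕ) • ∑ μ, v i μ •
        P α (D μ (w (Matrix.vecCons (Pi.single α 1) (i.removeNth v)))) := by
    intro α
    rw [Fin.sum_univ_succ]
    simp only [Fin.val_zero, pow_zero, one_smul, Matrix.cons_val_zero, removeNth_zero_vecCons,
      sum_single_smul, Fin.val_succ, Matrix.cons_val_succ, removeNth_succ_vecCons, map_add, map_neg,
      map_sum, map_zsmul, map_smul, pow_succ, mul_neg, mul_one, neg_smul, Finset.sum_neg_distrib,
      sub_eq_add_neg]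
  have h2 : ∀ i : Fin (q + 1), ∑ μ, v i μ • D μ (∑ α, P α
        (w (Matrix.vecCons (Pi.single α 1) (i.removeNth v)))) =
      (∑ α, ∑ μ, v i μ • P α (D μ (w (Matrix.vecCons (Pi.single α 1) (i.removeNth v))))) +
        ε • w (Matrix.vecCons (v i) (i.removeNth v)) := by
    intro i
    rw [map_eq_sum_vecCons w (v i), Finset.smul_sum, Finset.sum_comm, ← Finset.sum_add_distrib]
    refine Finset.sum_congr rfl fun μ _ => ?_
    rw [map_sum, ← Finset.smul_sum, smul_comm ε, ← smul_add]
    congr 1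
    simp only [h, Finset.sum_add_distrib, Finset.sum_ite_eq, Finset.mem_univ, if_true]
  -- Moving `v i` back to its place cancels the sign, so each of the `q + 1` commutator terms equals
  -- `ε • w v`. This is the origin of the constant `ε * (q + 1)`.
  have h3 : ∑ i : Fin (q + 1), (-1 : ℤ) ^ (i : ℕ) •
      ε • w (Matrix.vecCons (v i) (i.removeNth v)) = (ε * (q + 1)) • w v := by
    simp only [smul_comm _ ε, neg_one_pow_smul_vecCons_removeNth, Finset.sum_const,
      Finset.card_univ, Fintype.card_fin]
    rw [← Nat.cast_smul_eq_nsmul ℝ, smul_smul, Nat.cast_add, Nat.cast_one]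
  simp only [h1, h2, smul_add, Finset.sum_add_distrib, Finset.sum_sub_distrib, h3]
  have h4 : ∑ α, ∑ i : Fin (q + 1), (-1 : ℤ) ^ (i : ℕ) • ∑ μ, v i μ •
        P α (D μ (w (Matrix.vecCons (Pi.single α 1) (i.removeNth v)))) =
      ∑ i : Fin (q + 1), (-1 : ℤ) ^ (i : ℕ) • ∑ α, ∑ μ, v i μ •
        P α (D μ (w (Matrix.vecCons (Pi.single α 1) (i.removeNth v)))) := by
    rw [Finset.sum_comm]
    simp only [Finset.smul_sum]
  rw [h4]
  abel

end Forms

/-! ### Splitting off the first direction -/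

section Split

variable {n : ℕ} {A : Type} [AddCommGroup A] [Module ℝ A]

/-- A form in the directions `2, …, n + 1`, seen as a form in all directions. -/
def pull {q : ℕ} (θ : Form n A q) : Form (n + 1) A q :=
  θ.compLinearMap (LinearMap.funLeft ℝ ℝ Fin.succ)

/-- The part without `dx^1` of a form. -/
def front {q : ℕ} (w : Form (n + 1) A q) : Form n A q :=
  w.compLinearMap (LinearMap.pi (Fin.cons 0 fun α => LinearMap.proj α))

/-- The exterior multiplication by `dx^1`. -/
def wedgeFirst (q : ℕ) : Form (n + 1) A q →ₗ[ℝ] Form (n + 1) A (q + 1) :=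
  dForm (Pi.single 0 LinearMap.id) q

/-- The contraction with the first basis vector. -/
def contractFirst {q : ℕ} (w : Form (n + 1) A (q + 1)) : Form (n + 1) A q :=
  w.curryLeft (Pi.single 0 1)

theorem pull_apply {q : ℕ} (θ : Form n A q) (v : Fin q → Fin (n + 1) → ℝ) :
    pull θ v = θ fun i => Fin.tail (v i) := rfl

theorem front_apply {q : ℕ} (w : Form (n + 1) A q) (v : Fin q → Fin n → ℝ) :
    front w v = w fun i => Fin.cons (α := fun _ => ℝ) 0 (v i) := by
  rw [front, AlternatingMap.compLinearMap_apply]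
  congr 1
  funext i μ
  refine Fin.cases ?_ (fun α => ?_) μ <;> simp

theorem front_pull {q : ℕ} (θ : Form n A q) : front (pull θ) = θ := by
  ext v
  rw [front_apply, pull_apply]
  rfl

theorem front_add {q : ℕ} (w w' : Form (n + 1) A q) : front (w + w') = front w + front w' := rfl

theorem front_sub {q : ℕ} (w w' : Form (n + 1) A q) : front (w - w') = front w - front w' := rfl

theorem pull_sub {q : ℕ} (w w' : Form n A q) : pull (w - w') = pull w - pull w' := rfl

theorem pull_smul {q : ℕ} (c : ℝ) (w : Form n A q) : pull (c • w) = c • pull w := rfl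

theorem pull_add {q : ℕ} (w w' : Form n A q) : pull (w + w') = pull w + pull w' := rfl

theorem pull_zero {q : ℕ} : pull (0 : Form n A q) = 0 := rfl

theorem dForm_front (D : Fin (n + 1) → A →ₗ[ℝ] A) {q : ℕ} (w : Form (n + 1) A q) :
    dForm (fun α => D α.succ) q (front w) = front (dForm D q w) := by
  ext v
  rw [front_apply, dForm_apply, dForm_apply]
  refine Finset.sum_congr rfl fun i _ => ?_
  rw [Fin.sum_univ_succ]
  simp only [Fin.cons_zero, zero_smul, zero_add, Fin.cons_succ, front_apply]
  rfl

theorem wedgeFirst_apply {q : ℕ} (w : Form (n + 1) A q) (v : Fin (q + 1) → Fin (n + 1) → ℝ) :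
    wedgeFirst q w v = ∑ i : Fin (q + 1), (-1 : ℤ) ^ (i : ℕ) • v i 0 • w (i.removeNth v) := by
  rw [wedgeFirst, dForm_apply]
  refine Finset.sum_congr rfl fun i _ => ?_
  rw [Fin.sum_univ_succ]
  simp

theorem front_wedgeFirst {q : ℕ} (w : Form (n + 1) A q) : front (wedgeFirst q w) = 0 := by
  ext v
  rw [front_apply, wedgeFirst_apply]
  simp

theorem dForm_pull (D : Fin (n + 1) → A →ₗ[ℝ] A) {q : ℕ} (θ : Form n A q) :
    dForm D q (pull θ) = pull (dForm (fun α => D α.succ) q θ) +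
      wedgeFirst q (pull ((D 0).compAlternatingMap θ)) := by
  ext v
  rw [AlternatingMap.add_apply, wedgeFirst_apply, pull_apply, dForm_apply, dForm_apply,
    ← Finset.sum_add_distrib]
  refine Finset.sum_congr rfl fun i _ => ?_
  rw [Fin.sum_univ_succ, ← smul_add, add_comm (v i 0 • _)]
  rfl

/-- Multiplication by `dx^1` is itself the differential of the family `(id, 0, …, 0)`, which
commutes with every family of coefficient operators. The sign rule is thus a case of anticommuting
differentials, just as `wedgeFirst_wedgeFirst` is a case of `d² = 0`. -/
theorem dForm_wedgeFirst {D : Fin (n + 1) → A →ₗ[ℝ] A}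
    (hD : ∀ μ ν a, D μ (D ν a) = D ν (D μ a)) {q : ℕ} (w : Form (n + 1) A q) :
    dForm D (q + 1) (wedgeFirst q w) = -wedgeFirst (q + 1) (dForm D q w) := by
  have h0 : ∀ (μ : Fin (n + 1)) (T : A →ₗ[ℝ] A) (a : A),
      T ((Pi.single 0 LinearMap.id : Fin (n + 1) → A →ₗ[ℝ] A) μ a) =
        (Pi.single 0 LinearMap.id : Fin (n + 1) → A →ₗ[ℝ] A) μ (T a) := by
    intro μ T a
    refine Fin.cases ?_ (fun α => ?_) μ <;> simp
  exact dForm_anticomm hD (fun μ ν a => h0 ν _ a) (fun μ ν a => h0 ν _ a) q w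

theorem wedgeFirst_wedgeFirst {q : ℕ} (w : Form (n + 1) A q) :
    wedgeFirst (q + 1) (wedgeFirst q w) = 0 := by
  refine dForm_dForm (fun μ ν a => ?_) q w
  refine Fin.cases ?_ (fun α => ?_) μ <;> refine Fin.cases ?_ (fun β => ?_) ν <;> simp

theorem contract_single {q : ℕ} (w : Form (n + 1) A (q + 1)) :
    contract (Pi.single 0 LinearMap.id) w = contractFirst w := by
  ext v
  rw [contract_apply, Fin.sum_univ_succ]
  simp [contractFirst]

theorem sum_single_comp : (∑ α, (Pi.single 0 LinearMap.id : Fin (n + 1) → A →ₗ[ℝ] A) α ∘ₗ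
    (Pi.single 0 LinearMap.id : Fin (n + 1) → A →ₗ[ℝ] A) α) = LinearMap.id := by
  rw [Fin.sum_univ_succ]
  ext a
  simp

theorem contractFirst_wedgeFirst_zero (w : Form (n + 1) A 0) :
    contractFirst (wedgeFirst 0 w) = w := by
  rw [← contract_single, wedgeFirst, contract_dForm_zero, sum_single_comp]
  ext v
  rfl

/-- Cartan's formula for the family `(id, 0, …, 0)`, used both as differential and as contraction;
everything commutes, so `ε = 0`. -/
theorem contractFirst_wedgeFirst_succ {q : ℕ} (w : Form (n + 1) A (q + 1)) :
    contractFirst (wedgeFirst (q + 1) w) + wedgeFirst q (contractFirst w) = w := by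
  rw [← contract_single, ← contract_single, wedgeFirst, wedgeFirst,
    contract_dForm_succ (ε := 0), sum_single_comp]
  · ext v
    simp
  · intro α β a
    refine Fin.cases ?_ (fun α => ?_) α <;> refine Fin.cases ?_ (fun β => ?_) β <;> simp

/-- It suffices to test on basis vectors. If one of them is `e_1`, both sides vanish, the right one
by hypothesis; if none is, deleting and restoring the zero first component changes nothing. -/
theorem pull_front_of_contractFirst {q : ℕ} {w : Form (n + 1) A (q + 1)}
    (h : contractFirst w = 0) : pull (front w) = w := by
  refine (Pi.basisFun ℝ (Fin (n + 1))).ext_alternating fun v _ => ?_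
  rw [pull_apply, front_apply]
  simp only [Pi.basisFun_apply]
  by_cases hv : ∃ i, v i = 0
  · obtain ⟨i, hi⟩ := hv
    have h1 : w (fun i => Pi.single (v i) 1) = 0 := by
      rw [← neg_one_pow_smul_vecCons_removeNth w _ i]
      have := DFunLike.congr_fun h (i.removeNth fun i => (Pi.single (v i) 1 : Fin (n + 1) → ℝ))
      rw [contractFirst, AlternatingMap.curryLeft_apply_apply] at this
      rw [hi, this]
      simp
    rw [h1]
    refine w.map_coord_zero i ?_
    funext μ
    rw [hi]
    refine Fin.cases ?_ (fun α => ?_) μ <;> simp [Fin.tail]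
  · push Not at hv
    congr 1
    funext i μ
    refine Fin.cases ?_ (fun α => ?_) μ
    · simp [Ne.symm (hv i)]
    · simp [Fin.tail]

theorem pull_front_zero (w : Form (n + 1) A 0) : pull (front w) = w := by
  ext v
  rw [pull_apply, front_apply]
  congr 1
  exact Subsingleton.elim _ _

theorem contractFirst_contractFirst {q : ℕ} (w : Form (n + 1) A (q + 2)) :
    contractFirst (contractFirst w) = 0 := AlternatingMap.curryLeft_same _ _

/-- Every form is `θ + dx^1 ∧ θ'`. -/
theorem eq_pull_add_wedgeFirst {q : ℕ} (w : Form (n + 1) A (q + 1)) :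
    w = pull (front w) + wedgeFirst q (pull (front (contractFirst w))) := by
  have h1 : pull (front (contractFirst w)) = contractFirst w := by
    cases q with
    | zero => exact pull_front_zero _
    | succ q => exact pull_front_of_contractFirst (contractFirst_contractFirst w)
  have h2 := contractFirst_wedgeFirst_succ w
  -- The other summand of `w` in `h2` is a multiple of `dx^1`, so it does not contribute to the
  -- front part.
  have h3 : front w = front (contractFirst (wedgeFirst (q + 1) w)) := by
    conv_lhs => rw [← h2]
    rw [front_add, front_wedgeFirst, add_zero]
  rw [h1, h3, pull_front_of_contractFirst (contractFirst_contractFirst _), h2]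

theorem contractFirst_pull {q : ℕ} (θ : Form n A (q + 1)) : contractFirst (pull θ) = 0 := by
  ext v
  rw [contractFirst, AlternatingMap.curryLeft_apply_apply, pull_apply]
  refine θ.map_coord_zero 0 ?_
  funext α
  simp [Fin.tail]

theorem wedgeFirst_pull_injective {q : ℕ} {θ : Form n A q} (h : wedgeFirst q (pull θ) = 0) :
    θ = 0 := by
  have h1 : pull θ = 0 := by
    cases q with
    | zero =>
      rw [← contractFirst_wedgeFirst_zero (pull θ), h]
      rfl
    | succ q =>
      have h2 := contractFirst_wedgeFirst_succ (pull θ)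
      rw [h, contractFirst_pull, map_zero, add_zero] at h2
      rw [← h2]
      rfl
  rw [← front_pull θ, h1]
  rfl

theorem pull_add_wedgeFirst_eq_zero {q : ℕ} {θ : Form n A (q + 1)} {θ' : Form n A q}
    (h : pull θ + wedgeFirst q (pull θ') = 0) : θ = 0 ∧ θ' = 0 := by
  have h1 : θ = 0 := by
    have := congrArg front h
    rw [front_add, front_pull, front_wedgeFirst, add_zero] at this
    rw [this]
    rfl
  refine ⟨h1, wedgeFirst_pull_injective ?_⟩
  rw [h1, pull_zero, zero_add] at h
  exact h

/-- The differential of `θ + dx^1 ∧ θ'`. -/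
theorem dForm_pull_add_wedgeFirst {D : Fin (n + 1) → A →ₗ[ℝ] A}
    (hD : ∀ μ ν a, D μ (D ν a) = D ν (D μ a)) {q : ℕ} (θ : Form n A (q + 1)) (θ' : Form n A q) :
    dForm D (q + 1) (pull θ + wedgeFirst q (pull θ')) =
      pull (dForm (fun α => D α.succ) (q + 1) θ) + wedgeFirst (q + 1) (pull
        ((D 0).compAlternatingMap θ - dForm (fun α => D α.succ) q θ')) := by
  rw [map_add, dForm_wedgeFirst hD, dForm_pull, dForm_pull, map_add, wedgeFirst_wedgeFirst,
    add_zero, pull_sub, map_sub]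
  abel

end Split

/-! ### Vector fields -/

section VectorField

variable {V : Type}

theorem vectorField_pderiv_eq (c : V → FinSmooth V) (v : V) (f : FinSmooth V) :
    pderiv v (vectorField c f) =
      vectorField c (pderiv v f) + vectorField (fun w => pderiv v (c w)) f := by
  obtain ⟨S, hS⟩ := f.2
  rw [vectorField_eq_sum c hS, vectorField_eq_sum _ hS,
    vectorField_eq_sum c (f := pderiv v f) (DependsOn.pderivFun hS v),
    map_sum, ← Finset.sum_add_distrib]
  refine Finset.sum_congr rfl fun w _ => ?_
  rw [pderiv_mul, pderiv_comm v w]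
  ring

theorem vectorField_commutator (c e : V → FinSmooth V) (f : FinSmooth V) :
    vectorField c (vectorField e f) = vectorField e (vectorField c f) +
      vectorField (fun v => vectorField c (e v) - vectorField e (c v)) f := by
  obtain ⟨S, hS⟩ := f.2
  have hv : ∀ v, DependsOn S (pderiv v f).1 := fun v => DependsOn.pderivFun hS v
  have key : ∀ c e : V → FinSmooth V, vectorField c (vectorField e f) =
      ∑ v ∈ S, vectorField c (e v) * pderiv v f +
        ∑ v ∈ S, ∑ w ∈ S, e v * (c w * pderiv w (pderiv v f)) := by
    intro c e
    rw [vectorField_eq_sum e hS, map_sum, ← Finset.sum_add_distrib]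
    refine Finset.sum_congr rfl fun v _ => ?_
    rw [vectorField_mul, vectorField_eq_sum c (hv v), Finset.mul_sum]
    ring
  rw [key c e, key e c, vectorField_eq_sum _ hS]
  simp only [sub_mul, Finset.sum_sub_distrib]
  have h1 : ∑ v ∈ S, ∑ w ∈ S, e v * (c w * pderiv w (pderiv v f)) =
      ∑ v ∈ S, ∑ w ∈ S, c v * (e w * pderiv w (pderiv v f)) := by
    rw [Finset.sum_comm]
    exact Finset.sum_congr rfl fun v _ => Finset.sum_congr rfl fun w _ => by
      rw [pderiv_comm]; ring
  rw [h1]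
  abel

end VectorField

/-! ### Calculus in the global coordinates of the solution manifold -/

section Calculus

variable {n : ℕ}

/-- The global coordinates as elements of `A(CE)`. -/
def cv (v : CEVar n) : ACE (n + 1) := (inCoords n).symm (coord v)

theorem inCoords_cv (v : CEVar n) : inCoords n (cv v) = coord v :=
  (inCoords n).apply_symm_apply _

theorem inCoords_pderivCE (v : CEVar n) (f : ACE (n + 1)) :
    inCoords n (pderivCE v f) = pderiv v (inCoords n f) :=
  (inCoords n).apply_symm_apply _

/-- The derivation `∑_v c_v ∂_v` of `A(CE)`. -/
def vfCE (c : CEVar n → ACE (n + 1)) : ACE (n + 1) →ₗ[ℝ] ACE (n + 1) :=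
  (inCoords n).symm.toLinearMap ∘ₗ vectorField (fun v => inCoords n (c v)) ∘ₗ
    (inCoords n).toLinearMap

theorem inCoords_vfCE (c : CEVar n → ACE (n + 1)) (f : ACE (n + 1)) :
    inCoords n (vfCE c f) = vectorField (fun v => inCoords n (c v)) (inCoords n f) :=
  (inCoords n).apply_symm_apply _

theorem vfCE_mul (c : CEVar n → ACE (n + 1)) (f g : ACE (n + 1)) :
    vfCE c (f * g) = f * vfCE c g + g * vfCE c f := by
  apply (inCoords n).injective
  simp only [inCoords_vfCE, map_mul, map_add, vectorField_mul]

theorem pderivCE_mul (v : CEVar n) (f g : ACE (n + 1)) :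
    pderivCE v (f * g) = f * pderivCE v g + g * pderivCE v f := by
  apply (inCoords n).injective
  simp only [inCoords_pderivCE, map_mul, map_add, pderiv_mul]

theorem pderivCE_comm (v w : CEVar n) (f : ACE (n + 1)) :
    pderivCE v (pderivCE w f) = pderivCE w (pderivCE v f) := by
  apply (inCoords n).injective
  simp only [inCoords_pderivCE, pderiv_comm v w]

theorem vfCE_cv (c : CEVar n → ACE (n + 1)) (v : CEVar n) : vfCE c (cv v) = c v := by
  apply (inCoords n).injective
  rw [inCoords_vfCE, inCoords_cv, vectorField_coord]

open Classical in
theorem pderivCE_cv (v w : CEVar n) : pderivCE v (cv w) = if v = w then 1 else 0 := by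
  apply (inCoords n).injective
  rw [inCoords_pderivCE, inCoords_cv, pderiv_coord]
  split_ifs <;> simp

theorem pderivCE_vfCE (c : CEVar n → ACE (n + 1)) (v : CEVar n) (f : ACE (n + 1)) :
    pderivCE v (vfCE c f) = vfCE c (pderivCE v f) + vfCE (fun w => pderivCE v (c w)) f := by
  apply (inCoords n).injective
  simp only [inCoords_vfCE, inCoords_pderivCE, map_add, vectorField_pderiv_eq]

theorem vfCE_commutator (c e : CEVar n → ACE (n + 1)) (f : ACE (n + 1)) :
    vfCE c (vfCE e f) = vfCE e (vfCE c f) + vfCE (fun v => vfCE c (e v) - vfCE e (c v)) f := by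
  apply (inCoords n).injective
  simp only [inCoords_vfCE, map_add, map_sub]
  exact vectorField_commutator _ _ _

theorem vfCE_eq_finsum (c : CEVar n → ACE (n + 1)) (f : ACE (n + 1)) :
    vfCE c f = ∑ᶠ v, c v * pderivCE v f := by
  apply (inCoords n).injective
  rw [inCoords_vfCE]
  have h : (Function.support fun v => c v * pderivCE v f).Finite :=
    (pderivCE_support_finite f).subset fun v hv h => hv (by simp [h])
  have h1 := (inCoords n).toAlgHom.toLinearMap.toAddMonoidHom.map_finsum h
  refine Eq.trans ?_ h1.symm
  change ∑ᶠ v, _ = ∑ᶠ v, inCoords n (c v * pderivCE v f)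
  simp only [map_mul, inCoords_pderivCE]

theorem vfCE_eq_sum (c : CEVar n → ACE (n + 1)) {f : ACE (n + 1)} {S : Finset (CEVar n)}
    (hS : ∀ v, pderivCE v f ≠ 0 → v ∈ S) : vfCE c f = ∑ v ∈ S, c v * pderivCE v f := by
  rw [vfCE_eq_finsum]
  refine finsum_eq_sum_of_support_subset _ fun v hv => hS v fun h => hv ?_
  simp [h]

theorem vfCE_congr {c e : CEVar n → ACE (n + 1)} {f : ACE (n + 1)}
    (h : ∀ v, pderivCE v f ≠ 0 → c v = e v) : vfCE c f = vfCE e f := by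
  rw [vfCE_eq_finsum, vfCE_eq_finsum]
  refine finsum_congr fun v => ?_
  by_cases hv : pderivCE v f = 0
  · simp [hv]
  · rw [h v hv]

theorem vfCE_eq_mul_pderivCE {c : CEVar n → ACE (n + 1)} (w : CEVar n)
    (h : ∀ v, v ≠ w → c v = 0) (f : ACE (n + 1)) : vfCE c f = c w * pderivCE w f := by
  rw [vfCE_eq_finsum]
  exact finsum_eq_single _ w fun v hv => by simp [h v hv]

theorem vfCE_zero (f : ACE (n + 1)) : vfCE (fun _ => 0) f = 0 := by
  rw [vfCE_eq_finsum]
  simp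

theorem vfCE_sum {ι : Type} (s : Finset ι) (g : ι → ACE (n + 1)) (c : ι → CEVar n → ACE (n + 1))
    (f : ACE (n + 1)) :
    ∑ i ∈ s, g i * vfCE (c i) f = vfCE (fun v => ∑ i ∈ s, g i * c i v) f := by
  have hS : ∀ v, pderivCE v f ≠ 0 → v ∈ (pderivCE_support_finite f).toFinset := fun v hv => by
    simpa using hv
  simp only [vfCE_eq_sum _ hS, Finset.mul_sum, Finset.sum_mul]
  rw [Finset.sum_comm]
  simp only [mul_assoc]

/-- The total derivatives are derivations of `A(CE)`. -/
theorem DCE_eq_vfCE (μ : Fin (n + 1)) (f : ACE (n + 1)) :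
    DCE μ f = vfCE (fun v => DCE μ (cv v)) f := by
  obtain ⟨f, rfl⟩ := restr_surjective _ f
  apply (inCoords n).injective
  have hcv : ∀ v : CEVar n, cv v = restr (n + 1) (coord (toBVar v)) := fun v => rfl
  have hin : ∀ g, inCoords n (restr (n + 1) g) = pullback param isFinSmooth_param g :=
    fun g => rfl
  rw [inCoords_vfCE, DCE_restr, hin, hin]
  ext y
  rw [vectorField_apply]
  change (vectorField (totalCoeff μ) f).1 (param y) = _
  rw [vectorField_apply]
  have h1 : ∀ v : CEVar n, (inCoords n (DCE μ (cv v))).1 y =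
      (totalCoeff μ (toBVar v)).1 (param y) := by
    intro v
    rw [hcv, DCE_restr, DB, vectorField_coord, hin]
    rfl
  simp only [h1]
  -- The equations of `CE` are linear and are preserved by the total derivative, so the line through
  -- a point of `CE` in the direction of `D_μ` stays in `CE`. The derivative along this line can
  -- then be computed in the global coordinates.
  have h2 : ∀ t : ℝ, (fun v => param y v + t * (totalCoeff μ v).1 (param y)) ∈
      solManifold (n + 1) := by
    intro t i
    have hb := param_mem y
    have h1 := hb i
    have h2 := hb (i + Pi.single μ 1)
    simp only [totalCoeff, coord, Finset.sum_add_distrib, h1, ← Finset.mul_sum]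
    have h3 : ∑ l, param y (.u l (i + Pi.single l 1 + Pi.single μ 1)) = 0 := by
      rw [← h2]
      exact Finset.sum_congr rfl fun l _ => by rw [add_right_comm]
    rw [h3]
    simp
  congr 1
  funext t
  change _ = f.1 (param _)
  rw [← param_of_mem (h2 t)]
  simp only [param_toBVar]

theorem DCE_mul (μ : Fin (n + 1)) (f g : ACE (n + 1)) :
    DCE μ (f * g) = f * DCE μ g + g * DCE μ f := by
  rw [DCE_eq_vfCE, vfCE_mul, ← DCE_eq_vfCE, ← DCE_eq_vfCE]

theorem mcons_add_single_zero (k : ℕ) (j : Fin n → ℕ) :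
    mcons k j + Pi.single 0 1 = mcons (k + 1) j := by
  funext μ
  refine Fin.cases ?_ (fun α => ?_) μ <;> simp

theorem mcons_add_single_succ (k : ℕ) (j : Fin n → ℕ) (α : Fin n) :
    mcons k j + Pi.single α.succ 1 = mcons k (j + Pi.single α 1) := by
  funext μ
  refine Fin.cases ?_ (fun β => ?_) μ
  · simp
  · simp [Pi.single_apply]

theorem eq_x_or_var (v : CEVar n) : (∃ μ, v = .x μ) ∨ ∃ (a : ThetaField n) (j : Fin n → ℕ),
    v = a.var j := by
  cases v with
  | x μ => exact .inl ⟨μ, rfl⟩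
  | u1 j => exact .inr ⟨.u1, j, rfl⟩
  | u α i => exact .inr ⟨.u α (i 0), Fin.tail i, by
      simp [ThetaField.var, mcons, Fin.cons_self_tail]⟩
  | p i => exact .inr ⟨.p (i 0), Fin.tail i, by
      simp [ThetaField.var, mcons, Fin.cons_self_tail]⟩

theorem x_ne_var (μ : Fin (n + 1)) (a : ThetaField n) (j : Fin n → ℕ) : CEVar.x μ ≠ a.var j := by
  cases a <;> simp [ThetaField.var]

theorem var_inj {a b : ThetaField n} {i j : Fin n → ℕ} : a.var i = b.var j ↔ a = b ∧ i = j := by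
  refine ⟨fun h => ?_, by rintro ⟨rfl, rfl⟩; rfl⟩
  simpa using @ThetaField.var_injective n (a, i) (b, j) h

theorem DCE_x (μ ν : Fin (n + 1)) : DCE μ (cv (.x ν) : ACE (n + 1)) = if ν = μ then 1 else 0 := by
  have h : (cv (.x ν) : ACE (n + 1)) = restr (n + 1) (coord (.x ν)) := rfl
  rw [h, DCE_restr, DB, vectorField_coord, totalCoeff]
  split_ifs <;> simp

theorem DCE_var (α : Fin n) (a : ThetaField n) (j : Fin n → ℕ) :
    DCE α.succ (cv (a.var j)) = cv (a.var (j + Pi.single α 1)) := by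
  have h : ∀ v : CEVar n, cv v = restr (n + 1) (coord (toBVar v)) := fun v => rfl
  rw [h, h, DCE_restr, DB, vectorField_coord]
  cases a <;> simp only [ThetaField.var, toBVar, totalCoeff, mcons_add_single_succ]

/-- The derivative `u^1_{1,j}` is not a global coordinate of `CE`; the continuity equation with the
multi-index `(0, j)` eliminates it. -/
theorem DCE_zero_u1 (j : Fin n → ℕ) : DCE 0 (cv (ThetaField.u1.var j)) =
    -∑ α : Fin n, cv ((ThetaField.u α 0).var (j + Pi.single α 1)) := by
  have h : ∀ v : CEVar n, cv v = restr (n + 1) (coord (toBVar v)) := fun v => rfl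
  simp only [h]
  rw [DCE_restr, DB, vectorField_coord, ← map_sum, ← map_neg, restr_eq_iff]
  intro b hb
  have h1 := hb (mcons 0 j)
  rw [Fin.sum_univ_succ] at h1
  simp only [mcons_add_single_succ] at h1
  simp only [ThetaField.var, toBVar, totalCoeff]
  rw [sub_neg_eq_add]
  change _ + (∑ α : Fin n, coord (BVar.u α.succ (mcons 0 (j + Pi.single α 1)))).1 b = 0
  rw [AddSubmonoidClass.coe_finsetSum, Finset.sum_apply]
  exact h1

theorem DCE_zero_u (α : Fin n) (k : ℕ) (j : Fin n → ℕ) :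
    DCE 0 (cv ((ThetaField.u α k).var j)) = cv ((ThetaField.u α (k + 1)).var j) := by
  have h : ∀ v : CEVar n, cv v = restr (n + 1) (coord (toBVar v)) := fun v => rfl
  rw [h, h, DCE_restr, DB, vectorField_coord]
  simp only [ThetaField.var, toBVar, totalCoeff, mcons_add_single_zero]

theorem DCE_zero_p (k : ℕ) (j : Fin n → ℕ) :
    DCE 0 (cv ((ThetaField.p k).var j)) = (cv ((ThetaField.p (k + 1)).var j) : ACE (n + 1)) := by
  have h : ∀ v : CEVar n, cv v = restr (n + 1) (coord (toBVar v)) := fun v => rfl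
  rw [h, h, DCE_restr, DB, vectorField_coord]
  simp only [ThetaField.var, toBVar, totalCoeff, mcons_add_single_zero]

theorem pderivCE_DCE (μ : Fin (n + 1)) (v : CEVar n) (f : ACE (n + 1)) :
    pderivCE v (DCE μ f) = DCE μ (pderivCE v f) + vfCE (fun w => pderivCE v (DCE μ (cv w))) f := by
  rw [DCE_eq_vfCE, pderivCE_vfCE, ← DCE_eq_vfCE]

theorem pderivCE_one (v : CEVar n) : pderivCE v (1 : ACE (n + 1)) = 0 := by
  simpa using pderivCE_mul v (1 : ACE (n + 1)) 1

theorem pderivCE_DCE_x (μ ν : Fin (n + 1)) (v : CEVar n) :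
    pderivCE v (DCE μ (cv (.x ν) : ACE (n + 1))) = 0 := by
  rw [DCE_x]
  split_ifs
  · exact pderivCE_one v
  · simp

theorem add_single_eq_iff {α : Fin n} {i j : Fin n → ℕ} :
    j = i + Pi.single α 1 ↔ j α ≠ 0 ∧ i = j - Pi.single α 1 := by
  constructor
  · rintro rfl
    simp
  · rintro ⟨h, rfl⟩
    funext β
    by_cases hβ : β = α
    · subst hβ
      simp
      omega
    · simp [hβ]

/-- Among the coefficients of `D_α` only that of `a_{j-(α)}` contains `a_j`, with factor `1`. If `j
α = 0` there is no such coordinate; the case is separated because subtraction of natural numbers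
truncates. -/
theorem pderivCE_DCE_succ (α : Fin n) (a : ThetaField n) (j : Fin n → ℕ) (f : ACE (n + 1)) :
    pderivCE (a.var j) (DCE α.succ f) = DCE α.succ (pderivCE (a.var j) f) +
      if j α = 0 then 0 else pderivCE (a.var (j - Pi.single α 1)) f := by
  classical
  rw [pderivCE_DCE]
  congr 1
  have h2 : ∀ b i, pderivCE (a.var j) (DCE α.succ (cv (ThetaField.var b i))) =
      if a = b ∧ j α ≠ 0 ∧ i = j - Pi.single α 1 then 1 else 0 := by
    intro b i
    rw [DCE_var, pderivCE_cv]
    simp only [var_inj, add_single_eq_iff]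
  by_cases hj : j α = 0
  · rw [if_pos hj, ← vfCE_zero f]
    congr 2
    funext w
    rcases eq_x_or_var w with ⟨ν, rfl⟩ | ⟨b, i, rfl⟩
    · exact pderivCE_DCE_x _ _ _
    · simp [h2, hj]
  · rw [if_neg hj, vfCE_eq_mul_pderivCE (a.var (j - Pi.single α 1))]
    · simp [h2, hj]
    · intro w hw
      rcases eq_x_or_var w with ⟨ν, rfl⟩ | ⟨b, i, rfl⟩
      · exact pderivCE_DCE_x _ _ _
      · rw [h2, if_neg]
        rintro ⟨rfl, -, rfl⟩
        exact hw rfl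

theorem pderivCE_DCE_zero_u1 (j : Fin n → ℕ) (f : ACE (n + 1)) :
    pderivCE (ThetaField.u1.var j) (DCE 0 f) = DCE 0 (pderivCE (ThetaField.u1.var j) f) := by
  classical
  rw [pderivCE_DCE, add_eq_left, ← vfCE_zero f]
  congr 2
  funext w
  rcases eq_x_or_var w with ⟨ν, rfl⟩ | ⟨b, i, rfl⟩
  · exact pderivCE_DCE_x _ _ _
  · cases b <;> simp [DCE_zero_u1, DCE_zero_u, DCE_zero_p, pderivCE_cv, var_inj]

/-- No `u^α_{-1}` exists, so the usual shift in `k` is absent. Instead `u^α_{0,j}` occurs, with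
factor `-1`, in `D_1 u^1_{0,j-(α)}`, because of the continuity equation. This term becomes the
summand `D_α χ^0_1` of `DTilde`. -/
theorem pderivCE_DCE_zero_u_zero (α : Fin n) (j : Fin n → ℕ) (f : ACE (n + 1)) :
    pderivCE ((ThetaField.u α 0).var j) (DCE 0 f) =
      DCE 0 (pderivCE ((ThetaField.u α 0).var j) f) -
        if j α = 0 then 0 else pderivCE (ThetaField.u1.var (j - Pi.single α 1)) f := by
  classical
  rw [pderivCE_DCE, sub_eq_add_neg]
  congr 1
  have h2 : ∀ i, pderivCE ((ThetaField.u α 0).var j) (DCE 0 (cv (ThetaField.u1.var i))) =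
      if j α ≠ 0 ∧ i = j - Pi.single α 1 then -1 else 0 := by
    intro i
    rw [DCE_zero_u1, map_neg, map_sum, Finset.sum_eq_single α]
    · rw [pderivCE_cv]
      simp only [var_inj, add_single_eq_iff, true_and]
      split_ifs <;> simp
    · intro β _ hβ
      simp [pderivCE_cv, var_inj, Ne.symm hβ]
    · simp
  have h3 : ∀ b i, b ≠ ThetaField.u1 →
      pderivCE ((ThetaField.u α 0).var j) (DCE 0 (cv (ThetaField.var b i))) = 0 := by
    intro b i hb
    cases b with
    | u1 => exact absurd rfl hb
    | u β k => simp [DCE_zero_u, pderivCE_cv, var_inj]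
    | p k => simp [DCE_zero_p, pderivCE_cv, var_inj]
  by_cases hj : j α = 0
  · rw [if_pos hj, neg_zero, ← vfCE_zero f]
    congr 2
    funext w
    rcases eq_x_or_var w with ⟨ν, rfl⟩ | ⟨b, i, rfl⟩
    · exact pderivCE_DCE_x _ _ _
    · by_cases hb : b = ThetaField.u1
      · subst hb; simp [h2, hj]
      · exact h3 b i hb
  · rw [if_neg hj, vfCE_eq_mul_pderivCE (ThetaField.u1.var (j - Pi.single α 1))]
    · simp [h2, hj]
    · intro w hw
      rcases eq_x_or_var w with ⟨ν, rfl⟩ | ⟨b, i, rfl⟩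
      · exact pderivCE_DCE_x _ _ _
      · by_cases hb : b = ThetaField.u1
        · subst hb
          rw [h2, if_neg]
          rintro ⟨-, rfl⟩
          exact hw rfl
        · exact h3 b i hb

theorem pderivCE_DCE_zero_u_succ (α : Fin n) (k : ℕ) (j : Fin n → ℕ) (f : ACE (n + 1)) :
    pderivCE ((ThetaField.u α (k + 1)).var j) (DCE 0 f) =
      DCE 0 (pderivCE ((ThetaField.u α (k + 1)).var j) f) +
        pderivCE ((ThetaField.u α k).var j) f := by
  classical
  rw [pderivCE_DCE, vfCE_eq_mul_pderivCE ((ThetaField.u α k).var j)]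
  · simp [DCE_zero_u, pderivCE_cv]
  · intro w hw
    rcases eq_x_or_var w with ⟨ν, rfl⟩ | ⟨b, i, rfl⟩
    · exact pderivCE_DCE_x _ _ _
    · cases b with
      | u1 => simp [DCE_zero_u1, pderivCE_cv, var_inj]
      | u β l =>
        rw [DCE_zero_u, pderivCE_cv, if_neg]
        rw [var_inj]
        rintro ⟨h, rfl⟩
        simp only [ThetaField.u.injEq, Nat.add_right_cancel_iff] at h
        obtain ⟨rfl, rfl⟩ := h
        exact hw rfl
      | p l => simp [DCE_zero_p, pderivCE_cv, var_inj]

theorem pderivCE_DCE_zero_p_zero (j : Fin n → ℕ) (f : ACE (n + 1)) :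
    pderivCE ((ThetaField.p 0).var j) (DCE 0 f) =
      DCE 0 (pderivCE ((ThetaField.p 0).var j) f) := by
  classical
  rw [pderivCE_DCE, add_eq_left, ← vfCE_zero f]
  congr 2
  funext w
  rcases eq_x_or_var w with ⟨ν, rfl⟩ | ⟨b, i, rfl⟩
  · exact pderivCE_DCE_x _ _ _
  · cases b <;> simp [DCE_zero_u1, DCE_zero_u, DCE_zero_p, pderivCE_cv, var_inj]

theorem pderivCE_DCE_zero_p_succ (k : ℕ) (j : Fin n → ℕ) (f : ACE (n + 1)) :
    pderivCE ((ThetaField.p (k + 1)).var j) (DCE 0 f) =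
      DCE 0 (pderivCE ((ThetaField.p (k + 1)).var j) f) +
        pderivCE ((ThetaField.p k).var j) f := by
  classical
  rw [pderivCE_DCE, vfCE_eq_mul_pderivCE ((ThetaField.p k).var j)]
  · simp [DCE_zero_p, pderivCE_cv]
  · intro w hw
    rcases eq_x_or_var w with ⟨ν, rfl⟩ | ⟨b, i, rfl⟩
    · exact pderivCE_DCE_x _ _ _
    · cases b with
      | u1 => simp [DCE_zero_u1, pderivCE_cv, var_inj]
      | u β l => simp [DCE_zero_u, pderivCE_cv, var_inj]
      | p l =>
        rw [DCE_zero_p, pderivCE_cv, if_neg]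
        rw [var_inj]
        rintro ⟨h, rfl⟩
        simp only [ThetaField.p.injEq, Nat.add_right_cancel_iff] at h
        exact hw (by rw [h])

end Calculus

/-! ### Euler fields on the solution manifold -/

section EulerCE

variable {n : ℕ}

theorem vfCE_eq_zero {c : CEVar n → ACE (n + 1)} (h : ∀ v, c v = 0) (f : ACE (n + 1)) :
    vfCE c f = 0 := by
  rw [show c = fun _ => 0 from funext h, vfCE_zero]

/-- The Euler field `∑_{v ∈ P} v ∂_v` on `CE`. -/
def eulerCE (P : CEVar n → Prop) [DecidablePred P] : ACE (n + 1) →ₗ[ℝ] ACE (n + 1) :=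
  vfCE fun v => if P v then cv v else 0

theorem inCoords_eulerCE (P : CEVar n → Prop) [DecidablePred P] (f : ACE (n + 1)) :
    inCoords n (eulerCE P f) = euler P (inCoords n f) := by
  rw [eulerCE, inCoords_vfCE, euler]
  congr 2
  funext v
  split_ifs
  · exact inCoords_cv v
  · exact map_zero _

/-- The operator `E + q + 1` is invertible, where `E` is an Euler field. -/
def eulerEquiv (P : CEVar n → Prop) [DecidablePred P] (q : ℕ) :
    ACE (n + 1) ≃ₗ[ℝ] ACE (n + 1) :=
  LinearEquiv.ofBijective (eulerCE P + ((q + 1 : ℕ) : ℝ) • LinearMap.id) <| by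
    constructor
    · refine (injective_iff_map_eq_zero _).2 fun f hf => ?_
      apply (inCoords n).injective
      rw [map_zero]
      refine euler_add_injective P (q := q + 1) (by omega) ?_
      rw [← inCoords_eulerCE, ← map_smul, ← map_add, ← map_zero (inCoords n)]
      exact congrArg _ hf
    · intro f
      obtain ⟨F, hF⟩ := euler_add_surjective P (q := q + 1) (by omega) (inCoords n f)
      refine ⟨(inCoords n).symm F, ?_⟩
      apply (inCoords n).injective
      rw [← hF]
      change inCoords n (eulerCE P _ + ((q + 1 : ℕ) : ℝ) • _) = _
      rw [map_add, map_smul, LinearMap.id_apply, inCoords_eulerCE, AlgEquiv.apply_symm_apply]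

theorem eulerCE_symm (P : CEVar n → Prop) [DecidablePred P] (q : ℕ) (f : ACE (n + 1)) :
    eulerCE P ((eulerEquiv P q).symm f) + ((q + 1 : ℕ) : ℝ) • (eulerEquiv P q).symm f = f :=
  (eulerEquiv P q).apply_symm_apply f

theorem eq_zero_of_eulerCE_add (P : CEVar n → Prop) [DecidablePred P] (q : ℕ) {f : ACE (n + 1)}
    (h : eulerCE P f + ((q + 1 : ℕ) : ℝ) • f = 0) : f = 0 :=
  (eulerEquiv P q).map_eq_zero_iff.1 h

theorem pderivCE_eulerCE (P : CEVar n → Prop) [DecidablePred P] (v : CEVar n)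
    (f : ACE (n + 1)) :
    pderivCE v (eulerCE P f) = eulerCE P (pderivCE v f) + if P v then pderivCE v f else 0 := by
  apply (inCoords n).injective
  rw [inCoords_pderivCE, inCoords_eulerCE, pderiv_euler, map_add, inCoords_eulerCE,
    inCoords_pderivCE]
  split_ifs
  · rw [inCoords_pderivCE]
  · rw [map_zero]

/-- The derivative `∂_v` lowers the degree of homogeneity by one, so `(E + 1) ∂_v f = ∂_v E f = 0`,
and `E + 1` is injective. -/
theorem pderivCE_eq_zero_of_eulerCE (P : CEVar n → Prop) [DecidablePred P] {f : ACE (n + 1)}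
    (h : eulerCE P f = 0) {v : CEVar n} (hv : P v) : pderivCE v f = 0 := by
  refine eq_zero_of_eulerCE_add P 0 ?_
  have h1 := pderivCE_eulerCE P v f
  rw [h, map_zero, if_pos hv] at h1
  simpa using h1.symm

theorem exists_eq_algebraMap {f : ACE (n + 1)} (h : ∀ v, pderivCE v f = 0) :
    ∃ c : ℝ, f = algebraMap ℝ (ACE (n + 1)) c := by
  refine ⟨(inCoords n f).1 0, (inCoords n).injective ?_⟩
  rw [AlgEquiv.commutes]
  ext b
  rw [eq_scale_zero (fun _ => True) (fun v _ => by rw [← inCoords_pderivCE, h, map_zero]) b]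
  exact congrArg (inCoords n f).1 (funext fun v => by simp [scale])

open Classical in
/-- The Euler field of the dependent variables and their derivatives. -/
def eulerJet : ACE (n + 1) →ₗ[ℝ] ACE (n + 1) :=
  eulerCE fun v : CEVar n => ∃ (a : ThetaField n) (j : Fin n → ℕ), v = a.var j

open Classical in
/-- The Euler field of the independent variables `x^2, …, x^m`. -/
def eulerBase : ACE (n + 1) →ₗ[ℝ] ACE (n + 1) :=
  eulerCE fun v : CEVar n => ∃ α : Fin n, v = .x α.succ

/-- Apart from `∂_{x^α}`, the field `D_α` sends jet coordinates to jet coordinates, linearly. It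
therefore preserves the degree in the fibre variables. -/
theorem eulerJet_DCE (α : Fin n) (f : ACE (n + 1)) :
    eulerJet (DCE α.succ f) = DCE α.succ (eulerJet f) := by
  rw [eulerJet, eulerCE, DCE_eq_vfCE α.succ f, vfCE_commutator, ← DCE_eq_vfCE, add_eq_left]
  refine vfCE_eq_zero (fun v => ?_) f
  rw [← DCE_eq_vfCE]
  rcases eq_x_or_var v with ⟨μ, rfl⟩ | ⟨a, j, rfl⟩
  · rw [if_neg fun ⟨a, j, h⟩ => x_ne_var _ _ _ h, map_zero, sub_zero, DCE_x]
    have h1 : ∀ c : CEVar n → ACE (n + 1), vfCE c 1 = 0 := fun c => by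
      simpa using vfCE_mul c (1 : ACE (n + 1)) 1
    split_ifs
    · exact h1 _
    · exact map_zero _
  · rw [if_pos ⟨a, j, rfl⟩, DCE_var, vfCE_cv, if_pos ⟨a, _, rfl⟩, sub_self]

/-- Only the explicit dependence of the coefficients `x^α` on the base contributes. The commutator
is the partial derivative; it agrees with `D_α` on functions of `x` alone, which is the case needed
for the Poincaré lemma. -/
theorem DCE_eulerBase (α : Fin n) (f : ACE (n + 1)) :
    DCE α.succ (eulerBase f) = eulerBase (DCE α.succ f) + pderivCE (.x α.succ) f := by
  rw [eulerBase, eulerCE, DCE_eq_vfCE α.succ (vfCE _ f), vfCE_commutator, ← DCE_eq_vfCE]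
  congr 1
  have h1 : ∀ c : CEVar n → ACE (n + 1), vfCE c 1 = 0 := fun c => by
    simpa using vfCE_mul c (1 : ACE (n + 1)) 1
  have h2 : ∀ c : CEVar n → ACE (n + 1), ∀ μ : Fin (n + 1),
      vfCE c (DCE α.succ (cv (.x μ))) = 0 := fun c μ => by
    rw [DCE_x]
    split_ifs
    · exact h1 c
    · exact map_zero _
  rw [vfCE_eq_mul_pderivCE (.x α.succ)]
  · rw [h2, sub_zero, if_pos ⟨α, rfl⟩, ← DCE_eq_vfCE, DCE_x, if_pos rfl, one_mul]
  · intro v hv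
    rcases eq_x_or_var v with ⟨μ, rfl⟩ | ⟨a, j, rfl⟩
    · rw [h2, sub_zero, ← DCE_eq_vfCE]
      split_ifs
      · rw [DCE_x, if_neg fun h => hv (by rw [h])]
      · exact map_zero _
    · rw [if_neg fun ⟨β, h⟩ => x_ne_var _ _ _ h.symm, map_zero, zero_sub, DCE_var, vfCE_cv,
        if_neg fun ⟨β, h⟩ => x_ne_var _ _ _ h.symm, neg_zero]

theorem eulerBase_eulerJet (f : ACE (n + 1)) : eulerBase (eulerJet f) = eulerJet (eulerBase f) := by
  rw [eulerBase, eulerJet, eulerCE, eulerCE, vfCE_commutator, add_eq_left]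
  refine vfCE_eq_zero (fun v => ?_) f
  rcases eq_x_or_var v with ⟨μ, rfl⟩ | ⟨a, j, rfl⟩
  · rw [if_neg fun ⟨a, j, h⟩ => x_ne_var _ _ _ h, map_zero, zero_sub]
    split_ifs
    · rw [vfCE_cv, if_neg fun ⟨a, j, h⟩ => x_ne_var _ _ _ h, neg_zero]
    · rw [map_zero, neg_zero]
  · have h1 : ¬ ∃ α : Fin n, a.var j = CEVar.x α.succ := fun ⟨β, h⟩ => x_ne_var _ _ _ h.symm
    rw [if_neg h1, map_zero, sub_zero, if_pos ⟨a, j, rfl⟩, vfCE_cv, if_neg h1]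

theorem pderivCE_var_eq_zero {f : ACE (n + 1)} (h : eulerJet f = 0) (a : ThetaField n)
    (j : Fin n → ℕ) : pderivCE (a.var j) f = 0 := by
  classical exact pderivCE_eq_zero_of_eulerCE _ h ⟨a, j, rfl⟩

/-- On functions of the independent variables, total derivatives are partial derivatives. -/
theorem DCE_eq_pderivCE {f : ACE (n + 1)} (h : ∀ a j, pderivCE (ThetaField.var a j) f = 0)
    (μ : Fin (n + 1)) : DCE μ f = pderivCE (.x μ) f := by
  classical
  rw [DCE_eq_vfCE, vfCE_congr (e := fun v => if v = .x μ then 1 else 0),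
    vfCE_eq_mul_pderivCE (.x μ), if_pos rfl, one_mul]
  · exact fun v hv => if_neg hv
  · intro v hv
    rcases eq_x_or_var v with ⟨ν, rfl⟩ | ⟨a, j, rfl⟩
    · simp [DCE_x]
    · exact absurd (h a j) hv

theorem sum_x_mul_DCE {f : ACE (n + 1)} (h : ∀ a j, pderivCE (ThetaField.var a j) f = 0) :
    ∑ α : Fin n, cv (.x α.succ) * DCE α.succ f = eulerBase f := by
  simp only [fun α : Fin n => DCE_eq_vfCE α.succ f]
  rw [vfCE_sum]
  refine vfCE_congr fun v hv => ?_
  rcases eq_x_or_var v with ⟨ν, rfl⟩ | ⟨a, j, rfl⟩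
  · simp only [DCE_x, CEVar.x.injEq, mul_ite, mul_one, mul_zero]
    refine Fin.cases ?_ (fun β => ?_) ν
    · simp [(Fin.succ_ne_zero _).symm]
    · simp
  · exact absurd (h a j) hv

/-- A function of `x^1` alone is the `x^1`-derivative of a function of `x^1` alone. -/
theorem exists_primitive {f : ACE (n + 1)} (h : ∀ v, v ≠ .x 0 → pderivCE v f = 0) :
    ∃ F : ACE (n + 1), DCE 0 F = f ∧ ∀ α : Fin n, DCE α.succ F = 0 := by
  classical
  let P : CEVar n → Prop := fun v => v = .x 0
  -- With `E = x^1 ∂_{x^1}` and `(E + 1) g = f`, the function `x^1 g` is a primitive: `D_1 (x^1 g) =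
  -- g + x^1 ∂_{x^1} g = f`, as soon as `g` depends on `x^1` alone.
  obtain ⟨g, hg⟩ : ∃ g : ACE (n + 1), eulerCE P g + g = f :=
    ⟨_, by simpa using eulerCE_symm P 0 f⟩
  have h1 : ∀ v, v ≠ .x 0 → pderivCE v g = 0 := by
    intro v hv
    refine eq_zero_of_eulerCE_add P 0 ?_
    have h2 := congrArg (pderivCE v) hg
    rw [map_add, pderivCE_eulerCE, if_neg hv, h v hv, add_zero] at h2
    simpa using h2
  have h2 : ∀ μ, DCE μ g = pderivCE (.x μ) g :=
    DCE_eq_pderivCE fun a j => h1 _ (x_ne_var _ _ _).symm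
  refine ⟨cv (.x 0) * g, ?_, fun α => ?_⟩
  · rw [DCE_mul, DCE_x, if_pos rfl, mul_one, h2, ← hg]
    congr 1
    rw [eulerCE, vfCE_eq_mul_pderivCE (.x 0), if_pos rfl]
    exact fun v hv => if_neg hv
  · rw [DCE_mul, DCE_x, if_neg (Fin.succ_ne_zero α).symm, h2,
      h1 _ (by simp [Fin.succ_ne_zero])]
    simp

end EulerCE

/-! ### Iterated total derivatives -/

section Jets

variable {n : ℕ}

/-- `T^j = T_1^{j_1} ∘ … ∘ T_n^{j_n}`. -/
def prodJet {M : Type} [AddCommGroup M] [Module ℝ M] (T : Fin n → Module.End ℝ M)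
    (j : Fin n → ℕ) : Module.End ℝ M :=
  (List.ofFn fun α => T α ^ j α).prod

theorem prodJet_zero {M : Type} [AddCommGroup M] [Module ℝ M] (T : Fin n → Module.End ℝ M) :
    prodJet T 0 = 1 := by
  simp [prodJet]

theorem prodJet_add_single {M : Type} [AddCommGroup M] [Module ℝ M] {T : Fin n → Module.End ℝ M}
    (hT : ∀ α β, Commute (T α) (T β)) (j : Fin n → ℕ) (α : Fin n) :
    prodJet T (j + Pi.single α 1) = T α * prodJet T j := by
  induction n with
  | zero => exact α.elim0
  | succ n ih =>
    have ih' := fun j α => ih (T := fun α => T α.succ) (fun α β => hT _ _) j α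
    simp only [prodJet] at ih' ⊢
    rw [List.ofFn_succ, List.prod_cons, List.ofFn_succ, List.prod_cons]
    refine Fin.cases ?_ (fun α => ?_) α
    · simp [pow_succ', mul_assoc]
    · have h2 : ∀ β : Fin n, (j + Pi.single α.succ 1 : Fin (n + 1) → ℕ) β.succ =
          ((fun β : Fin n => j β.succ) + Pi.single α 1 : Fin n → ℕ) β := fun β => by
        simp [Pi.single_apply]
      simp only [h2]
      rw [ih', ← mul_assoc, ← mul_assoc]
      congr 1
      simpa [Pi.single_apply, (Fin.succ_ne_zero α).symm] using
        ((hT 0 α.succ).pow_left (j 0)).eq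

theorem multiIndex_induction {p : (Fin n → ℕ) → Prop} (zero : p 0)
    (add : ∀ j α, p j → p (j + Pi.single α 1)) (j : Fin n → ℕ) : p j := by
  generalize hN : ∑ α, j α = N
  induction N generalizing j with
  | zero =>
    have : j = 0 := by
      funext α
      exact (Finset.sum_eq_zero_iff.1 hN) α (Finset.mem_univ α)
    exact this ▸ zero
  | succ N ih =>
    obtain ⟨α, -, hα⟩ : ∃ α ∈ Finset.univ, j α ≠ 0 := by
      refine Finset.exists_ne_zero_of_sum_ne_zero ?_
      omega
    rw [add_single_eq_iff.2 ⟨hα, rfl⟩] at hN ⊢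
    refine add _ _ (ih _ ?_)
    simp only [Pi.add_apply, Finset.sum_add_distrib, Finset.sum_pi_single', Finset.mem_univ,
      if_true, Nat.add_right_cancel_iff] at hN
    exact hN

theorem DJet_add_single (j : Fin n → ℕ) (α : Fin n) (f : ACE (n + 1)) :
    DJet (j + Pi.single α 1) f = DCE α.succ (DJet j f) :=
  LinearMap.congr_fun (prodJet_add_single (T := fun α => (DTheta n α : Module.End ℝ _))
    (fun _ _ => LinearMap.ext fun _ => DCE_comm _ _ _) j α) f

theorem negDJet_add_single (j : Fin n → ℕ) (α : Fin n) (f : ACE (n + 1)) :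
    negDJet (j + Pi.single α 1) f = -DCE α.succ (negDJet j f) :=
  LinearMap.congr_fun (prodJet_add_single (T := fun α => (-DTheta n α : Module.End ℝ _))
    (fun α β => (show Commute (DTheta n α : Module.End ℝ _) (DTheta n β) from
      LinearMap.ext fun _ => DCE_comm _ _ _).neg_left.neg_right) j α) f

theorem DJet_zero (f : ACE (n + 1)) : DJet 0 f = f :=
  LinearMap.congr_fun (prodJet_zero _) f

theorem negDJet_zero (f : ACE (n + 1)) : negDJet 0 f = f :=
  LinearMap.congr_fun (prodJet_zero _) f

/-- Operators that commute with the total derivatives commute with iterated ones. -/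
theorem negDJet_comm {T : ACE (n + 1) →ₗ[ℝ] ACE (n + 1)}
    (hT : ∀ (α : Fin n) f, T (DCE α.succ f) = DCE α.succ (T f)) (j : Fin n → ℕ)
    (f : ACE (n + 1)) : T (negDJet j f) = negDJet j (T f) := by
  induction j using multiIndex_induction with
  | zero => rw [negDJet_zero, negDJet_zero]
  | add j α ih => rw [negDJet_add_single, negDJet_add_single, map_neg, hT, ih]

theorem DJet_cv (a : ThetaField n) (j : Fin n → ℕ) : DJet j (cv (a.var 0)) = cv (a.var j) := by
  induction j using multiIndex_induction with
  | zero => rw [DJet_zero]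
  | add j α ih => rw [DJet_add_single, ih, DCE_var]

end Jets

/-! ### Vertical one-forms -/

section Vertical

variable {n : ℕ}

/-- The finite linear combinations of the vertical one-forms `θ_{a,j}`, with coefficients in
`A(CE)`. -/
abbrev Vert (n : ℕ) : Type := ThetaField n × (Fin n → ℕ) →₀ ACE (n + 1)

/-- The action of the total derivatives on vertical one-forms, with `D_α θ_{a,j} = θ_{a,j+(α)}`. -/
def DVert (α : Fin n) : Vert n →ₗ[ℝ] Vert n :=
  Finsupp.mapRange.linearMap (DCE α.succ) +
    Finsupp.lmapDomain _ ℝ fun c => (c.1, c.2 + Pi.single α 1)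

/-- The commutator with the multiplication by `x^α`: `θ_{a,j} ↦ j^α θ_{a,j-(α)}`. -/
def lowerVert (α : Fin n) : Vert n →ₗ[ℝ] Vert n :=
  Finsupp.lsum ℝ fun c => (c.2 α : ℝ) • Finsupp.lsingle (c.1, c.2 - Pi.single α 1)

theorem DVert_single (α : Fin n) (a : ThetaField n) (j : Fin n → ℕ) (f : ACE (n + 1)) :
    DVert α (Finsupp.single (a, j) f) =
      Finsupp.single (a, j) (DCE α.succ f) + Finsupp.single (a, j + Pi.single α 1) f := by
  rw [DVert, LinearMap.add_apply, Finsupp.mapRange.linearMap_apply, Finsupp.mapRange_single,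
    Finsupp.lmapDomain_apply, Finsupp.mapDomain_single]

theorem lowerVert_single (α : Fin n) (a : ThetaField n) (j : Fin n → ℕ) (f : ACE (n + 1)) :
    lowerVert α (Finsupp.single (a, j) f) =
      Finsupp.single (a, j - Pi.single α 1) ((j α : ℝ) • f) := by
  rw [lowerVert, Finsupp.lsum_single]
  simp

theorem DVert_apply (α : Fin n) (v : Vert n) (a : ThetaField n) (j : Fin n → ℕ) :
    DVert α v (a, j) =
      DCE α.succ (v (a, j)) + if j α = 0 then 0 else v (a, j - Pi.single α 1) := by
  classical
  induction v using Finsupp.induction_linear with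
  | zero => simp
  | add v w hv hw =>
    rw [map_add, Finsupp.add_apply, hv, hw, Finsupp.add_apply, map_add]
    split_ifs
    · abel
    · rw [Finsupp.add_apply]; abel
  | single c f =>
    obtain ⟨b, i⟩ := c
    rw [DVert_single, Finsupp.add_apply]
    congr 1
    · simp only [Finsupp.single_apply]
      split_ifs <;> simp
    · simp only [Finsupp.single_apply, Prod.mk.injEq, eq_comm (b := j), add_single_eq_iff]
      split_ifs <;> simp_all

theorem lowerVert_apply (α : Fin n) (v : Vert n) (a : ThetaField n) (j : Fin n → ℕ) :
    lowerVert α v (a, j) = ((j α : ℝ) + 1) • v (a, j + Pi.single α 1) := by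
  classical
  induction v using Finsupp.induction_linear with
  | zero => simp
  | add v w hv hw => rw [map_add, Finsupp.add_apply, hv, hw, Finsupp.add_apply, smul_add]
  | single c f =>
    obtain ⟨b, i⟩ := c
    rw [lowerVert_single]
    simp only [Finsupp.single_apply, Prod.mk.injEq, add_single_eq_iff]
    by_cases hi : i α = 0
    · simp [hi]
    · by_cases h : b = a ∧ i - Pi.single α 1 = j
      · obtain ⟨rfl, rfl⟩ := h
        have h1 : ((i α - 1 : ℕ) : ℝ) + 1 = i α := by
          rw [Nat.cast_sub (by omega)]; simp
        simp [hi, h1]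
      · rw [if_neg h, if_neg, smul_zero]
        rintro ⟨rfl, -, rfl⟩
        exact h ⟨rfl, rfl⟩

theorem DVert_comm (α β : Fin n) (v : Vert n) : DVert α (DVert β v) = DVert β (DVert α v) := by
  induction v using Finsupp.induction_linear with
  | zero => simp
  | add v w hv hw => simp only [map_add, hv, hw]
  | single c f =>
    obtain ⟨a, j⟩ := c
    simp only [DVert_single, map_add, DCE_comm β.succ α.succ, add_right_comm j]
    abel

/-- Read `θ_{a,j}` as the monomial `ξ^j`. Then `DVert α` is `D_α + ξ_α`, `lowerVert β` is `∂/∂ξ_β`,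
and the identity is the canonical commutation relation. It provides Cartan's formula with `ε = -1`.
-/
theorem DVert_lowerVert (α β : Fin n) (v : Vert n) :
    DVert α (lowerVert β v) = lowerVert β (DVert α v) + if α = β then (-1 : ℝ) • v else 0 := by
  classical
  ext c
  obtain ⟨a, j⟩ := c
  rw [Finsupp.add_apply, lowerVert_apply, DVert_apply, DVert_apply, lowerVert_apply,
    lowerVert_apply]
  by_cases h : α = β
  · subst h
    by_cases hj : j α = 0
    · simp [hj]
    · have h1 : j - Pi.single α 1 + Pi.single α 1 = j := (add_single_eq_iff.2 ⟨hj, rfl⟩).symm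
      have h2 : ((j α - 1 : ℕ) : ℝ) + 1 = j α := by
        rw [Nat.cast_sub (by omega)]; simp
      simp only [if_neg hj, if_true, h1, Pi.sub_apply, Pi.single_eq_same, h2, Pi.add_apply,
        Nat.add_eq_zero_iff, one_ne_zero, and_false, if_false, add_tsub_cancel_right, map_smul,
        smul_add, Finsupp.smul_apply]
      module
  · by_cases hj : j α = 0
    · simp [hj, h]
    · have h1 : j - Pi.single α 1 + Pi.single β 1 = j + Pi.single β 1 - Pi.single α 1 := by
        funext γ
        by_cases hγ : γ = α
        · subst hγ
          simp [h]
        · simp [hγ]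
      simp [hj, h, h1]

/-- The operator of Cartan's formula for vertical one-forms. -/
def countVert (n : ℕ) : Vert n →ₗ[ℝ] Vert n := ∑ α, lowerVert α ∘ₗ DVert α

theorem countVert_apply (v : Vert n) (a : ThetaField n) (j : Fin n → ℕ) :
    countVert n v (a, j) = ((n : ℝ) + ∑ α, (j α : ℝ)) • v (a, j) +
      ∑ α, ((j α : ℝ) + 1) • DCE α.succ (v (a, j + Pi.single α 1)) := by
  rw [countVert, LinearMap.sum_apply, Finsupp.finsetSum_apply]
  have h1 : (n : ℝ) + ∑ α, (j α : ℝ) = ∑ α, ((j α : ℝ) + 1) := by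
    rw [Finset.sum_add_distrib]
    simp [add_comm]
  rw [h1, Finset.sum_smul, ← Finset.sum_add_distrib]
  refine Finset.sum_congr rfl fun α _ => ?_
  rw [LinearMap.comp_apply, lowerVert_apply, DVert_apply, if_neg (by simp)]
  rw [add_tsub_cancel_right, smul_add]
  exact add_comm _ _

/-- In the polynomial picture `countVert` is `n + ∑ ξ_α ∂/∂ξ_α` plus the terms `∂/∂ξ_α D_α`. Passing
it across a total derivative costs exactly one unit, which matches the increase of the form degree.
-/
theorem countVert_DVert (β : Fin n) (v : Vert n) :
    countVert n (DVert β v) = DVert β (countVert n v) + DVert β v := by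
  simp only [countVert, LinearMap.sum_apply, LinearMap.comp_apply, map_sum, DVert_lowerVert,
    Finset.sum_add_distrib, Finset.sum_ite_eq, Finset.mem_univ, if_true, DVert_comm β]
  module

/-- The operator `countVert` is triangular with respect to `|j|`, with diagonal entries `n + |j|`.
At a nonzero coefficient of largest `|j|` the equation reduces to `(n + |j| - q) v = 0`, and for `q
≤ n` this factor vanishes only if `q = n` and `j = 0`. -/
theorem eq_zero_of_countVert_eq {q : ℕ} (hq : q ≤ n) {v : Vert n}
    (h : countVert n v = (q : ℝ) • v) (a : ThetaField n) (j : Fin n → ℕ)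
    (hj : q < n ∨ j ≠ 0) : v (a, j) = 0 := by
  classical
  by_contra hv
  let s := v.support.filter fun c => q < n ∨ c.2 ≠ 0
  obtain ⟨⟨b, i⟩, hi, hmax⟩ := s.exists_max_image (fun c => ∑ α, c.2 α)
    ⟨(a, j), by simp [s, hv, hj]⟩
  simp only [s, Finset.mem_filter, Finsupp.mem_support_iff] at hi
  -- An index `i + (α)` is never zero, so a nonzero coefficient there would lie in `s` and
  -- contradict the maximality of `|i|`.
  have h1 : ∀ α, v (b, i + Pi.single α 1) = 0 := by
    intro α
    by_contra h2
    have h3 := hmax (b, i + Pi.single α 1) (by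
      simp only [s, Finset.mem_filter, Finsupp.mem_support_iff]
      refine ⟨h2, .inr fun h => ?_⟩
      have := congrFun h α
      simp at this)
    simp [Finset.sum_add_distrib] at h3
  have h2 := DFunLike.congr_fun h (b, i)
  rw [countVert_apply, Finsupp.smul_apply, ← sub_eq_zero] at h2
  simp only [h1, map_zero, smul_zero, Finset.sum_const_zero, add_zero, ← sub_smul] at h2
  refine (smul_eq_zero.1 h2).elim (fun h3 => ?_) hi.1
  have h4 : n + ∑ α, i α = q := by
    have : ((n + ∑ α, i α : ℕ) : ℝ) = q := by
      push_cast
      linarith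
    exact_mod_cast this
  rcases hi.2 with h5 | h5
  · omega
  · refine h5 (funext fun α => ?_)
    have h6 : i α ≤ ∑ α, i α := Finset.single_le_sum (fun _ _ => Nat.zero_le _) (Finset.mem_univ α)
    simp only [Pi.zero_apply]
    omega

/-- By the same triangularity, `θ_{a,j} f` is hit up to terms with smaller `|j|`, because `n + |j| -
q` is positive. Strong induction on `|j|` removes these terms. -/
theorem countVert_sub_surjective {q : ℕ} (hq : q < n) :
    Function.Surjective (countVert n - (q : ℝ) • (LinearMap.id : Vert n →ₗ[ℝ] Vert n)) := by
  rw [← LinearMap.range_eq_top, eq_top_iff]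
  rintro v -
  induction v using Finsupp.induction_linear with
  | zero => exact zero_mem _
  | add v w hv hw => exact add_mem hv hw
  | single c f =>
    obtain ⟨a, j⟩ := c
    induction hN : ∑ α, j α using Nat.strong_induction_on generalizing j f with
    | _ N ih =>
      have h0 : ((n : ℝ) + ∑ α, (j α : ℝ) - q) ≠ 0 := by
        have h1 : (q : ℝ) < n := by exact_mod_cast hq
        have h2 : 0 ≤ ∑ α, (j α : ℝ) := Finset.sum_nonneg fun _ _ => Nat.cast_nonneg _
        linarith
      have h1 : countVert n (Finsupp.single (a, j) f) =
          ((n : ℝ) + ∑ α, (j α : ℝ)) • Finsupp.single (a, j) f +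
            ∑ α, (j α : ℝ) • Finsupp.single (a, j - Pi.single α 1) (DCE α.succ f) := by
        rw [countVert, LinearMap.sum_apply]
        have h2 : (n : ℝ) + ∑ α, (j α : ℝ) = ∑ α, ((j α : ℝ) + 1) := by
          rw [Finset.sum_add_distrib]
          simp [add_comm]
        rw [h2, Finset.sum_smul, ← Finset.sum_add_distrib]
        refine Finset.sum_congr rfl fun α _ => ?_
        rw [LinearMap.comp_apply, DVert_single, map_add, lowerVert_single, lowerVert_single]
        simp [add_comm]
      have h2 : Finsupp.single (a, j) f = ((n : ℝ) + ∑ α, (j α : ℝ) - q)⁻¹ •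
          ((countVert n - (q : ℝ) • (LinearMap.id : Vert n →ₗ[ℝ] Vert n)) (Finsupp.single (a, j) f) -
            ∑ α, (j α : ℝ) • Finsupp.single (a, j - Pi.single α 1) (DCE α.succ f)) := by
        rw [eq_inv_smul_iff₀ h0, LinearMap.sub_apply, h1]
        simp only [LinearMap.smul_apply, LinearMap.id_apply]
        module
      rw [h2]
      refine Submodule.smul_mem _ _ (sub_mem (LinearMap.mem_range_self _ _)
        (sum_mem fun α _ => ?_))
      by_cases hj : j α = 0
      · rw [hj]; simp
      · refine Submodule.smul_mem _ _ (ih _ ?_ _ _ rfl)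
        rw [← hN]
        conv_rhs => rw [add_single_eq_iff.2 ⟨hj, rfl⟩]
        simp [Finset.sum_add_distrib]

/-- Meant for operators that commute with the differential only up to a shift, such as `E + q`
turning into `E + q + 1`. The intertwining relation is required only on the values of `w`, since for
base Euler fields it fails on general functions. -/
theorem dForm_map_twisted {k : ℕ} {A B : Type} [AddCommGroup A] [Module ℝ A] [AddCommGroup B]
    [Module ℝ B] {D : Fin k → A →ₗ[ℝ] A} {D' : Fin k → B →ₗ[ℝ] B} {T T' : A →ₗ[ℝ] B}
    {q : ℕ} {w : Form k A q} (hT : ∀ μ v, T (D μ (w v)) = D' μ (T' (w v))) :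
    dForm D' q (T'.compAlternatingMap w) = T.compAlternatingMap (dForm D q w) := by
  ext v
  simp only [dForm_apply, LinearMap.compAlternatingMap_apply, map_sum, map_zsmul, map_smul, hT]

/-- A closed form with values in the vertical one-forms is exact up to a form with values in
the span of the `θ_{a,0}`, and exact below the top degree. -/
theorem exists_dForm_DVert {q : ℕ} (hq : q + 1 ≤ n) {w : Form n (Vert n) (q + 1)}
    (hw : dForm DVert (q + 1) w = 0) : ∃ η : Form n (Vert n) q, ∀ v a (j : Fin n → ℕ),
      q + 1 < n ∨ j ≠ 0 → (w - dForm DVert q η) v (a, j) = 0 := by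
  obtain ⟨g, hg⟩ := (countVert n - (q : ℝ) • LinearMap.id).exists_rightInverse_of_surjective
    (LinearMap.range_eq_top.2 (countVert_sub_surjective hq))
  have h1 := contract_dForm_succ (ε := -1) DVert_lowerVert w
  rw [hw] at h1
  -- With `C = countVert`, Cartan's formula reads `d ι w = (C - (q + 1)) w` for closed `w`, where
  -- `ι` is the contraction with `lowerVert`. The choice `η = (C - q)⁻¹ ι w`, with `g` as right
  -- inverse, gives `(C - (q + 1)) d η = d (C - q) η = d ι w`. So `w - d η` is an eigenvector of `C`
  -- for `q + 1`, and its coefficients vanish where claimed.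
  refine ⟨g.compAlternatingMap (contract lowerVert w), fun v a j hj => ?_⟩
  refine eq_zero_of_countVert_eq hq ?_ a j hj
  have h2 : (countVert n - ((q + 1 : ℕ) : ℝ) • LinearMap.id).compAlternatingMap
      (dForm DVert q (g.compAlternatingMap (contract lowerVert w))) =
      dForm DVert q (contract lowerVert w) := by
    rw [← dForm_map_twisted (D := DVert) (T' := countVert n - (q : ℝ) • LinearMap.id)]
    · congr 1
      ext1 v
      exact LinearMap.congr_fun hg _
    · intro μ a
      simp only [LinearMap.sub_apply, LinearMap.smul_apply, LinearMap.id_apply, map_sub, map_smul,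
        countVert_DVert]
      push_cast
      module
  have h3 := DFunLike.congr_fun h1 v
  have h4 := DFunLike.congr_fun h2 v
  have h5 : contract lowerVert (0 : Form n (Vert n) (q + 2)) v = 0 := by
    rw [contract_apply]; simp
  simp only [AlternatingMap.add_apply, LinearMap.compAlternatingMap_apply, LinearMap.sub_apply,
    LinearMap.smul_apply, LinearMap.id_apply, AlternatingMap.smul_apply, h5, zero_add] at h3 h4
  rw [AlternatingMap.sub_apply, map_sub, ← sub_eq_zero]
  rw [h3] at h4
  change countVert n _ - _ = countVert n _ + _ at h4
  rw [sub_eq_iff_eq_add] at h4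
  rw [h4]
  push_cast
  module

/-- In degree `0` Cartan's formula has no correction term, so `countVert` annihilates the values of
`w`; its diagonal entries `n + |j|` are all positive. -/
theorem eq_zero_of_dForm_DVert (hn : 0 < n) {w : Form n (Vert n) 0}
    (hw : dForm DVert 0 w = 0) : w = 0 := by
  have h1 := contract_dForm_zero DVert lowerVert w
  rw [hw] at h1
  ext1 v
  ext1 c
  refine eq_zero_of_countVert_eq (q := 0) (Nat.zero_le n) ?_ c.1 c.2 (.inl hn)
  have h3 := DFunLike.congr_fun h1 v
  rw [contract_apply] at h3
  simp only [Nat.cast_zero, zero_smul]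
  refine Eq.trans h3.symm ?_
  simp

end Vertical

/-! ### The vertical differential and integration by parts -/

section Variation

variable {n : ℕ}

/-- The vertical differential `f ↦ ∑ ∂_{a_j} f θ_{a,j}`. -/
def dVert : ACE (n + 1) →ₗ[ℝ] Vert n where
  toFun f := Finsupp.ofSupportFinite (fun c => pderivCE (c.1.var c.2) f)
    ((pderivCE_support_finite f).preimage ThetaField.var_injective.injOn)
  map_add' f g := by
    ext c
    exact map_add (pderivCE (c.1.var c.2)) f g
  map_smul' r f := by
    ext c
    exact map_smul (pderivCE (c.1.var c.2)) r f

theorem dVert_apply (f : ACE (n + 1)) (a : ThetaField n) (j : Fin n → ℕ) :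
    dVert f (a, j) = pderivCE (a.var j) f := rfl

theorem dVert_DCE (α : Fin n) (f : ACE (n + 1)) : dVert (DCE α.succ f) = DVert α (dVert f) := by
  ext ⟨a, j⟩
  rw [DVert_apply, dVert_apply, pderivCE_DCE_succ]
  rfl

theorem dVert_mul (f g : ACE (n + 1)) : dVert (f * g) = f • dVert g + g • dVert f := by
  ext ⟨a, j⟩
  exact pderivCE_mul _ f g

/-- The contraction of vertical one-forms with the evolutionary field of the family `f`. -/
def evalVert (f : ThetaField n → ACE (n + 1)) : Vert n →ₗ[ℝ] ACE (n + 1) :=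
  Finsupp.lsum ℝ fun c => LinearMap.mulLeft ℝ (DJet c.2 (f c.1))

theorem evalVert_single (f : ThetaField n → ACE (n + 1)) (a : ThetaField n) (j : Fin n → ℕ)
    (g : ACE (n + 1)) : evalVert f (Finsupp.single (a, j) g) = DJet j (f a) * g := by
  rw [evalVert, Finsupp.lsum_single]
  rfl

theorem evalVert_DVert (f : ThetaField n → ACE (n + 1)) (α : Fin n) (v : Vert n) :
    evalVert f (DVert α v) = DCE α.succ (evalVert f v) := by
  induction v using Finsupp.induction_linear with
  | zero => simp
  | add v w hv hw => simp only [map_add, hv, hw]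
  | single c g =>
    obtain ⟨a, j⟩ := c
    rw [DVert_single, map_add, evalVert_single, evalVert_single, evalVert_single, DCE_mul,
      DJet_add_single]
    ring

theorem evalVert_dVert (f : ThetaField n → ACE (n + 1)) (g : ACE (n + 1)) :
    evalVert f (dVert g) = ∑ᶠ c : ThetaField n × (Fin n → ℕ),
      pderivCE (c.1.var c.2) g * DJet c.2 (f c.1) := by
  rw [evalVert, Finsupp.lsum_apply, Finsupp.sum]
  refine Eq.trans ?_ (finsum_eq_sum_of_support_subset _ (s := (dVert g).support) ?_).symm
  · exact Finset.sum_congr rfl fun c _ => mul_comm _ _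
  · intro c hc
    simp only [Finset.mem_coe, Finsupp.mem_support_iff]
    exact fun h => hc (by
      change dVert g c * _ = 0
      rw [h, zero_mul])

/-- The dependent variables as functions on `CE`. -/
def fieldCoord (a : ThetaField n) : ACE (n + 1) := cv (a.var 0)

/-- Since `D_j a = a_j`, the evolutionary field whose characteristic is the family of the dependent
variables themselves is the Euler field of the fibre. -/
theorem evalVert_fieldCoord (f : ACE (n + 1)) : evalVert fieldCoord (dVert f) = eulerJet f := by
  classical
  rw [evalVert_dVert, eulerJet, eulerCE, vfCE_eq_finsum]
  have h1 : ∀ v : CEVar n,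
      (if ∃ (a : ThetaField n) (j : Fin n → ℕ), v = a.var j then cv v else 0) * pderivCE v f =
      Set.indicator (Set.range fun c : ThetaField n × (Fin n → ℕ) => c.1.var c.2)
        (fun v => cv v * pderivCE v f) v := by
    intro v
    rw [Set.indicator_apply, ite_mul, zero_mul]
    refine if_congr ?_ rfl rfl
    simp only [Set.mem_range, Prod.exists, eq_comm]
  rw [finsum_congr h1, ← finsum_mem_def, finsum_mem_range ThetaField.var_injective]
  refine finsum_congr fun c => ?_
  rw [fieldCoord, DJet_cv, mul_comm]

open Classical in
/-- The integration by parts `∑ f_{a,j} θ_{a,j} ↦ ∑_j (-D)_j f_{a,j}`. -/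
def parts (a : ThetaField n) : Vert n →ₗ[ℝ] ACE (n + 1) :=
  Finsupp.lsum ℝ fun c => if c.1 = a then negDJet c.2 else 0

open Classical in
theorem parts_single (a b : ThetaField n) (j : Fin n → ℕ) (f : ACE (n + 1)) :
    parts a (Finsupp.single (b, j) f) = if b = a then negDJet j f else 0 := by
  rw [parts, Finsupp.lsum_single]
  split_ifs <;> rfl

/-- The two terms `(-D)_j D_α f` and `(-D)_{j+(α)} f` produced by `D_α (f θ_{a,j})` cancel. -/
theorem parts_DVert (a : ThetaField n) (α : Fin n) (v : Vert n) : parts a (DVert α v) = 0 := by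
  classical
  induction v using Finsupp.induction_linear with
  | zero => simp
  | add v w hv hw => rw [map_add, map_add, hv, hw, add_zero]
  | single c g =>
    obtain ⟨b, j⟩ := c
    rw [DVert_single, map_add, parts_single, parts_single]
    split_ifs
    · rw [negDJet_add_single, negDJet_comm (T := DCE α.succ) (fun _ _ => DCE_comm _ _ _),
        add_neg_cancel]
    · rw [add_zero]

/-- Without derivatives of `θ_{b,0}` nothing is left to integrate by parts. In top degree this
identifies the remainder of `exists_dForm_DVert` with the variational derivative. -/
theorem parts_eq_apply (a : ThetaField n) {v : Vert n} (h : ∀ b j, j ≠ 0 → v (b, j) = 0) :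
    parts a v = v (a, 0) := by
  classical
  rw [parts, Finsupp.lsum_apply, Finsupp.sum, Finset.sum_eq_single (a, 0)]
  · rw [if_pos rfl]
    exact negDJet_zero _
  · rintro ⟨b, j⟩ hc hne
    by_cases hj : j = 0
    · subst hj
      rw [if_neg fun hb => hne (by rw [← show b = a from hb])]
      rfl
    · rw [h b j hj, map_zero]
  · intro hc
    rw [Finsupp.notMem_support_iff.1 hc, map_zero]

theorem parts_eq_finsum (a : ThetaField n) (v : Vert n) :
    parts a v = ∑ᶠ j : Fin n → ℕ, negDJet j (v (a, j)) := by
  classical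
  have h1 : parts a v = ∑ᶠ c : ThetaField n × (Fin n → ℕ),
      (if c.1 = a then negDJet c.2 else 0 : Module.End ℝ (ACE (n + 1))) (v c) := by
    rw [parts, Finsupp.lsum_apply, Finsupp.sum]
    refine (finsum_eq_sum_of_support_subset _ fun c hc => ?_).symm
    simp only [Finset.mem_coe, Finsupp.mem_support_iff]
    exact fun h => hc (by simp only [h, map_zero])
  have h2 : ∀ c : ThetaField n × (Fin n → ℕ),
      (if c.1 = a then negDJet c.2 else 0 : Module.End ℝ (ACE (n + 1))) (v c) =
      Set.indicator (Set.range fun j : Fin n → ℕ => (a, j))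
        (fun c => negDJet c.2 (v c)) c := by
    rintro ⟨b, j⟩
    rw [Set.indicator_apply]
    by_cases hb : b = a
    · subst hb
      rw [if_pos rfl, if_pos ⟨j, rfl⟩]
    · rw [if_neg hb, if_neg]
      · rfl
      · rintro ⟨i, hi⟩
        exact hb (congrArg Prod.fst hi).symm
  rw [h1, finsum_congr h2, ← finsum_mem_def,
    finsum_mem_range (g := fun j : Fin n → ℕ => (a, j)) fun i j h => congrArg Prod.snd h]

theorem varDeriv_eq (L : ACE (n + 1)) (a : ThetaField n) : varDeriv L a = parts a (dVert L) :=
  (parts_eq_finsum a (dVert L)).symm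

theorem DVert_smul (α : Fin n) (g : ACE (n + 1)) (v : Vert n) :
    DVert α (g • v) = DCE α.succ g • v + g • DVert α v := by
  ext ⟨a, j⟩
  rw [DVert_apply, Finsupp.add_apply, Finsupp.smul_apply, Finsupp.smul_apply, Finsupp.smul_apply,
    Finsupp.smul_apply, DVert_apply]
  simp only [smul_eq_mul, DCE_mul]
  split_ifs <;> ring

/-- `(-D)_j` on vertical one-forms. -/
def negDVert (j : Fin n → ℕ) : Module.End ℝ (Vert n) :=
  prodJet (fun α => -(DVert α : Module.End ℝ (Vert n))) j

theorem negDVert_add_single (j : Fin n → ℕ) (α : Fin n) (v : Vert n) :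
    negDVert (j + Pi.single α 1) v = -DVert α (negDVert j v) := by
  have h2 := prodJet_add_single (T := fun α => -(DVert α : Module.End ℝ (Vert n)))
    (fun α β => LinearMap.ext fun v => by
      change -DVert α (-DVert β v) = -DVert β (-DVert α v)
      rw [map_neg, map_neg, DVert_comm]) j α
  rw [negDVert, h2]
  rfl

theorem negDVert_zero (v : Vert n) : negDVert 0 v = v :=
  LinearMap.congr_fun (prodJet_zero _) v

theorem negDVert_DVert (j : Fin n → ℕ) (α : Fin n) (v : Vert n) :
    negDVert j (DVert α v) = DVert α (negDVert j v) := by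
  induction j using multiIndex_induction with
  | zero => rw [negDVert_zero, negDVert_zero]
  | add j β ih => rw [negDVert_add_single, negDVert_add_single, ih, map_neg, DVert_comm]

theorem dVert_negDJet (j : Fin n → ℕ) (f : ACE (n + 1)) :
    dVert (negDJet j f) = negDVert j (dVert f) := by
  induction j using multiIndex_induction with
  | zero => rw [negDVert_zero, negDJet_zero]
  | add j β ih => rw [negDVert_add_single, negDJet_add_single, map_neg, dVert_DCE, ih]

/-- Total derivatives are invisible to `parts`, so by the Leibniz rule derivatives of the factor `g`
can be moved one by one onto `v`, each with a sign. -/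
theorem parts_DJet_smul (a : ThetaField n) (j : Fin n → ℕ) (g : ACE (n + 1)) (v : Vert n) :
    parts a (DJet j g • v) = parts a (g • negDVert j v) := by
  induction j using multiIndex_induction generalizing v with
  | zero => rw [negDVert_zero, DJet_zero]
  | add j β ih =>
    have h1 := parts_DVert a β (DJet j g • v)
    rw [DVert_smul, map_add, ← DJet_add_single] at h1
    rw [eq_neg_of_add_eq_zero_left h1, ih, negDVert_DVert, negDVert_add_single, smul_neg, map_neg]

end Variation

/-! ### Exactness of the auxiliary complex -/

section Exactness

variable {n : ℕ}

/-- The Poincaré lemma for forms whose coefficients are functions of the independent variables. -/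
theorem exists_dForm_of_eulerJet {q : ℕ} {w : Theta n (q + 1)}
    (hw : dForm (DTheta n) (q + 1) w = 0) (hE : ∀ v, eulerJet (w v) = 0) :
    ∃ η, dForm (DTheta n) q η = w := by
  classical
  let P : CEVar n → Prop := fun v => ∃ α : Fin n, v = .x α.succ
  let R := ((eulerEquiv P q).symm : ACE (n + 1) →ₗ[ℝ] ACE (n + 1))
  have hP : eulerBase = eulerCE P := rfl
  have hR : ∀ f, eulerBase (R f) + ((q + 1 : ℕ) : ℝ) • R f = f := fun f =>
    eulerCE_symm P q f
  have h1 : ∀ f, eulerJet f = 0 → eulerJet (R f) = 0 := by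
    intro f hf
    refine eq_zero_of_eulerCE_add P q ?_
    have h2 := congrArg eulerJet (hR f)
    rw [map_add, map_smul, ← eulerBase_eulerJet, hf] at h2
    rw [← h2, hP]
  let η := R.compAlternatingMap w
  have hη : ∀ v a j, pderivCE (ThetaField.var a j) (η v) = 0 := fun v =>
    pderivCE_var_eq_zero (h1 _ (hE v))
  -- On functions of `x` alone `D_α (E + q + 1) = (E + q + 2) D_α`. Hence `(E + q + 2) d η = d w =
  -- 0`, and `E + q + 2` is injective.
  have h2 : dForm (DTheta n) (q + 1) η = 0 := by
    have h3 : (eulerEquiv P (q + 1)).toLinearMap.compAlternatingMap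
        (dForm (DTheta n) (q + 1) η) = 0 := by
      rw [← dForm_map_twisted (D' := DTheta n) (T' := (eulerEquiv P q).toLinearMap), ← hw]
      · congr 1
        ext v
        exact (eulerEquiv P q).apply_symm_apply _
      · intro α v
        have h4 := DCE_eulerBase α (η v)
        rw [← DCE_eq_pderivCE (hη v)] at h4
        change eulerCE P (DCE α.succ (η v)) + ((q + 1 + 1 : ℕ) : ℝ) • (DCE α.succ (η v)) =
          DCE α.succ (eulerCE P (η v) + ((q + 1 : ℕ) : ℝ) • η v)
        rw [map_add, map_smul, ← hP, h4]
        push_cast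
        module
    ext v
    have h4 := DFunLike.congr_fun h3 v
    exact (eulerEquiv P (q + 1)).map_eq_zero_iff.1 h4
  -- The classical radial homotopy: contraction with the field `∑ x^α ∂_{x^α}`. As `η` is closed,
  -- Cartan's formula with `ε = 1` gives `(E + q + 1) η`, which is `w`.
  refine ⟨contract (fun α => LinearMap.mulLeft ℝ (cv (.x α.succ))) η, ?_⟩
  have h3 := contract_dForm_succ (D := DTheta n)
    (P := fun α => LinearMap.mulLeft ℝ (cv (.x α.succ) : ACE (n + 1))) (ε := 1) (fun α β f => by
      change DCE α.succ (cv (.x β.succ) * f) = cv (.x β.succ) * DCE α.succ f + _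
      rw [DCE_mul, DCE_x]
      by_cases h : α = β
      · subst h; simp
      · simp [h, Ne.symm h]) η
  ext v
  have h4 := DFunLike.congr_fun h3 v
  rw [AlternatingMap.add_apply, h2, contract_apply] at h4
  simp only [AlternatingMap.zero_apply, map_zero, Finset.sum_const_zero, zero_add] at h4
  rw [h4, AlternatingMap.add_apply, LinearMap.compAlternatingMap_apply, LinearMap.sum_apply]
  have h5 := hR (w v)
  change eulerBase (η v) + _ • η v = w v at h5
  rw [← sum_x_mul_DCE (hη v)] at h5
  rw [← h5]
  push_cast
  simp

/-- The vertical differential of `w` is exact, because the only possible obstruction, the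
coefficients of `θ_{a,0}` in top degree, is the variational derivative, assumed to vanish there.
Contraction with the fibre Euler field yields a form `T η` such that `w - d (T η)` has coefficients
of fibre degree zero. Such coefficients are functions of `x` alone, and the Poincaré lemma applies.
-/
theorem exists_dForm_eq {q : ℕ} (hq : q + 1 ≤ n) {w : Theta n (q + 1)}
    (hw : dForm (DTheta n) (q + 1) w = 0)
    (h : q + 1 < n ∨ ∀ a v, parts a (dVert (w v)) = 0) :
    ∃ η, dForm (DTheta n) q η = w := by
  classical
  obtain ⟨η, hη⟩ := exists_dForm_DVert hq (w := dVert.compAlternatingMap w) (by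
    rw [dForm_map (D := DTheta n) (fun α f => dVert_DCE α f), hw]
    ext1 v
    exact map_zero dVert)
  have h1 : dForm DVert q η = dVert.compAlternatingMap w := by
    refine (sub_eq_zero.1 ?_).symm
    ext1 v
    ext1 ⟨a, j⟩
    by_cases hj : q + 1 < n ∨ j ≠ 0
    · exact hη v a j hj
    · push Not at hj
      obtain ⟨hqn, rfl⟩ := hj
      rw [← parts_eq_apply a fun b j hj => hη v b j (.inr hj)]
      rw [AlternatingMap.sub_apply, map_sub, LinearMap.compAlternatingMap_apply,
        (h.resolve_left (by omega)) a v, dForm_apply, zero_sub, map_sum]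
      simp [parts_DVert]
  let P : CEVar n → Prop := fun v => ∃ (a : ThetaField n) (j : Fin n → ℕ), v = a.var j
  let R := ((eulerEquiv P 0).symm : ACE (n + 1) →ₗ[ℝ] ACE (n + 1))
  have hR : ∀ f, eulerJet (R f) + R f = f := fun f => by
    have h5 := eulerCE_symm P 0 f
    rw [zero_add, Nat.cast_one, one_smul] at h5
    exact h5
  -- The Euler field `E` itself is not invertible, since it kills functions of `x`. Its inverse on
  -- products `a_j f` is nevertheless available: `E (a_j (E + 1)⁻¹ f) = a_j f`. Inserting `(E +
  -- 1)⁻¹` before the contraction thus solves `E ∘ T = evalVert fieldCoord`.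
  let T : Vert n →ₗ[ℝ] ACE (n + 1) := evalVert fieldCoord ∘ₗ Finsupp.mapRange.linearMap R
  have hT : ∀ v, eulerJet (T v) = evalVert fieldCoord v := by
    intro v
    induction v using Finsupp.induction_linear with
    | zero => simp
    | add v w hv hw => rw [map_add, map_add, map_add, hv, hw]
    | single c f =>
      obtain ⟨a, j⟩ := c
      simp only [T, LinearMap.comp_apply, Finsupp.mapRange.linearMap_apply,
        Finsupp.mapRange_single, evalVert_single]
      rw [fieldCoord, DJet_cv]
      conv_rhs => rw [← hR f]
      rw [eulerJet, eulerCE, vfCE_mul, vfCE_cv, if_pos ⟨a, j, rfl⟩]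
      ring
  have h2 : ∀ v, eulerJet ((w - dForm (DTheta n) q (T.compAlternatingMap η)) v) = 0 := by
    intro v
    -- Both `E` and the contraction commute with the differentials, so `E d (T η) = d (E T η)` is
    -- the contraction of `d η`. Since `d η` is the vertical differential of `w`, this contraction
    -- is `E w`.
    have h3 : eulerJet.compAlternatingMap (dForm (DTheta n) q (T.compAlternatingMap η)) =
        (evalVert fieldCoord).compAlternatingMap (dForm DVert q η) := by
      rw [← dForm_map (D' := DTheta n) (fun α f => eulerJet_DCE α f),
        ← dForm_map (D' := DTheta n) (fun α f => evalVert_DVert _ α f)]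
      congr 1
      ext v
      exact hT _
    have h4 := DFunLike.congr_fun h3 v
    rw [h1] at h4
    simp only [LinearMap.compAlternatingMap_apply] at h4
    rw [AlternatingMap.sub_apply, map_sub, h4, evalVert_fieldCoord, sub_self]
  obtain ⟨η', hη'⟩ := exists_dForm_of_eulerJet (w := w - dForm (DTheta n) q
    (T.compAlternatingMap η)) (by
      rw [map_sub, hw, dForm_dForm (fun _ _ _ => DCE_comm _ _ _), sub_zero]) h2
  exact ⟨η' + T.compAlternatingMap η, by rw [map_add, hη', sub_add_cancel]⟩

theorem dForm_zero_apply {k : ℕ} {A : Type} [AddCommGroup A] [Module ℝ A]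
    (D : Fin k → A →ₗ[ℝ] A) (w : Form k A 0) (α : Fin k) :
    dForm D 0 w (fun _ => Pi.single α 1) = D α (w ![]) := by
  rw [dForm_apply, Fin.sum_univ_one, sum_single_smul, Fin.val_zero, pow_zero, one_smul]
  congr 2
  exact Subsingleton.elim _ _

/-- In degree `0` the vertical differential of a closed form vanishes, so no jet coordinate occurs.
The `D_α` are then the partial derivatives `∂_{x^α}`, and only `x^1` remains. -/
theorem pderivCE_eq_zero_of_dForm (hn : 0 < n) {w : Theta n 0} (hw : dForm (DTheta n) 0 w = 0)
    (v : CEVar n) (hv : v ≠ .x 0) : pderivCE v (w ![]) = 0 := by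
  have h1 := eq_zero_of_dForm_DVert hn (w := dVert.compAlternatingMap w) (by
    rw [dForm_map (D := DTheta n) (fun α f => dVert_DCE α f), hw]
    ext1 v
    exact map_zero dVert)
  have h2 : ∀ a j, pderivCE (ThetaField.var a j) (w ![]) = 0 := fun a j =>
    DFunLike.congr_fun (DFunLike.congr_fun h1 ![]) (a, j)
  rcases eq_x_or_var v with ⟨μ, rfl⟩ | ⟨a, j, rfl⟩
  · induction μ using Fin.cases with
    | zero => exact absurd rfl hv
    | succ α =>
      rw [← DCE_eq_pderivCE h2]
      exact (dForm_zero_apply (DTheta n) w α).symm.trans (by rw [hw]; rfl)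
  · exact h2 a j

end Exactness

/-! ### The Helmholtz conditions -/

section Helmholtz

variable {n : ℕ}

theorem parts_mapRange {T : ACE (n + 1) →ₗ[ℝ] ACE (n + 1)}
    (hT : ∀ (α : Fin n) f, T (DCE α.succ f) = DCE α.succ (T f)) (a : ThetaField n) (v : Vert n) :
    parts a (Finsupp.mapRange.linearMap T v) = T (parts a v) := by
  classical
  induction v using Finsupp.induction_linear with
  | zero => simp
  | add v w hv hw => simp only [map_add, hv, hw]
  | single c g =>
    obtain ⟨b, j⟩ := c
    rw [Finsupp.mapRange.linearMap_apply, Finsupp.mapRange_single, parts_single, parts_single]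
    split_ifs
    · rw [negDJet_comm hT]
    · rw [map_zero]

theorem parts_support_finite (a : ThetaField n) (v : Vert n) :
    (Function.support fun j : Fin n → ℕ => negDJet j (v (a, j))).Finite := by
  refine (v.support.finite_toSet.preimage (f := fun j : Fin n → ℕ => (a, j))
    fun i _ j _ h => congrArg Prod.snd h).subset fun j hj => ?_
  simp only [Set.mem_preimage, Finset.mem_coe, Finsupp.mem_support_iff]
  exact fun h => hj (by simp only [h, map_zero])

theorem parts_eq_add {a b : ThetaField n} {u v w : Vert n}
    (h : ∀ j, u (a, j) = v (a, j) + w (b, j)) : parts a u = parts a v + parts b w := by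
  simp only [parts_eq_finsum]
  rw [← finsum_add_distrib (parts_support_finite a v) (parts_support_finite b w)]
  exact finsum_congr fun j => by rw [h, map_add]

theorem parts_congr {a : ThetaField n} {u v : Vert n} (h : ∀ j, u (a, j) = v (a, j)) :
    parts a u = parts a v := by
  simp only [parts_eq_finsum, h]

/-- The variational derivative as a linear map. -/
def varL (n : ℕ) : ACE (n + 1) →ₗ[ℝ] (ThetaField n → ACE (n + 1)) :=
  LinearMap.pi fun a => parts a ∘ₗ dVert

theorem varL_apply (L : ACE (n + 1)) (a : ThetaField n) : varL n L a = parts a (dVert L) := rfl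

theorem varDeriv_eq_varL (L : ACE (n + 1)) : varDeriv L = varL n L :=
  funext fun a => varDeriv_eq L a

theorem varL_DCE (α : Fin n) (L : ACE (n + 1)) : varL n (DCE α.succ L) = 0 := by
  funext a
  rw [varL_apply, dVert_DCE, parts_DVert]
  rfl

theorem varL_support_finite (L : ACE (n + 1)) : (Function.support (varL n L)).Finite := by
  classical
  refine ((dVert L).support.image Prod.fst).finite_toSet.subset fun a ha => ?_
  by_contra h
  refine ha ?_
  rw [varL_apply, parts_congr (v := 0), map_zero]
  intro j
  by_contra hj
  exact h (by simpa using ⟨j, hj⟩)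

/-- The fibre Euler field commutes with the `D_α`, hence with integration by parts, and each
`∂_{a_j}` lowers the fibre degree by one. -/
theorem varL_eulerJet (L : ACE (n + 1)) (a : ThetaField n) :
    varL n (eulerJet L) a = eulerJet (varL n L a) + varL n L a := by
  rw [varL_apply, varL_apply, ← parts_mapRange eulerJet_DCE]
  refine parts_eq_add fun j => ?_
  rw [dVert_apply, eulerJet, pderivCE_eulerCE, if_pos ⟨a, j, rfl⟩]
  rfl

/-- The variational derivative intertwines `D_1` with `DTilde`. -/
theorem varL_DCE_zero (L : ACE (n + 1)) : varL n (DCE 0 L) = DTilde (varL n L) := by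
  have hc : ∀ (μ : Fin (n + 1)) (α : Fin n) (f : ACE (n + 1)),
    DCE μ (DCE α.succ f) = DCE α.succ (DCE μ f) := fun _ _ _ => DCE_comm _ _ _
  have hm := fun (a : ThetaField n) (μ : Fin (n + 1)) =>
    parts_mapRange (T := DCE μ) (hc μ) a (dVert L)
  funext a
  rcases a with _ | ⟨α, _ | k⟩ | _ | k
  · simp only [DTilde, varL_apply, ← hm]
    exact parts_congr fun j => pderivCE_DCE_zero_u1 j L
  · simp only [DTilde, varL_apply, ← hm]
    have h1 := parts_DVert ThetaField.u1 α (dVert L)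
    -- The exceptional term `-∂_{u^1_{0,j-(α)}} L` is the `j`-th coefficient of `D_α` applied to the
    -- coefficients of `dVert L`, minus that of `DVert α (dVert L)`. The latter disappears under
    -- `parts`, and the former leaves `D_α (δL)_{u^1_0}`.
    have h2 : parts (ThetaField.u α 0) (dVert (DCE 0 L)) =
        parts (ThetaField.u α 0) (Finsupp.mapRange.linearMap (DCE 0) (dVert L)) +
          parts ThetaField.u1
            (Finsupp.mapRange.linearMap (DCE α.succ) (dVert L) - DVert α (dVert L)) := by
      refine parts_eq_add fun j => ?_
      rw [dVert_apply, pderivCE_DCE_zero_u_zero, Finsupp.sub_apply, DVert_apply]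
      simp only [Finsupp.mapRange.linearMap_apply, Finsupp.mapRange_apply, dVert_apply]
      abel
    rw [h2, map_sub, h1, sub_zero]
  · simp only [DTilde, varL_apply, ← hm]
    exact parts_eq_add fun j => pderivCE_DCE_zero_u_succ α k j L
  · simp only [DTilde, varL_apply, ← hm]
    exact parts_congr fun j => pderivCE_DCE_zero_p_zero j L
  · simp only [DTilde, varL_apply, ← hm]
    exact parts_eq_add fun j => pderivCE_DCE_zero_p_succ k j L

theorem linearization_eq (χ f : ThetaField n → ACE (n + 1)) (a : ThetaField n) :
    linearization χ f a = evalVert f (dVert (χ a)) := (evalVert_dVert f (χ a)).symm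

theorem adjoint_eq {χ : ThetaField n → ACE (n + 1)} {S : Finset (ThetaField n)}
    (hS : Function.support χ ⊆ S) (f : ThetaField n → ACE (n + 1)) (a : ThetaField n) :
    adjoint χ f a = ∑ b ∈ S, parts a (f b • dVert (χ b)) := by
  rw [adjoint, finsum_curry _ (adjoint_support (S.finite_toSet.subset hS) f a)]
  simp only [parts_eq_finsum]
  refine finsum_eq_sum_of_support_subset _ fun b hb => hS fun h => hb ?_
  simp [h]

theorem evalVert_eq_sum (f : ThetaField n → ACE (n + 1)) {v : Vert n}
    {S : Finset (ThetaField n × (Fin n → ℕ))} (hS : v.support ⊆ S) :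
    evalVert f v = ∑ c ∈ S, DJet c.2 (f c.1) * v c := by
  rw [evalVert, Finsupp.lsum_apply, Finsupp.sum_of_support_subset _ hS _ fun _ _ => map_zero _]
  rfl

open Classical in
theorem parts_eq_sum (a : ThetaField n) (v : Vert n) :
    parts a v = ∑ c ∈ v.support, if c.1 = a then negDJet c.2 (v c) else 0 := by
  rw [parts, Finsupp.lsum_apply, Finsupp.sum]
  exact Finset.sum_congr rfl fun c _ => by split_ifs <;> rfl

/-- An evolutionary field commutes with total derivatives, so the variation of `(δL)_a` along `f`
may be taken inside the integration by parts. There the symmetry of second derivatives turns it into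
a sum of terms `D_j f_b • dVert (∂_{b_j} L)`. Shifting `D_j` away from `f_b` gives the adjoint. -/
theorem varL_mem_helmholtz (L : ACE (n + 1)) : varL n L ∈ helmholtz n := by
  classical
  refine ⟨varL_support_finite L, fun f => funext fun a => ?_⟩
  let S := (dVert L).support
  -- The set contains the support of `δL`, as `adjoint_eq` requires, and also every field occurring
  -- in `dVert L`, so that no term is lost when the sums are exchanged.
  let B := (varL_support_finite L).toFinset ∪ S.image Prod.fst
  have hev : ∀ (α : Fin n) g, (evalVert f ∘ₗ dVert) (DCE α.succ g) =
      DCE α.succ ((evalVert f ∘ₗ dVert) g) := fun α g => by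
    rw [LinearMap.comp_apply, LinearMap.comp_apply, dVert_DCE, evalVert_DVert]
  have h1 : Finsupp.mapRange.linearMap (evalVert f ∘ₗ dVert) (dVert L) =
      ∑ c ∈ S, DJet c.2 (f c.1) • dVert (dVert L c) := by
    ext ⟨b, i⟩
    rw [Finsupp.finsetSum_apply]
    change evalVert f (dVert (pderivCE (b.var i) L)) = _
    rw [evalVert_eq_sum f (S := S)]
    · refine Finset.sum_congr rfl fun c _ => ?_
      exact congrArg _ (pderivCE_comm _ _ _)
    · intro c hc
      rw [Finsupp.mem_support_iff] at hc ⊢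
      intro h
      refine hc ?_
      change pderivCE _ (pderivCE _ L) = 0
      rw [pderivCE_comm]
      exact (congrArg _ h).trans (map_zero _)
  rw [linearization_eq, varL_apply,
    adjoint_eq (S := B) fun b hb => by simp [B, Function.mem_support.1 hb]]
  have h2 := parts_mapRange hev a (dVert L)
  rw [LinearMap.comp_apply] at h2
  rw [← h2, h1, map_sum]
  have h3 : ∀ b, f b • dVert (varL n L b) =
      ∑ c ∈ S, if c.1 = b then f c.1 • negDVert c.2 (dVert (dVert L c)) else 0 := by
    intro b
    rw [varL_apply, parts_eq_sum, map_sum, Finset.smul_sum]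
    refine Finset.sum_congr rfl fun c _ => ?_
    split_ifs with h
    · rw [h, dVert_negDJet]
    · rw [map_zero, smul_zero]
  simp only [h3, ← map_sum]
  rw [Finset.sum_comm, map_sum, map_sum]
  refine Finset.sum_congr rfl fun c hc => ?_
  rw [Finset.sum_ite_eq, if_pos, parts_DJet_smul]
  exact Finset.mem_union_right _ (Finset.mem_image_of_mem _ hc)

/-- With `E` the fibre Euler field, take `L = ∑ u^a (E + 1)⁻¹ χ_a`, that is `∑ u^a ∫_0^1 χ_a(t u)
dt`, so that `E L = ∑ u^a χ_a`. The variational derivative of `∑ u^a χ_a` is `χ^* u + χ`. By the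
Helmholtz condition this equals `χ_* u + χ = (E + 1) χ`. It is also `δ (E L) = (E + 1) δL`, and `E +
1` is injective. -/
theorem exists_varL_eq {χ : ThetaField n → ACE (n + 1)} (hχ : χ ∈ helmholtz n) :
    ∃ L, varL n L = χ := by
  classical
  obtain ⟨hfin, hχ⟩ := hχ
  let S := hfin.toFinset
  have hS : Function.support χ ⊆ S := fun a ha => by simpa [S] using ha
  let P : CEVar n → Prop := fun v => ∃ (a : ThetaField n) (j : Fin n → ℕ), v = a.var j
  have hR : ∀ f : ACE (n + 1), eulerJet ((eulerEquiv P 0).symm f) + (eulerEquiv P 0).symm f = f :=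
    fun f => by
      have h5 := eulerCE_symm P 0 f
      rw [zero_add, Nat.cast_one, one_smul] at h5
      exact h5
  refine ⟨∑ a ∈ S, fieldCoord a * (eulerEquiv P 0).symm (χ a), ?_⟩
  have h1 : eulerJet (∑ a ∈ S, fieldCoord a * (eulerEquiv P 0).symm (χ a)) =
      ∑ a ∈ S, fieldCoord a * χ a := by
    rw [map_sum]
    refine Finset.sum_congr rfl fun a _ => ?_
    conv_rhs => rw [← hR (χ a)]
    rw [eulerJet, eulerCE, vfCE_mul, fieldCoord, vfCE_cv, if_pos ⟨a, 0, rfl⟩]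
    ring
  have h2 : ∀ a, varL n (∑ a ∈ S, fieldCoord a * χ a) a = eulerJet (χ a) + χ a := by
    intro a
    have h3 : ∀ b, dVert (fieldCoord b * χ b) =
        fieldCoord b • dVert (χ b) + Finsupp.single (b, 0) (χ b) := by
      intro b
      rw [dVert_mul]
      congr 1
      ext ⟨c, i⟩
      rw [Finsupp.smul_apply, dVert_apply, fieldCoord, pderivCE_cv, Finsupp.single_apply]
      simp only [var_inj, Prod.mk.injEq, smul_eq_mul, mul_ite, mul_one, mul_zero]
      exact if_congr ⟨fun h => ⟨h.1.symm, h.2.symm⟩, fun h => ⟨h.1.symm, h.2.symm⟩⟩ rfl rfl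
    rw [varL_apply, map_sum, map_sum, Finset.sum_congr rfl fun b _ => by rw [h3 b, map_add],
      Finset.sum_add_distrib, ← adjoint_eq hS, ← hχ, linearization_eq, evalVert_fieldCoord]
    congr 1
    simp only [parts_single, negDJet_zero]
    rw [Finset.sum_ite_eq']
    split_ifs with h
    · rfl
    · by_contra h'
      exact h (hS (Ne.symm h'))
  funext a
  refine sub_eq_zero.1 (eq_zero_of_eulerCE_add P 0 ?_)
  have h4 := varL_eulerJet (∑ a ∈ S, fieldCoord a * (eulerEquiv P 0).symm (χ a)) a
  rw [h1, h2] at h4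
  rw [zero_add, Nat.cast_one, one_smul]
  change eulerJet _ + _ = 0
  rw [map_sub]
  linear_combination -h4

end Helmholtz

/-! ### Forms of top degree -/

section Top

variable {n : ℕ}

/-- The form `L dx^2 ∧ … ∧ dx^m`. -/
def topForm (L : ACE (n + 1)) : Theta n n :=
  (LinearMap.toSpanSingleton ℝ (ACE (n + 1)) L).compAlternatingMap Matrix.detRowAlternating

theorem topForm_apply (L : ACE (n + 1)) (v : Fin n → Fin n → ℝ) :
    topForm L v = Matrix.det v • L := rfl

theorem det_single : Matrix.det (fun α : Fin n => (Pi.single α 1 : Fin n → ℝ)) = 1 := by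
  rw [← Matrix.det_one (n := Fin n)]
  congr 1
  funext i j
  simp [Matrix.one_apply, Pi.single_apply, eq_comm]

theorem topCoeff_topForm (L : ACE (n + 1)) : topCoeff (topForm L) = L := by
  rw [topCoeff, topForm_apply, det_single, one_smul]

theorem topForm_topCoeff (θ : Theta n n) : topForm (topCoeff θ) = θ := by
  refine (Pi.basisFun ℝ (Fin n)).ext_alternating fun v hv => ?_
  obtain ⟨σ, rfl⟩ : ∃ σ : Equiv.Perm (Fin n), ⇑σ = v :=
    ⟨Equiv.ofBijective v (Finite.injective_iff_bijective.1 hv), rfl⟩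
  simp only [Pi.basisFun_apply]
  have h1 := (topForm (topCoeff θ)).map_perm (fun α : Fin n => (Pi.single α 1 : Fin n → ℝ)) σ
  have h2 := θ.map_perm (fun α : Fin n => (Pi.single α 1 : Fin n → ℝ)) σ
  refine h1.trans (Eq.trans ?_ h2.symm)
  congr 1
  exact topCoeff_topForm (topCoeff θ)

theorem apply_eq_det_smul (θ : Theta n n) (v : Fin n → Fin n → ℝ) :
    θ v = Matrix.det v • topCoeff θ := by
  conv_lhs => rw [← topForm_topCoeff θ]
  rfl

theorem mem_cocycles_top (θ : Theta n n) : θ ∈ cocycles (DTheta n) n :=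
  form_eq_zero_of_lt (Nat.lt_succ_self n) _

theorem varL_topCoeff_of_mem_coboundaries {θ : Theta n n} (h : θ ∈ coboundaries (DTheta n) n)
    (hn : 1 ≤ n) : varL n (topCoeff θ) = 0 := by
  obtain ⟨n, rfl⟩ : ∃ k, n = k + 1 := ⟨n - 1, by omega⟩
  obtain ⟨η, rfl⟩ := h
  rw [topCoeff, dForm_apply, map_sum]
  refine Finset.sum_eq_zero fun i _ => ?_
  rw [map_zsmul, sum_single_smul, varL_DCE, smul_zero]

theorem mem_coboundaries_of_varL_topCoeff {θ : Theta n n} (h : varL n (topCoeff θ) = 0)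
    (hn : 1 ≤ n) : θ ∈ coboundaries (DTheta n) n := by
  obtain ⟨n, rfl⟩ : ∃ k, n = k + 1 := ⟨n - 1, by omega⟩
  refine exists_dForm_eq le_rfl (mem_cocycles_top θ) (.inr fun a v => ?_)
  rw [apply_eq_det_smul, map_smul, map_smul, ← varL_apply, h]
  simp

/-- The map `[L dx^2 ∧ … ∧ dx^m] ↦ δL`. -/
def varCoh (hn : 1 ≤ n) : HTheta n n →ₗ[ℝ] helmholtz n :=
  Submodule.liftQ _ (((varL n).codRestrict (helmholtz n) varL_mem_helmholtz) ∘ₗ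
    ({ toFun := topCoeff, map_add' := fun _ _ => rfl, map_smul' := fun _ _ => rfl } :
      Theta n n →ₗ[ℝ] ACE (n + 1)) ∘ₗ (cocycles (DTheta n) n).subtype)
    fun _ hθ => Subtype.ext (varL_topCoeff_of_mem_coboundaries hθ hn)

theorem varCoh_cls (hn : 1 ≤ n) (θ : Theta n n) (hθ : θ ∈ cocycles (DTheta n) n) :
    (varCoh hn (Coh.cls (DTheta n) θ hθ) : ThetaField n → ACE (n + 1)) = varL n (topCoeff θ) := rfl

/-- Injectivity is exactness of the auxiliary complex in top degree; surjectivity is the existence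
of a Lagrangian under the Helmholtz conditions. -/
theorem varCoh_bijective (hn : 1 ≤ n) : Function.Bijective (varCoh hn) := by
  constructor
  · refine (injective_iff_map_eq_zero _).2 fun z hz => ?_
    obtain ⟨⟨θ, hθ⟩, rfl⟩ := Submodule.Quotient.mk_surjective _ z
    refine (Submodule.Quotient.mk_eq_zero _).2 ?_
    exact mem_coboundaries_of_varL_topCoeff (congrArg Subtype.val hz) hn
  · rintro ⟨χ, hχ⟩
    obtain ⟨L, rfl⟩ := exists_varL_eq hχ
    refine ⟨Coh.cls (DTheta n) (topForm L) (mem_cocycles_top _), Subtype.ext ?_⟩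
    rw [varCoh_cls, topCoeff_topForm]

end Top

/-! ### The long exact sequence -/

section LongExact

variable {n : ℕ}

theorem cls_eq_zero_iff {k q : ℕ} {A : Type} [AddCommGroup A] [Module ℝ A]
    {D : Fin k → A →ₗ[ℝ] A} {w : Form k A q} {h : w ∈ cocycles D q} :
    Coh.cls D w h = 0 ↔ w ∈ coboundaries D q := by
  rw [Submodule.Quotient.mk_eq_zero]
  rfl

theorem dForm_wedgeFirst_pull {q : ℕ} (θ : Theta n q) :
    dForm DCE (q + 1) (wedgeFirst q (pull θ)) =
      -wedgeFirst (q + 1) (pull (dForm (DTheta n) q θ)) := by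
  rw [dForm_wedgeFirst DCE_comm, dForm_pull, map_add, wedgeFirst_wedgeFirst, add_zero]

/-- The map `H^q(Θ) → H^{q+1}(Ω)` of the long exact sequence is zero below the top degree. For `q >
0` the form `θ` is exact already. For `q = 0` it is a function of `x^1` alone, hence `D_1 F` with
`F` annihilated by the other `D_α`. -/
theorem exists_dForm_eq_wedgeFirst {q : ℕ} (hq : q < n) {θ : Theta n q}
    (hθ : dForm (DTheta n) q θ = 0) :
    ∃ η, dForm (DCE (m := n + 1)) q η = wedgeFirst q (pull θ) := by
  cases q with
  | zero =>
    obtain ⟨F, hF, hF'⟩ := exists_primitive (pderivCE_eq_zero_of_dForm hq hθ)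
    let w : Theta n 0 := AlternatingMap.constOfIsEmpty ℝ (Fin n → ℝ) (Fin 0) F
    refine ⟨pull w, ?_⟩
    have h1 : dForm (fun α : Fin n => DCE (m := n + 1) α.succ) 0 w = 0 := by
      ext v
      rw [dForm_apply]
      simp [w, hF']
    have h2 : (DCE 0).compAlternatingMap w = θ := by
      ext v
      rw [Subsingleton.elim v ![], ← hF]
      rfl
    rw [dForm_pull, h1, h2, pull_zero]
    exact zero_add _
  | succ q =>
    obtain ⟨ρ, rfl⟩ := exists_dForm_eq (by omega) hθ (.inl hq)
    exact ⟨-wedgeFirst q (pull ρ), by rw [map_neg, dForm_wedgeFirst_pull, neg_neg]⟩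

theorem dForm_front_eq_zero {q : ℕ} {w : Form (n + 1) (ACE (n + 1)) q} (hw : dForm DCE q w = 0) :
    dForm (DTheta n) q (front w) = 0 := by
  rw [dForm_front DCE, hw]
  rfl

/-- The `dx^1` component of the closedness condition. It says that the connecting map `D_1` kills
the class of the front part. -/
theorem compAlternatingMap_front_eq {q : ℕ} {w : Form (n + 1) (ACE (n + 1)) (q + 1)}
    (hw : dForm DCE (q + 1) w = 0) :
    (DCE 0).compAlternatingMap (front w) = dForm (DTheta n) q (front (contractFirst w)) := by
  rw [eq_pull_add_wedgeFirst w, dForm_pull_add_wedgeFirst DCE_comm] at hw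
  exact sub_eq_zero.1 (pull_add_wedgeFirst_eq_zero hw).2

/-- After subtracting the differential of a pulled back primitive of the front part, only a form
`dx^1 ∧ θ'` with closed `θ'` is left. As `θ'` has degree `q - 1 < n`, this form is exact by
`exists_dForm_eq_wedgeFirst`. -/
theorem mem_coboundaries_of_front {q : ℕ} (hq : q ≤ n) (hq' : 1 ≤ q)
    {w : Form (n + 1) (ACE (n + 1)) q}
    (hw : w ∈ cocycles DCE q) (h : front w ∈ coboundaries (DTheta n) q) :
    w ∈ coboundaries DCE q := by
  obtain ⟨q, rfl⟩ : ∃ k, q = k + 1 := ⟨q - 1, by omega⟩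
  obtain ⟨ψ, hψ⟩ := h
  let w' := w - dForm DCE q (pull ψ)
  have h1 : dForm DCE (q + 1) w' = 0 := by
    rw [map_sub, dForm_dForm DCE_comm, show dForm DCE (q + 1) w = 0 from hw, sub_zero]
  have h2 : front w' = 0 := by
    rw [front_sub, ← dForm_front DCE, front_pull, hψ, sub_self]
  have h3 := compAlternatingMap_front_eq h1
  rw [h2] at h3
  obtain ⟨η, hη⟩ := exists_dForm_eq_wedgeFirst (θ := front (contractFirst w')) hq (by
    rw [← h3]
    ext v
    exact map_zero (DCE 0))
  refine ⟨η + pull ψ, ?_⟩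
  have h4 := eq_pull_add_wedgeFirst w'
  rw [h2, pull_zero, zero_add] at h4
  rw [map_add, hη, ← h4]
  exact sub_add_cancel _ _

theorem coh_subsingleton {q : ℕ} (hq : 1 ≤ q) (hqn : q < n) :
    Subsingleton (HCE (n + 1) q) := by
  refine subsingleton_of_forall_eq 0 fun z => ?_
  obtain ⟨⟨w, hw⟩, rfl⟩ := Submodule.Quotient.mk_surjective _ z
  refine (Submodule.Quotient.mk_eq_zero _).2 (mem_coboundaries_of_front hqn.le hq hw ?_)
  have h1 := dForm_front_eq_zero (show dForm DCE q w = 0 from hw)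
  obtain ⟨q, rfl⟩ : ∃ k, q = k + 1 := ⟨q - 1, by omega⟩
  exact exists_dForm_eq hqn.le h1 (.inl hqn)

theorem coh_subsingleton_of_lt {q : ℕ} (hq : n + 1 < q) : Subsingleton (HCE (n + 1) q) := by
  refine subsingleton_of_forall_eq 0 fun z => ?_
  obtain ⟨w, rfl⟩ := Submodule.Quotient.mk_surjective _ z
  rw [show w = 0 from Subtype.ext (form_eq_zero_of_lt hq w.1)]
  rfl

/-! #### Degree zero -/

theorem ACE_algebraMap_injective : Function.Injective (algebraMap ℝ (ACE (n + 1))) := by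
  intro c d h
  have h1 := congrArg (inCoords n) h
  rw [AlgEquiv.commutes, AlgEquiv.commutes] at h1
  exact congrFun (congrArg Subtype.val h1) 0

/-- The derivatives in the directions `2, …, m`, of which there is at least one, reduce `f` to a
function of `x^1`. On such a function `D_1` is the partial derivative. -/
theorem exists_eq_algebraMap_of_DCE (hn : 1 ≤ n) {f : ACE (n + 1)} (h : ∀ μ, DCE μ f = 0) :
    ∃ c : ℝ, f = algebraMap ℝ (ACE (n + 1)) c := by
  let w : Theta n 0 := AlternatingMap.constOfIsEmpty ℝ (Fin n → ℝ) (Fin 0) f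
  have h1 : dForm (DTheta n) 0 w = 0 := by
    ext v
    rw [dForm_apply]
    simp [w, h]
  have h2 : ∀ v, v ≠ .x 0 → pderivCE v f = 0 := pderivCE_eq_zero_of_dForm hn h1
  refine exists_eq_algebraMap fun v => ?_
  by_cases hv : v = .x 0
  · rw [hv, ← DCE_eq_pderivCE (fun a j => h2 _ (x_ne_var _ _ _).symm), h]
  · exact h2 v hv

theorem DCE_algebraMap (μ : Fin (n + 1)) (c : ℝ) :
    DCE μ (algebraMap ℝ (ACE (n + 1)) c) = 0 := by
  have h1 : DCE μ (1 : ACE (n + 1)) = 0 := by simpa using DCE_mul μ (1 : ACE (n + 1)) 1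
  rw [Algebra.algebraMap_eq_smul_one, map_smul, h1, smul_zero]

theorem constForm_mem_cocycles (c : ℝ) : constForm (n + 1) c ∈ cocycles DCE 0 := by
  change dForm DCE 0 _ = 0
  ext v
  rw [dForm_apply]
  simp [constForm, DCE_algebraMap]

/-- The class of a constant function. -/
def constCoh (n : ℕ) : ℝ →ₗ[ℝ] HCE (n + 1) 0 :=
  Submodule.mkQ _ ∘ₗ LinearMap.codRestrict (cocycles DCE 0)
    { toFun := constForm (n + 1)
      map_add' := fun c d => by
        ext v
        exact map_add (algebraMap ℝ (ACE (n + 1))) c d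
      map_smul' := fun c d => by
        ext v
        change algebraMap ℝ (ACE (n + 1)) (c * d) = c • algebraMap ℝ (ACE (n + 1)) d
        rw [map_mul, Algebra.smul_def] } constForm_mem_cocycles

theorem constCoh_bijective (hn : 1 ≤ n) : Function.Bijective (constCoh n) := by
  constructor
  · refine (injective_iff_map_eq_zero _).2 fun c hc => ?_
    have h1 : constForm (n + 1) c = 0 := (Submodule.Quotient.mk_eq_zero _).1 hc
    refine ACE_algebraMap_injective (n := n) ?_
    rw [map_zero]
    exact DFunLike.congr_fun h1 ![]
  · intro z
    obtain ⟨⟨w, hw⟩, rfl⟩ := Submodule.Quotient.mk_surjective _ z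
    obtain ⟨c, hc⟩ := exists_eq_algebraMap_of_DCE hn (f := w ![]) fun μ => by
      rw [← dForm_zero_apply, show dForm DCE 0 w = 0 from hw]
      rfl
    refine ⟨c, congrArg Submodule.Quotient.mk (Subtype.ext ?_)⟩
    ext v
    rw [Subsingleton.elim v ![], hc]
    rfl

/-! #### Degree `m - 1` -/

/-- The map in cohomology induced by the projection. -/
def frontCoh (n q : ℕ) : HCE (n + 1) q →ₗ[ℝ] HTheta n q :=
  Submodule.mapQ _ _ (LinearMap.restrict
    ({ toFun := front, map_add' := fun _ _ => rfl, map_smul' := fun _ _ => rfl } :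
      Form (n + 1) (ACE (n + 1)) q →ₗ[ℝ] Theta n q)
    (fun _ hw => dForm_front_eq_zero hw)) <| by
  rintro ⟨w, hw⟩ h
  cases q with
  | zero =>
    have h1 : w = 0 := h
    subst h1
    exact rfl
  | succ q =>
    obtain ⟨η, rfl⟩ := h
    exact ⟨front η, dForm_front DCE η⟩

theorem frontCoh_cls {q : ℕ} (w : Form (n + 1) (ACE (n + 1)) q) (hw : w ∈ cocycles DCE q) :
    frontCoh n q (Coh.cls DCE w hw) = Coh.cls (DTheta n) (front w) (dForm_front_eq_zero hw) := rfl

theorem frontCoh_injective {q : ℕ} (hq : q ≤ n) (hq' : 1 ≤ q) :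
    Function.Injective (frontCoh n q) := by
  refine (injective_iff_map_eq_zero _).2 fun z hz => ?_
  obtain ⟨⟨w, hw⟩, rfl⟩ := Submodule.Quotient.mk_surjective _ z
  exact cls_eq_zero_iff.2 (mem_coboundaries_of_front hq hq' hw
    (cls_eq_zero_iff.1 ((frontCoh_cls w hw).symm.trans hz)))

/-- For closed `θ`, the form `θ + dx^1 ∧ ρ` is closed precisely when `D_1 θ = d_Θ ρ`. -/
theorem range_frontCoh {q : ℕ} (hq : 1 ≤ q) :
    LinearMap.range (frontCoh n q) = LinearMap.ker (D1 n q) := by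
  obtain ⟨q, rfl⟩ : ∃ k, q = k + 1 := ⟨q - 1, by omega⟩
  ext z
  constructor
  · rintro ⟨z, rfl⟩
    obtain ⟨⟨w, hw⟩, rfl⟩ := Submodule.Quotient.mk_surjective _ z
    refine (Submodule.Quotient.mk_eq_zero _).2 ?_
    exact ⟨_, (compAlternatingMap_front_eq hw).symm⟩
  · intro hz
    obtain ⟨⟨θ, hθ⟩, rfl⟩ := Submodule.Quotient.mk_surjective _ z
    obtain ⟨ρ, hρ⟩ := (Submodule.Quotient.mk_eq_zero _).1 hz
    replace hρ : dForm (DTheta n) q ρ = (DCE 0).compAlternatingMap θ := hρ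
    have h1 : pull θ + wedgeFirst q (pull ρ) ∈ cocycles DCE (q + 1) := by
      change dForm DCE (q + 1) _ = 0
      rw [dForm_pull_add_wedgeFirst DCE_comm, show dForm _ (q + 1) θ = 0 from hθ]
      change _ + wedgeFirst (q + 1) (pull (_ - dForm (DTheta n) q ρ)) = 0
      rw [hρ, sub_self, pull_zero, pull_zero, map_zero, add_zero]
    refine ⟨Coh.cls DCE _ h1, congrArg Submodule.Quotient.mk (Subtype.ext ?_)⟩
    change front (pull θ + wedgeFirst q (pull ρ)) = θ
    rw [front_add, front_pull, front_wedgeFirst, add_zero]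

/-! #### Degree `m` -/

theorem incl_eq {q : ℕ} (θ : Theta n q) : incl θ = (-1 : ℝ) ^ q • wedgeFirst q (pull θ) := by
  rw [incl]
  congr 1
  ext v
  rw [wedgeFirst_apply, AlternatingMap.alternatizeUncurryFin_apply]
  rfl

theorem incl_mem_cocycles (θ : Theta n n) : incl θ ∈ cocycles DCE (n + 1) :=
  form_eq_zero_of_lt (Nat.lt_succ_self (n + 1)) _

/-- The map `θ ↦ [ι θ]` on the forms of top degree. -/
def inclCoh (n : ℕ) : HTheta n n →ₗ[ℝ] HCE (n + 1) (n + 1) :=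
  Submodule.mapQ _ _ (LinearMap.restrict
    ({ toFun := incl
       map_add' := fun _ _ => by simp only [incl_eq, pull_add, map_add, smul_add]
       map_smul' := fun _ _ => by
        simp only [incl_eq, pull_smul, map_smul, smul_comm _ ((-1 : ℝ) ^ n), RingHom.id_apply] } :
      Theta n n →ₗ[ℝ] Form (n + 1) (ACE (n + 1)) (n + 1))
    (fun θ _ => incl_mem_cocycles θ)) <| by
  rintro ⟨θ, hθ⟩ h
  cases n with
  | zero =>
    have h1 : θ = 0 := h
    subst h1
    refine ⟨0, ?_⟩
    rw [map_zero]
    change 0 = incl 0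
    rw [incl_eq, pull_zero, map_zero, smul_zero]
  | succ n =>
    obtain ⟨ρ, rfl⟩ := h
    refine ⟨(-1 : ℝ) ^ n • wedgeFirst n (pull ρ), ?_⟩
    change _ = incl (dForm (DTheta (n + 1)) n ρ)
    rw [map_smul, dForm_wedgeFirst_pull, incl_eq, pow_succ, smul_neg, mul_neg_one]
    exact (neg_smul _ _).symm

/-- The front part `θ` of an `(m-1)`-form `θ + dx^1 ∧ θ'` is automatically closed in `Θ`, so its
differential is `dx^1 ∧ (D_1 θ - d_Θ θ')`. The forms `dx^1 ∧ ψ` that are exact are therefore those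
with `ψ` in the image of `D_1` modulo exact forms. The sign in `incl` is absorbed by rescaling with
`(-1) ^ (n + 1)`, where this exponent is the degree `m - 1` after the substitution for `n`. -/
theorem ker_inclCoh (hn : 1 ≤ n) : LinearMap.ker (inclCoh n) = LinearMap.range (D1 n n) := by
  obtain ⟨n, rfl⟩ : ∃ k, n = k + 1 := ⟨n - 1, by omega⟩
  have hsq : ((-1 : ℝ) ^ (n + 1)) * ((-1 : ℝ) ^ (n + 1)) = 1 := by
    rw [← pow_add, Even.neg_one_pow ⟨_, rfl⟩]
  ext z
  obtain ⟨⟨θ, hθ⟩, rfl⟩ := Submodule.Quotient.mk_surjective _ z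
  constructor
  · intro hz
    obtain ⟨w, hw⟩ := (Submodule.Quotient.mk_eq_zero _).1 hz
    replace hw : dForm DCE (n + 1) w = incl θ := hw
    rw [eq_pull_add_wedgeFirst w, dForm_pull_add_wedgeFirst DCE_comm,
      form_eq_zero_of_lt (Nat.lt_succ_self (n + 1)) (dForm _ (n + 1) (front w)), pull_zero,
      zero_add, incl_eq, ← map_smul, ← pull_smul, ← sub_eq_zero, ← map_sub, ← pull_sub] at hw
    have h1 := wedgeFirst_pull_injective hw
    refine ⟨Coh.cls (DTheta (n + 1)) ((-1 : ℝ) ^ (n + 1) • front w) (mem_cocycles_top _), ?_⟩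
    refine (Submodule.Quotient.eq _).2 ⟨(-1 : ℝ) ^ (n + 1) • front (contractFirst w), ?_⟩
    change dForm (DTheta (n + 1)) n _ =
      (DCE 0).compAlternatingMap ((-1 : ℝ) ^ (n + 1) • front w) - θ
    have h2 : (DCE 0).compAlternatingMap ((-1 : ℝ) ^ (n + 1) • front w) =
        (-1 : ℝ) ^ (n + 1) • (DCE 0).compAlternatingMap (front w) := by
      ext v
      exact map_smul (DCE 0) _ _
    have h3 : θ = (-1 : ℝ) ^ (n + 1) • ((-1 : ℝ) ^ (n + 1) • θ) := by
      rw [smul_smul, hsq, one_smul]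
    rw [h2, map_smul, h3, ← sub_eq_zero.1 h1, smul_sub]
    abel
  · rintro ⟨y, hy⟩
    obtain ⟨⟨ψ, hψ⟩, rfl⟩ := Submodule.Quotient.mk_surjective _ y
    rw [← hy]
    refine (Submodule.Quotient.mk_eq_zero _).2 ⟨(-1 : ℝ) ^ (n + 1) • pull ψ, ?_⟩
    change _ = incl ((DCE 0).compAlternatingMap ψ)
    rw [map_smul, dForm_pull, incl_eq, form_eq_zero_of_lt (Nat.lt_succ_self (n + 1))
      (dForm _ (n + 1) ψ), pull_zero, zero_add]

theorem inclCoh_surjective : Function.Surjective (inclCoh n) := by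
  intro z
  obtain ⟨⟨w, hw⟩, rfl⟩ := Submodule.Quotient.mk_surjective _ z
  refine ⟨Coh.cls (DTheta n) ((-1 : ℝ) ^ n • front (contractFirst w)) (mem_cocycles_top _),
    congrArg Submodule.Quotient.mk (Subtype.ext ?_)⟩
  change incl ((-1 : ℝ) ^ n • front (contractFirst w)) = w
  conv_rhs => rw [eq_pull_add_wedgeFirst w,
    form_eq_zero_of_lt (Nat.lt_succ_self n) (front w), pull_zero, zero_add]
  rw [incl_eq, pull_smul, map_smul, smul_smul, ← pow_add, Even.neg_one_pow ⟨_, rfl⟩, one_smul]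

end LongExact

/-! ### The conserved current of the velocity field -/

section Velocity

variable {n : ℕ}

theorem velocityForm_removeNth (i : Fin (n + 1)) :
    velocityForm n (i.removeNth fun μ => (Pi.single μ 1 : Fin (n + 1) → ℝ)) =
      (-1 : ℝ) ^ (i : ℕ) • restr (n + 1) (coord (BVar.u i 0)) := by
  rw [velocityForm, sum_form_apply, Finset.sum_eq_single i]
  · have h1 := neg_one_pow_smul_vecCons_removeNth
      (Matrix.detRowAlternating : Form (n + 1) ℝ (n + 1))
      (fun μ => (Pi.single μ 1 : Fin (n + 1) → ℝ)) i
    have h2 : (Matrix.detRowAlternating : Form (n + 1) ℝ (n + 1))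
        (fun μ => (Pi.single μ 1 : Fin (n + 1) → ℝ)) = 1 := det_single
    rw [h2, ← Int.cast_smul_eq_zsmul ℝ, smul_eq_mul] at h1
    push_cast at h1
    have h3 : dHat i (i.removeNth fun μ => (Pi.single μ 1 : Fin (n + 1) → ℝ)) =
        (-1 : ℝ) ^ (i : ℕ) := by
      have h4 : ((-1 : ℝ) ^ (i : ℕ)) * ((-1 : ℝ) ^ (i : ℕ)) = 1 := by
        rw [← pow_add, Even.neg_one_pow ⟨_, rfl⟩]
      rw [dHat, AlternatingMap.curryLeft_apply_apply]
      linear_combination (-1 : ℝ) ^ (i : ℕ) * h1 -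
        (Matrix.detRowAlternating : Form (n + 1) ℝ (n + 1)) (Matrix.vecCons (Pi.single i 1)
          (i.removeNth fun μ => (Pi.single μ 1 : Fin (n + 1) → ℝ))) * h4
    rw [LinearMap.compAlternatingMap_apply, h3, LinearMap.toSpanSingleton_apply]
  · intro μ _ hμ
    -- For `μ ≠ i` the vector `e_μ` is inserted by the contraction and also occurs among the
    -- remaining ones, so the determinant has two equal rows.
    obtain ⟨k, rfl⟩ := Fin.exists_succAbove_eq hμ
    rw [LinearMap.compAlternatingMap_apply, dHat, AlternatingMap.curryLeft_apply_apply,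
      AlternatingMap.map_eq_zero_of_eq _ _ (i := 0) (j := k.succ) rfl (Fin.succ_ne_zero k).symm,
      map_zero]
  · simp

/-- A form of top degree is determined by its value on the standard basis. Here this value is the
divergence `∑ u^μ_{(μ)}`, because the signs of the differential cancel those of `d_μ x`; it vanishes
by the continuity equation with multi-index `0`. -/
theorem velocityForm_mem_cocycles : velocityForm n ∈ cocycles DCE n := by
  have h1 : dForm DCE n (velocityForm n) (fun μ => (Pi.single μ 1 : Fin (n + 1) → ℝ)) = 0 := by
    rw [dForm_apply]
    have h2 : ∀ i : Fin (n + 1), (-1 : ℤ) ^ (i : ℕ) • ∑ μ, (Pi.single i 1 : Fin (n + 1) → ℝ) μ •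
        DCE μ (velocityForm n (i.removeNth fun μ => (Pi.single μ 1 : Fin (n + 1) → ℝ))) =
        restr (n + 1) (coord (BVar.u i (0 + Pi.single i 1))) := by
      intro i
      rw [sum_single_smul, velocityForm_removeNth, map_smul, ← Int.cast_smul_eq_zsmul ℝ]
      push_cast
      rw [smul_smul, ← pow_add, Even.neg_one_pow ⟨_, rfl⟩, one_smul, DCE_restr, DB,
        vectorField_coord]
      rfl
    rw [Finset.sum_congr rfl fun i _ => h2 i, ← map_sum, ← map_zero (restr (n + 1)),
      restr_eq_iff, sub_zero]
    intro b hb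
    rw [AddSubmonoidClass.coe_finsetSum, Finset.sum_apply]
    exact hb 0
  change dForm DCE n (velocityForm n) = 0
  refine (Pi.basisFun ℝ (Fin (n + 1))).ext_alternating fun v hv => ?_
  obtain ⟨σ, rfl⟩ : ∃ σ : Equiv.Perm (Fin (n + 1)), ⇑σ = v :=
    ⟨Equiv.ofBijective v (Finite.injective_iff_bijective.1 hv), rfl⟩
  simp only [Pi.basisFun_apply]
  refine ((dForm DCE n (velocityForm n)).map_perm
    (fun μ => (Pi.single μ 1 : Fin (n + 1) → ℝ)) σ).trans ?_
  rw [h1, smul_zero]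
  rfl

theorem topCoeff_front_velocityForm :
    topCoeff (front (velocityForm n)) = cv (ThetaField.u1.var 0) := by
  have h1 := velocityForm_removeNth (0 : Fin (n + 1))
  rw [Fin.val_zero, pow_zero, one_smul] at h1
  have h2 : (cv (ThetaField.u1.var 0) : ACE (n + 1)) = restr (n + 1) (coord (BVar.u 0 0)) := by
    change restr (n + 1) (coord (BVar.u 0 (mcons 0 0))) = _
    congr 3
    funext μ
    refine Fin.cases ?_ (fun α => ?_) μ <;> simp
  rw [h2, ← h1, topCoeff, front_apply]
  congr 1
  funext α μ
  refine Fin.cases ?_ (fun β => ?_) μ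
  · simp [Fin.removeNth_apply]
  · simp [Fin.removeNth_apply, Pi.single_apply]

open Classical in
theorem varL_cv_u1 (a : ThetaField n) :
    varL n (cv (ThetaField.u1.var 0)) a = if a = .u1 then 1 else 0 := by
  have h1 : dVert (cv (ThetaField.u1.var 0)) =
      (Finsupp.single (ThetaField.u1, 0) 1 : Vert n) := by
    ext ⟨c, i⟩
    rw [dVert_apply, pderivCE_cv, Finsupp.single_apply]
    simp only [var_inj, Prod.mk.injEq, eq_comm]
  rw [varL_apply, h1, parts_single, negDJet_zero]
  simp only [eq_comm]

/-- The recursion `f k = -T (f (k + 1))` propagates the zeros beyond the finite support downwards.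
-/
theorem eq_zero_of_eq_neg_succ {A : Type} [AddCommGroup A] [Module ℝ A] (T : A →ₗ[ℝ] A)
    {f : ℕ → A} (hf : (Function.support f).Finite) (h : ∀ k, T (f (k + 1)) + f k = 0) (k : ℕ) :
    f k = 0 := by
  obtain ⟨N, hN⟩ := hf.bddAbove
  have h1 : ∀ d k, N < k + d → f k = 0 := by
    intro d
    induction d with
    | zero =>
      intro k hk
      by_contra hne
      have := hN hne
      omega
    | succ d ih =>
      intro k hk
      have h2 := h k
      rwa [ih (k + 1) (by omega), map_zero, zero_add] at h2
  exact h1 (N + 1) k (by omega)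

/-- The shift in `k` and the finite number of components force all `u^α_k` and `p_k` components to
vanish. The equations that remain say that every `D_μ` kills the `u^1_0` component, which is
therefore constant. -/
theorem eq_smul_of_DTilde_eq_zero (hn : 1 ≤ n) {χ : ThetaField n → ACE (n + 1)}
    (hfin : (Function.support χ).Finite) (h : DTilde χ = 0) :
    ∃ c : ℝ, χ = c • varL n (cv (ThetaField.u1.var 0)) := by
  classical
  have hp : ∀ k, χ (.p k) = 0 := by
    refine eq_zero_of_eq_neg_succ (DCE 0) (f := fun k => χ (.p k)) ?_ fun k =>
      congrFun h (.p (k + 1))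
    exact hfin.preimage fun i _ j _ hij => by simpa using hij
  have hu : ∀ α k, χ (.u α k) = 0 := by
    intro α
    refine eq_zero_of_eq_neg_succ (DCE 0) (f := fun k => χ (.u α k)) ?_ fun k =>
      congrFun h (.u α (k + 1))
    exact hfin.preimage fun i _ j _ hij => by simpa using hij
  obtain ⟨c, hc⟩ := exists_eq_algebraMap_of_DCE hn (f := χ .u1) fun μ => by
    refine Fin.cases (congrFun h .u1) (fun α => ?_) μ
    have h1 : DCE 0 (χ (.u α 0)) + DCE α.succ (χ .u1) = 0 := congrFun h (.u α 0)
    rwa [hu, map_zero, zero_add] at h1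
  refine ⟨c, funext fun a => ?_⟩
  rw [Pi.smul_apply, varL_cv_u1]
  cases a with
  | u1 => rw [hc, if_pos rfl, Algebra.algebraMap_eq_smul_one]
  | u α k => rw [hu, if_neg (by simp), smul_zero]
  | p k => rw [hp, if_neg (by simp), smul_zero]

/-- The image of the class in the Helmholtz space is `δ u^1_0`, whose `u^1_0` component is `1`. -/
theorem velocityForm_cls_ne_zero (hn : 1 ≤ n) :
    Coh.cls DCE (velocityForm n) velocityForm_mem_cocycles ≠ 0 := by
  classical
  intro h
  have h1 := congrArg (varCoh hn) (congrArg (frontCoh n n) h)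
  rw [map_zero, map_zero, frontCoh_cls] at h1
  have h2 : varL n (topCoeff (front (velocityForm n))) .u1 = 0 :=
    congrFun (congrArg Subtype.val h1) .u1
  rw [topCoeff_front_velocityForm, varL_cv_u1, if_pos rfl] at h2
  have h3 : (1 : ℝ) = 0 := ACE_algebraMap_injective (n := n) (by rw [map_one, map_zero]; exact h2)
  exact one_ne_zero h3

/-- The composite of the projection and `δ` embeds `H^{m-1}(Ω)` into the kernel of `DTilde`, where
every element is a multiple of `δ u^1_0`, the image of the velocity form. -/
theorem exists_eq_smul_velocityForm (hn : 1 ≤ n) (z : HCE (n + 1) n) :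
    ∃ c : ℝ, z = c • Coh.cls DCE (velocityForm n) velocityForm_mem_cocycles := by
  have h1 : D1 n n (frontCoh n n z) = 0 := by
    have : frontCoh n n z ∈ LinearMap.ker (D1 n n) :=
      range_frontCoh hn ▸ LinearMap.mem_range_self _ z
    exact this
  obtain ⟨⟨w, hw⟩, rfl⟩ := Submodule.Quotient.mk_surjective _ z
  have h3 : varL n (DCE 0 (topCoeff (front w))) = 0 :=
    congrArg Subtype.val ((congrArg (varCoh hn) h1).trans (map_zero _))
  rw [varL_DCE_zero] at h3
  obtain ⟨c, hc⟩ := eq_smul_of_DTilde_eq_zero hn (varL_support_finite _) h3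
  refine ⟨c, frontCoh_injective le_rfl hn ((varCoh_bijective hn).1 (Subtype.ext ?_))⟩
  rw [map_smul, map_smul]
  refine hc.trans ?_
  rw [← topCoeff_front_velocityForm]
  rfl

end Velocity

end DivFree

end

open DivFree
/-- The horizontal cohomology of the divergence-free solution manifold over `m = n + 1 ≥ 2`
independent variables. -/
theorem mainTheorem1 (n : ℕ) (hn : 1 ≤ n) :
    -- the degrees in which the cohomology vanishes
    (∀ q : ℤ, (q < 0 ∨ (1 ≤ q ∧ q ≤ ((n : ℤ) + 1) - 2) ∨ (n : ℤ) + 1 < q) →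
      Subsingleton (HCEInt (n + 1) q)) ∧
    -- degree `0`: the constants
    (∃ e : ℝ ≃ₗ[ℝ] HCE (n + 1) 0, ∀ c : ℝ,
      ∃ h : constForm (n + 1) c ∈ cocycles DCE 0, e c = Coh.cls DCE (constForm (n + 1) c) h) ∧
    -- degree `m - 1`: the kernel of `D_1`, through the projection `π`
    (∃ e : HCE (n + 1) n ≃ₗ[ℝ] LinearMap.ker (D1 n n),
      ∀ (w : Form (n + 1) (ACE (n + 1)) n) (hw : w ∈ cocycles DCE n),
        ∃ h : proj w ∈ cocycles (DTheta n) n,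
          (e (Coh.cls DCE w hw) : HTheta n n) = Coh.cls (DTheta n) (proj w) h) ∧
    -- degree `m - 1`: a line, spanned by the class of `u^μ d_μ x`
    (∃ h : velocityForm n ∈ cocycles DCE n,
      Coh.cls DCE (velocityForm n) h ≠ 0 ∧
      ∀ z : HCE (n + 1) n, ∃ c : ℝ, z = c • Coh.cls DCE (velocityForm n) h) ∧
    -- degree `m`: the cokernel of `D_1`, through the map `ι`
    (∃ e : (HTheta n n ⧸ LinearMap.range (D1 n n)) ≃ₗ[ℝ] HCE (n + 1) (n + 1),
      ∀ (θ : Theta n n) (hθ : θ ∈ cocycles (DTheta n) n),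
        ∃ h : incl θ ∈ cocycles DCE (n + 1),
          e (Submodule.Quotient.mk (Coh.cls (DTheta n) θ hθ)) = Coh.cls DCE (incl θ) h) ∧
    -- the same cokernel in the Helmholtz space, through the variational derivative
    (∃ (δ : HTheta n n ≃ₗ[ℝ] helmholtz n) (T : helmholtz n →ₗ[ℝ] helmholtz n),
      (∀ (θ : Theta n n) (hθ : θ ∈ cocycles (DTheta n) n),
        (δ (Coh.cls (DTheta n) θ hθ) : ThetaField n → ACE (n + 1)) = varDeriv (topCoeff θ)) ∧
      (∀ χ : helmholtz n, (T χ : ThetaField n → ACE (n + 1)) = DTilde χ) ∧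
      ∃ e : (HTheta n n ⧸ LinearMap.range (D1 n n)) ≃ₗ[ℝ] (helmholtz n ⧸ LinearMap.range T),
        ∀ z : HTheta n n,
          e (Submodule.Quotient.mk z) = Submodule.Quotient.mk (δ z)) := by
  refine ⟨fun q hq => ?_, ?_, ?_, ?_, ?_, ?_⟩
  · cases q with
    | negSucc q => exact inferInstanceAs (Subsingleton PUnit)
    | ofNat q =>
      simp only [Int.ofNat_eq_natCast] at hq ⊢
      rcases hq with hq | hq | hq
      · omega
      · exact coh_subsingleton (by omega) (by omega)
      · exact coh_subsingleton_of_lt (by omega)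
  · exact ⟨LinearEquiv.ofBijective _ (constCoh_bijective hn),
      fun c => ⟨constForm_mem_cocycles c, rfl⟩⟩
  · exact ⟨(LinearEquiv.ofInjective _ (frontCoh_injective le_rfl hn)).trans
      (LinearEquiv.ofEq _ _ (range_frontCoh hn)),
      fun w hw => ⟨dForm_front_eq_zero hw, rfl⟩⟩
  · exact ⟨velocityForm_mem_cocycles, velocityForm_cls_ne_zero hn,
      exists_eq_smul_velocityForm hn⟩
  · refine ⟨(Submodule.quotEquivOfEq _ _ (ker_inclCoh hn).symm).trans
      ((inclCoh n).quotKerEquivOfSurjective inclCoh_surjective),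
      fun θ hθ => ⟨incl_mem_cocycles θ, rfl⟩⟩
  · let δ := LinearEquiv.ofBijective (varCoh hn) (varCoh_bijective hn)
    -- Defining `T` by transport of `D_1` along `δ` makes the invariance of the Helmholtz space
    -- automatic. That `T` acts as `DTilde` is then `varL_DCE_zero` on representatives.
    let T : helmholtz n →ₗ[ℝ] helmholtz n := δ.toLinearMap ∘ₗ D1 n n ∘ₗ δ.symm.toLinearMap
    have hT : ∀ z, T (δ z) = δ (D1 n n z) := fun z =>
      congrArg (fun y => δ (D1 n n y)) (δ.symm_apply_apply z)
    have hrange : (LinearMap.range (D1 n n)).map δ.toLinearMap = LinearMap.range T := by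
      rw [← LinearMap.range_comp]
      ext χ
      constructor
      · rintro ⟨z, rfl⟩
        exact ⟨δ z, hT z⟩
      · rintro ⟨χ, rfl⟩
        exact ⟨δ.symm χ, rfl⟩
    refine ⟨δ, T, fun θ hθ => (varDeriv_eq_varL _).symm, fun χ => ?_,
      Submodule.Quotient.equiv _ _ δ hrange, fun z => rfl⟩
    obtain ⟨z, rfl⟩ := δ.surjective χ
    obtain ⟨⟨θ, hθ⟩, rfl⟩ := Submodule.Quotient.mk_surjective _ z
    rw [hT]
    exact varL_DCE_zero (topCoeff θ)
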